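/- Let $\Bbbk$ be a commutative ring. All categories below are strict $\Bbbk$-linear monoidal categories generated by two objects $\uparrow,\downarrow$ and by morphisms and relations; $\circ$ is vertical and $\otimes$ horizontal composition, $1$ denotes identities and $\mathbb 1$ the unit object. For $s:\uparrow\uparrow\to\uparrow\uparrow$, $c:\mathbb 1\to\downarrow\uparrow$, $d:\uparrow\downarrow\to\mathbb 1$, $c':\mathbb 1\to\uparrow\downarrow$, $d':\downarrow\uparrow\to\mathbb 1$ put $$t=(1_{\downarrow\uparrow}\otimes d)\circ(1_\downarrow\otimes s\otimes1_\downarrow)\circ(c\otimes1_{\uparrow\downarrow}):\uparrow\downarrow\to\downarrow\uparrow,\qquad \tau=(d'\otimes1_{\uparrow\downarrow})\circ(1_\downarrow\otimes s\otimes1_\downarrow)\circ(1_{\downarrow\uparrow}\otimes c'):\downarrow\uparrow\to\uparrow\downarrow .$$ Consider the relations: (S) $s^2=1$ and $(s\otimes1_\uparrow)(1_\uparrow\otimes s)(s\otimes1_\uparrow)=(1_\uparrow\otimes s)(s\otimes1_\uparrow)(1_\uparrow\otimes s)$; (H) $(x\otimes1_\uparrow)\circ s-s\circ(1_\uparrow\otimes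 x)=1_{\uparrow\uparrow}$, where $x:\uparrow\to\uparrow$; (R) $(d\otimes1_\uparrow)(1_\uparrow\otimes c)=1_\uparrow$ and $(1_\downarrow\otimes d)(c\otimes1_\downarrow)=1_\downarrow$; (L) $(1_\uparrow\otimes d')(c'\otimes1_\uparrow)=1_\uparrow$ and $(d'\otimes1_\downarrow)(1_\downarrow\otimes c')=1_\downarrow$; (C$_x$), (C$_s$) the $180^\circ$ rotation of $x$ (respectively $s$) formed with $c,d$ equals the one formed with $c',d'$ (nested cups and caps being used for $s$). **Heisenberg category.** For an integer $k=-m<0$, $\mathcal{H}eis_k$ is generated by $x:\uparrow\to\uparrow$, $s,c,d$ subject to (S), (H), (R) and the inversion relation: the matrix $[\,t,\ c,\ (1_\downarrow\otimes x)c,\ \dots,\ (1_\downarrow\otimes x^{m-1})c\,]:\uparrow\downarrow\oplus\mathbb 1^{\oplus m}\to\downarrow\uparrow$ is invertible in the additive envelope, that is, the entries $t',e_0,\dots,e_{m-1}$ of a two-sided inverse of it are adjoined. Let $d':=e_{m-1}$ be the last entry of the inverse and $c':=t'\circ(1_\downarrow\otimes x^m)\circ c$. For $\delta\in\Bbbk$,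 $\mathcal{H}eis_k(\delta)$ is obtained from $\mathcal{H}eis_k$ by imposing $d'\circ(1_\downarrow\otimes x^m)\circ c=\delta 1_{\mathbb 1}$. **Mackaay–Savage category.** Let $\lambda=\sum_i\lambda_i\omega_i\neq0$ be a dominant weight for $\mathfrak{sl}_\infty$ ($i\in\mathbb Z$), or for $\widehat{\mathfrak{sl}}_p$ ($i\in\mathbb Z/p$) with $\Bbbk$ a $\mathbb Z/p$-algebra, and put $m=\sum_i\lambda_i$, $\delta=\sum_i i\lambda_i\in\Bbbk$. Then $\tilde{\mathcal H}^\lambda$ is the additive envelope of the category of dotted oriented planar diagrams up to isotopy, generated by $x,s,c,d,c',d'$ with isotopy relations (R), (L), (C$_x$), (C$_s$), subject to the local relations (S), (H), and, with $b_r:=d'\circ(1_\downarrow\otimes x^r)\circ c$, $c_0:=1$ and $c_n:=-\sum_{j=1}^n b_{m-1+j}\,c_{n-j}$, $$\tau\circ t=1_{\uparrow\downarrow},\qquad t\circ\tau=1_{\downarrow\uparrow}-\sum_{\substack{r,q\ge0\\ r+q\le m-1}}c_{m-1-r-q}\otimes\bigl((1_\downarrow\otimes x^q)\circ c\circ d'\circ(1_\downarrow\otimes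 x^r)\bigr),$$ $$(d'\otimes1_\uparrow)(1_\downarrow\otimes s)(c\otimes1_\uparrow)=0,\qquad b_r=\delta_{r,m-1}1_{\mathbb 1}\ (0\le r<m),\qquad b_m=\delta 1_{\mathbb 1}.$$ **Khovanov's category.** $\mathcal H$ is the additive envelope of the category of oriented planar diagrams up to isotopy, generated by $s,c,d,c',d'$ with isotopy relations (R), (L), (C$_s$), subject to the local relations (S), $\tau\circ t=1_{\uparrow\downarrow}$, $t\circ\tau=1_{\downarrow\uparrow}-c\circ d'$, $(d'\otimes1_\uparrow)(1_\downarrow\otimes s)(c\otimes1_\uparrow)=0$ and $d'\circ c=1_{\mathbb 1}$. **Theorem 3.** For every $\lambda$ as above, with $k:=-\sum_i\lambda_i$ and $\delta:=\sum_i i\lambda_i$, there is an isomorphism of $\Bbbk$-linear monoidal categories (a strict monoidal $\Bbbk$-linear functor, bijective on objects and on morphisms) from the additive envelope of $\mathcal{H}eis_k(\delta)$ to $\tilde{\mathcal H}^\lambda$, sending $x,s,c,d,c',d'$ to the morphisms with the same names. Likewise there is an isomorphism of $\Bbbk$-linear monoidal categories from the additive envelope of $\mathcal{H}eis_{-1}(0)$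 to Khovanov's category $\mathcal H$, sending $s,c,d,c',d'$ to the morphisms with the same names and $x$ to the right curl $(1_\uparrow\otimes d)(s\otimes1_\downarrow)(1_\uparrow\otimes c')$. Moreover the cyclicity relation (C$_s$) in the definition of $\mathcal H$ is redundant: it is implied by the other relations, i.e. two diagrams that are equal in $\mathcal H$ are already equal in the category defined without (C$_s$). -/

import Mathlib

open CategoryTheory MonoidalCategory

universe u v w

namespace HeisenbergCategory

/-! ### Strict linear monoidal categories by generators and relations -/

/-- The two generating objects `↑` and `↓`. -/
inductive Ori : Type
  | up
  | dn

/-- Objects of the strict monoidal category generated by `↑` and `↓` are words; the tensor product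
is concatenation. -/
abbrev Word : Type := List Ori

/-- Formal `R`-linear combinations of formal string diagrams over generating morphisms `G`:
`seq f g` is `f` followed by `g` (`g` drawn above `f`), `beside f g` is `f` drawn to the left of
`g`. -/
inductive Diag (R : Type u) (G : Word → Word → Type) : Word → Word → Type u
  | gen {a b : Word} (g : G a b) : Diag R G a b
  | idd (a : Word) : Diag R G a a
  | seq {a b c : Word} (f : Diag R G a b) (g : Diag R G b c) : Diag R G a c
  | beside {a b a' b' : Word} (f : Diag R G a b) (g : Diag R G a' b') :
      Diag R G (a ++ a') (b ++ b')
  | zero (a b : Word) : Diag R G a b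
  | add {a b : Word} (f g : Diag R G a b) : Diag R G a b
  | smul {a b : Word} (r : R) (f : Diag R G a b) : Diag R G a b

infixl:65 " ⨾ " => Diag.seq
infixl:75 " ⊠ " => Diag.beside

/-- A set of relations between parallel diagrams. -/
abbrev Relations (R : Type u) (G : Word → Word → Type) : Type u :=
  ∀ ⦃a b : Word⦄, Diag R G a b → Diag R G a b → Prop

/-- The congruence generated by `rel` and the axioms of strict `R`-linear monoidal categories.
It relates diagrams whose source and target words are equal only propositionally, so that strict
associativity and unitality of `⊠` can be imposed without transporting along equalities. -/
inductive Cong {R : Type u} [CommRing R] {G : Word → Word → Type} (rel : Relations R G) :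
    ∀ {a b a' b' : Word}, Diag R G a b → Diag R G a' b' → Prop
  -- the given relations
  | of {a b : Word} {f g : Diag R G a b} : rel f g → Cong rel f g
  -- equivalence relation
  | refl {a b : Word} (f : Diag R G a b) : Cong rel f f
  | symm {a b a' b' : Word} {f : Diag R G a b} {g : Diag R G a' b'} : Cong rel f g → Cong rel g f
  | trans {a b a' b' a'' b'' : Word} {f : Diag R G a b} {g : Diag R G a' b'}
      {h : Diag R G a'' b''} : Cong rel f g → Cong rel g h → Cong rel f h
  -- compatibility with the operations
  | seq {a b c a' b' c' : Word} {f : Diag R G a b} {g : Diag R G b c}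
      {f' : Diag R G a' b'} {g' : Diag R G b' c'} :
      Cong rel f f' → Cong rel g g' → Cong rel (f ⨾ g) (f' ⨾ g')
  | beside {a b c d a' b' c' d' : Word} {f : Diag R G a b} {g : Diag R G c d}
      {f' : Diag R G a' b'} {g' : Diag R G c' d'} :
      Cong rel f f' → Cong rel g g' → Cong rel (f ⊠ g) (f' ⊠ g')
  | add {a b a' b' : Word} {f g : Diag R G a b} {f' g' : Diag R G a' b'} :
      Cong rel f f' → Cong rel g g' → Cong rel (f.add g) (f'.add g')
  | smul {a b a' b' : Word} (r : R) {f : Diag R G a b} {f' : Diag R G a' b'} :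
      Cong rel f f' → Cong rel (f.smul r) (f'.smul r)
  -- category
  | idd_seq {a b : Word} (f : Diag R G a b) : Cong rel (Diag.idd a ⨾ f) f
  | seq_idd {a b : Word} (f : Diag R G a b) : Cong rel (f ⨾ Diag.idd b) f
  | seq_assoc {a b c d : Word} (f : Diag R G a b) (g : Diag R G b c) (h : Diag R G c d) :
      Cong rel (f ⨾ g ⨾ h) (f ⨾ (g ⨾ h))
  -- strict monoidal category
  | idd_beside_idd (a b : Word) :
      Cong rel ((Diag.idd a : Diag R G a a) ⊠ (Diag.idd b : Diag R G b b)) (Diag.idd (a ++ b))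
  | interchange {a b c a' b' c' : Word} (f : Diag R G a b) (g : Diag R G b c)
      (f' : Diag R G a' b') (g' : Diag R G b' c') :
      Cong rel ((f ⊠ f') ⨾ (g ⊠ g')) ((f ⨾ g) ⊠ (f' ⨾ g'))
  | beside_assoc {a b c d a' b' : Word} (f : Diag R G a b) (g : Diag R G c d)
      (h : Diag R G a' b') : Cong rel (f ⊠ g ⊠ h) (f ⊠ (g ⊠ h))
  | one_beside {a b : Word} (f : Diag R G a b) : Cong rel (Diag.idd [] ⊠ f) f
  | beside_one {a b : Word} (f : Diag R G a b) : Cong rel (f ⊠ Diag.idd []) f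
  -- morphism spaces are modules
  | add_comm {a b : Word} (f g : Diag R G a b) : Cong rel (f.add g) (g.add f)
  | add_assoc {a b : Word} (f g h : Diag R G a b) :
      Cong rel ((f.add g).add h) (f.add (g.add h))
  | zero_add {a b : Word} (f : Diag R G a b) : Cong rel ((Diag.zero a b).add f) f
  | neg_add {a b : Word} (f : Diag R G a b) : Cong rel ((f.smul (-1)).add f) (Diag.zero a b)
  | one_smul {a b : Word} (f : Diag R G a b) : Cong rel (f.smul 1) f
  | mul_smul {a b : Word} (r s : R) (f : Diag R G a b) :
      Cong rel (f.smul (r * s)) ((f.smul s).smul r)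
  | smul_add {a b : Word} (r : R) (f g : Diag R G a b) :
      Cong rel ((f.add g).smul r) ((f.smul r).add (g.smul r))
  | add_smul {a b : Word} (r s : R) (f : Diag R G a b) :
      Cong rel (f.smul (r + s)) ((f.smul r).add (f.smul s))
  -- composition and tensor product are bilinear
  | add_seq {a b c : Word} (f g : Diag R G a b) (h : Diag R G b c) :
      Cong rel (f.add g ⨾ h) ((f ⨾ h).add (g ⨾ h))
  | seq_add {a b c : Word} (f : Diag R G a b) (g h : Diag R G b c) :
      Cong rel (f ⨾ g.add h) ((f ⨾ g).add (f ⨾ h))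
  | smul_seq {a b c : Word} (r : R) (f : Diag R G a b) (g : Diag R G b c) :
      Cong rel (f.smul r ⨾ g) ((f ⨾ g).smul r)
  | seq_smul {a b c : Word} (r : R) (f : Diag R G a b) (g : Diag R G b c) :
      Cong rel (f ⨾ g.smul r) ((f ⨾ g).smul r)
  | add_beside {a b c d : Word} (f g : Diag R G a b) (h : Diag R G c d) :
      Cong rel (f.add g ⊠ h) ((f ⊠ h).add (g ⊠ h))
  | beside_add {a b c d : Word} (f : Diag R G a b) (g h : Diag R G c d) :
      Cong rel (f ⊠ g.add h) ((f ⊠ g).add (f ⊠ h))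
  | smul_beside {a b c d : Word} (r : R) (f : Diag R G a b) (g : Diag R G c d) :
      Cong rel (f.smul r ⊠ g) ((f ⊠ g).smul r)
  | beside_smul {a b c d : Word} (r : R) (f : Diag R G a b) (g : Diag R G c d) :
      Cong rel (f ⊠ g.smul r) ((f ⊠ g).smul r)

/-- The strict `R`-linear monoidal category with generating objects `↑` and `↓`, generating
morphisms `G` and defining relations `rel`. -/
structure Pres {R : Type u} [CommRing R] {G : Word → Word → Type} (rel : Relations R G) :
    Type where
  word : Word

namespace Pres

variable {R : Type u} [CommRing R] {G : Word → Word → Type} {rel : Relations R G}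

/-- Two parallel diagrams are identified when they are congruent. -/
def homSetoid (rel : Relations R G) (a b : Word) : Setoid (Diag R G a b) where
  r f g := Cong rel f g
  iseqv := ⟨Cong.refl, Cong.symm, Cong.trans⟩

/-- Morphisms of the presented category. -/
def Hom (X Y : Pres rel) : Type u := Quotient (homSetoid rel X.word Y.word)

instance instCategory : Category.{u} (Pres rel) where
  Hom X Y := Hom X Y
  id X := Quotient.mk (homSetoid rel X.word X.word) (Diag.idd X.word)
  comp {X Y Z} f g := Quotient.map₂ (sb := homSetoid rel Y.word Z.word)
    (fun f g => f ⨾ g) (fun _ _ hf _ _ hg => Cong.seq hf hg) f g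
  id_comp f := by
    induction f using Quotient.inductionOn
    exact Quotient.sound (Cong.idd_seq _)
  comp_id f := by
    induction f using Quotient.inductionOn
    exact Quotient.sound (Cong.seq_idd _)
  assoc f g h := by
    induction f using Quotient.inductionOn
    induction g using Quotient.inductionOn
    induction h using Quotient.inductionOn
    exact Quotient.sound (Cong.seq_assoc _ _ _)

/-- The morphism represented by a diagram. -/
def mor (rel : Relations R G) {a b : Word} (f : Diag R G a b) :
    (⟨a⟩ : Pres rel) ⟶ (⟨b⟩ : Pres rel) :=
  Quotient.mk (homSetoid rel a b) f

theorem mor_surjective {a b : Word} (f : (⟨a⟩ : Pres rel) ⟶ (⟨b⟩ : Pres rel)) :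
    ∃ f' : Diag R G a b, mor rel f' = f :=
  Quotient.exists_rep (s := homSetoid rel a b) f

theorem mor_eq {a b : Word} {f g : Diag R G a b} (h : Cong rel f g) : mor rel f = mor rel g :=
  Quotient.sound (s := homSetoid rel a b) h

theorem mor_seq {a b c : Word} (f : Diag R G a b) (g : Diag R G b c) :
    mor rel f ≫ mor rel g = mor rel (f ⨾ g) := rfl

theorem mor_idd (a : Word) : mor rel (Diag.idd a) = 𝟙 (⟨a⟩ : Pres rel) := rfl

theorem mor_eq_eqToHom {a b a' b' : Word} (ha : a = a') (hb : b = b') (f : Diag R G a b)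
    (g : Diag R G a' b') (h : Cong rel f g) :
    mor rel f ≫ eqToHom (congrArg Pres.mk hb) =
      eqToHom (congrArg Pres.mk ha) ≫ mor rel g := by
  cases ha
  cases hb
  simpa using mor_eq h

instance instAdd (X Y : Pres rel) : Add (X ⟶ Y) where
  add := Quotient.map₂ (sa := homSetoid rel X.word Y.word) (sb := homSetoid rel X.word Y.word)
    (sc := homSetoid rel X.word Y.word)
    (fun f g => f.add g) (fun _ _ hf _ _ hg => Cong.add hf hg)

instance instZero (X Y : Pres rel) : Zero (X ⟶ Y) where
  zero := mor rel (Diag.zero X.word Y.word)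

instance instNeg (X Y : Pres rel) : Neg (X ⟶ Y) where
  neg := Quotient.map (sa := homSetoid rel X.word Y.word) (sb := homSetoid rel X.word Y.word)
    (fun f => f.smul (-1)) (fun _ _ hf => Cong.smul _ hf)

instance instAddCommGroup (X Y : Pres rel) : AddCommGroup (X ⟶ Y) where
  add_assoc f g h := by
    induction f using Quotient.inductionOn
    induction g using Quotient.inductionOn
    induction h using Quotient.inductionOn
    exact Quotient.sound (Cong.add_assoc _ _ _)
  zero_add f := by
    induction f using Quotient.inductionOn
    exact Quotient.sound (Cong.zero_add _)
  add_zero f := by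
    induction f using Quotient.inductionOn
    exact Quotient.sound ((Cong.add_comm _ _).trans (Cong.zero_add _))
  add_comm f g := by
    induction f using Quotient.inductionOn
    induction g using Quotient.inductionOn
    exact Quotient.sound (Cong.add_comm _ _)
  neg_add_cancel f := by
    induction f using Quotient.inductionOn
    exact Quotient.sound (Cong.neg_add _)
  nsmul := nsmulRec
  zsmul := zsmulRec

theorem mor_add {a b : Word} (f g : Diag R G a b) :
    mor rel f + mor rel g = mor rel (f.add g) := rfl

instance instPreadditive : Preadditive (Pres rel) where
  add_comp X Y Z f g h := by
    induction f using Quotient.inductionOn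
    induction g using Quotient.inductionOn
    induction h using Quotient.inductionOn
    exact Quotient.sound (Cong.add_seq _ _ _)
  comp_add X Y Z f g h := by
    induction f using Quotient.inductionOn
    induction g using Quotient.inductionOn
    induction h using Quotient.inductionOn
    exact Quotient.sound (Cong.seq_add _ _ _)

instance instSMul (X Y : Pres rel) : SMul R (X ⟶ Y) where
  smul r := Quotient.map (sa := homSetoid rel X.word Y.word) (sb := homSetoid rel X.word Y.word)
    (fun f => f.smul r) (fun _ _ hf => Cong.smul _ hf)

theorem mor_smul {a b : Word} (r : R) (f : Diag R G a b) :
    r • mor rel f = mor rel (f.smul r) := rfl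

instance instModule (X Y : Pres rel) : Module R (X ⟶ Y) :=
  Module.ofMinimalAxioms
    (fun r f g => by
      induction f using Quotient.inductionOn
      induction g using Quotient.inductionOn
      exact Quotient.sound (Cong.smul_add _ _ _))
    (fun r s f => by
      induction f using Quotient.inductionOn
      exact Quotient.sound (Cong.add_smul _ _ _))
    (fun r s f => by
      induction f using Quotient.inductionOn
      exact Quotient.sound (Cong.mul_smul _ _ _))
    (fun f => by
      induction f using Quotient.inductionOn
      exact Quotient.sound (Cong.one_smul _))

instance instLinear : Linear R (Pres rel) where
  homModule := instModule
  smul_comp X Y Z r f g := by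
    induction f using Quotient.inductionOn
    induction g using Quotient.inductionOn
    exact Quotient.sound (Cong.smul_seq _ _ _)
  comp_smul X Y Z f r g := by
    induction f using Quotient.inductionOn
    induction g using Quotient.inductionOn
    exact Quotient.sound (Cong.seq_smul _ _ _)

/-- Horizontal composition of morphisms. -/
def tensorHom' {X Y X' Y' : Pres rel} (f : X ⟶ Y) (g : X' ⟶ Y') :
    (⟨X.word ++ X'.word⟩ : Pres rel) ⟶ ⟨Y.word ++ Y'.word⟩ :=
  Quotient.map₂ (sa := homSetoid rel X.word Y.word) (sb := homSetoid rel X'.word Y'.word)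
    (sc := homSetoid rel (X.word ++ X'.word) (Y.word ++ Y'.word))
    (fun f g => f ⊠ g) (fun _ _ hf _ _ hg => Cong.beside hf hg) f g

instance instMonoidalCategoryStruct : MonoidalCategoryStruct (Pres rel) where
  tensorObj X Y := ⟨X.word ++ Y.word⟩
  tensorUnit := ⟨[]⟩
  tensorHom f g := tensorHom' f g
  whiskerLeft X _ _ f := tensorHom' (𝟙 X) f
  whiskerRight f X := tensorHom' f (𝟙 X)
  associator X Y Z := eqToIso (congrArg Pres.mk (List.append_assoc X.word Y.word Z.word))
  leftUnitor X := eqToIso (congrArg Pres.mk (List.nil_append X.word))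
  rightUnitor X := eqToIso (congrArg Pres.mk (List.append_nil X.word))

theorem mor_beside {a b a' b' : Word} (f : Diag R G a b) (g : Diag R G a' b') :
    mor rel f ⊗ₘ mor rel g = mor rel (f ⊠ g) := rfl

theorem id_tensor_id (X Y : Pres rel) : (𝟙 X ⊗ₘ 𝟙 Y) = 𝟙 (X ⊗ Y) :=
  Quotient.sound (Cong.idd_beside_idd _ _)

theorem eqToHom_tensor_id {X Y : Pres rel} (h : X = Y) (Z : Pres rel) :
    (eqToHom h ⊗ₘ 𝟙 Z) = eqToHom (congrArg (· ⊗ Z) h) := by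
  cases h
  exact id_tensor_id _ _

theorem id_tensor_eqToHom {X Y : Pres rel} (h : X = Y) (Z : Pres rel) :
    (𝟙 Z ⊗ₘ eqToHom h) = eqToHom (congrArg (Z ⊗ ·) h) := by
  cases h
  exact id_tensor_id _ _

instance instMonoidalCategory : MonoidalCategory (Pres rel) :=
  MonoidalCategory.ofTensorHom
    (id_tensorHom_id := id_tensor_id)
    (id_tensorHom := fun _ _ _ _ => rfl)
    (tensorHom_id := fun _ _ => rfl)
    (tensorHom_comp_tensorHom := fun f₁ f₂ g₁ g₂ => by
      induction f₁ using Quotient.inductionOn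
      induction f₂ using Quotient.inductionOn
      induction g₁ using Quotient.inductionOn
      induction g₂ using Quotient.inductionOn
      exact Quotient.sound (Cong.interchange _ _ _ _))
    (associator_naturality := fun {X₁ X₂ X₃ Y₁ Y₂ Y₃} f₁ f₂ f₃ => by
      obtain ⟨f₁, rfl⟩ := mor_surjective f₁
      obtain ⟨f₂, rfl⟩ := mor_surjective f₂
      obtain ⟨f₃, rfl⟩ := mor_surjective f₃
      exact mor_eq_eqToHom (List.append_assoc X₁.word X₂.word X₃.word)
        (List.append_assoc Y₁.word Y₂.word Y₃.word) _ _ (Cong.beside_assoc f₁ f₂ f₃))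
    (leftUnitor_naturality := fun {X Y} f => by
      obtain ⟨f, rfl⟩ := mor_surjective f
      exact mor_eq_eqToHom (List.nil_append X.word) (List.nil_append Y.word) _ _
        (Cong.one_beside f))
    (rightUnitor_naturality := fun {X Y} f => by
      obtain ⟨f, rfl⟩ := mor_surjective f
      exact mor_eq_eqToHom (List.append_nil X.word) (List.append_nil Y.word) _ _
        (Cong.beside_one f))
    (pentagon := fun W X Y Z => by
      change (eqToHom (congrArg Pres.mk (List.append_assoc W.word X.word Y.word)) ⊗ₘ 𝟙 Z) ≫
        eqToHom (congrArg Pres.mk (List.append_assoc W.word (X.word ++ Y.word) Z.word)) ≫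
        (𝟙 W ⊗ₘ eqToHom (congrArg Pres.mk (List.append_assoc X.word Y.word Z.word))) =
        eqToHom (congrArg Pres.mk (List.append_assoc (W.word ++ X.word) Y.word Z.word)) ≫
        eqToHom (congrArg Pres.mk (List.append_assoc W.word X.word (Y.word ++ Z.word)))
      rw [eqToHom_tensor_id, id_tensor_eqToHom]
      exact (congrArg _ (eqToHom_trans _ _)).trans
        ((eqToHom_trans _ _).trans (eqToHom_trans _ _).symm))
    (triangle := fun X Y => by
      change eqToHom (congrArg Pres.mk (List.append_assoc X.word [] Y.word)) ≫
        (𝟙 X ⊗ₘ eqToHom (congrArg Pres.mk (List.nil_append Y.word))) =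
        (eqToHom (congrArg Pres.mk (List.append_nil X.word)) ⊗ₘ 𝟙 Y)
      rw [eqToHom_tensor_id, id_tensor_eqToHom]
      exact eqToHom_trans _ _)

theorem tensor_add' {X Y X' Y' : Pres rel} (f : X ⟶ Y) (g h : X' ⟶ Y') :
    (f ⊗ₘ (g + h)) = (f ⊗ₘ g) + (f ⊗ₘ h) := by
  induction f using Quotient.inductionOn
  induction g using Quotient.inductionOn
  induction h using Quotient.inductionOn
  exact Quotient.sound (Cong.beside_add _ _ _)

theorem add_tensor' {X Y X' Y' : Pres rel} (f g : X ⟶ Y) (h : X' ⟶ Y') :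
    ((f + g) ⊗ₘ h) = (f ⊗ₘ h) + (g ⊗ₘ h) := by
  induction f using Quotient.inductionOn
  induction g using Quotient.inductionOn
  induction h using Quotient.inductionOn
  exact Quotient.sound (Cong.add_beside _ _ _)

instance instMonoidalPreadditive : MonoidalPreadditive (Pres rel) where
  whiskerLeft_add f g := tensor_add' _ f g
  add_whiskerRight f g := add_tensor' f g _
  whiskerLeft_zero {X Y Z} := by
    have h := tensor_add' (𝟙 X) (0 : Y ⟶ Z) 0
    rw [add_zero] at h
    exact (add_eq_left.mp h.symm)
  zero_whiskerRight {X Y Z} := by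
    have h := add_tensor' (0 : Y ⟶ Z) 0 (𝟙 X)
    rw [add_zero] at h
    exact (add_eq_left.mp h.symm)

instance instMonoidalLinear : MonoidalLinear R (Pres rel) where
  whiskerLeft_smul X Y Z r f := by
    induction f using Quotient.inductionOn
    exact Quotient.sound (Cong.beside_smul _ _ _)
  smul_whiskerRight r Y Z f X := by
    induction f using Quotient.inductionOn
    exact Quotient.sound (Cong.smul_beside _ _ _)

end Pres


/-! ### The monoidal structure on the additive envelope

`Mat_ C` is the additive envelope of `C`: objects are finite families of objects of `C` (formal
direct sums) and morphisms are matrices.  The tensor product of `C` extends biadditively. -/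

namespace AdditiveEnvelope

variable {C : Type v} [Category.{w} C] [Preadditive C]

noncomputable section

section Linear

variable {R : Type u} [CommRing R] [Linear R C]

instance instModule (M N : Mat_ C) : Module R (M ⟶ N) :=
  inferInstanceAs (Module R (∀ (i : M.ι) (j : N.ι), M.X i ⟶ N.X j))

theorem smul_apply (r : R) {M N : Mat_ C} (f : M ⟶ N) (i : M.ι) (j : N.ι) :
    (r • f) i j = r • f i j := rfl

instance instLinear : Linear R (Mat_ C) where
  homModule := instModule
  smul_comp X Y Z r f g := by
    ext i j
    simp [smul_apply, Finset.smul_sum]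
  comp_smul X Y Z f r g := by
    ext i j
    simp [smul_apply, Finset.smul_sum]

end Linear

open scoped Classical in
/-- The morphism of formal direct sums which sends the `i`-th summand to the `e i`-th summand by
`φ i`. -/
def reindex {M N : Mat_ C} (e : M.ι → N.ι) (φ : ∀ i, M.X i ⟶ N.X (e i)) : M ⟶ N :=
  fun i j => if h : e i = j then φ i ≫ eqToHom (congrArg N.X h) else 0

theorem reindex_self {M N : Mat_ C} (e : M.ι → N.ι) (φ : ∀ i, M.X i ⟶ N.X (e i)) (i : M.ι) :
    reindex e φ i (e i) = φ i := by
  simp [reindex]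

theorem reindex_of_ne {M N : Mat_ C} (e : M.ι → N.ι) (φ : ∀ i, M.X i ⟶ N.X (e i)) {i : M.ι}
    {j : N.ι} (h : e i ≠ j) : reindex e φ i j = 0 := by
  simp [reindex, h]

theorem reindex_comp_apply {M N K : Mat_ C} (e : M.ι → N.ι) (φ : ∀ i, M.X i ⟶ N.X (e i))
    (g : N ⟶ K) (i : M.ι) (k : K.ι) : (reindex e φ ≫ g) i k = φ i ≫ g (e i) k := by
  rw [Mat_.comp_apply, Finset.sum_eq_single (e i), reindex_self]
  · intro j _ hj
    rw [reindex_of_ne _ _ hj.symm, Limits.zero_comp]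
  · simp

theorem comp_reindex_apply {M N K : Mat_ C} (f : M ⟶ N) (e : N.ι ≃ K.ι)
    (φ : ∀ i, N.X i ⟶ K.X (e i)) (i : M.ι) (j : N.ι) :
    (f ≫ reindex e φ) i (e j) = f i j ≫ φ j := by
  rw [Mat_.comp_apply, Finset.sum_eq_single j, reindex_self]
  · intro k _ hk
    rw [reindex_of_ne _ _ (fun h => hk (e.injective h)), Limits.comp_zero]
  · simp

theorem reindex_comp_reindex {M N K : Mat_ C} (e : M.ι → N.ι) (φ : ∀ i, M.X i ⟶ N.X (e i))
    (e' : N.ι → K.ι) (ψ : ∀ i, N.X i ⟶ K.X (e' i)) :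
    reindex e φ ≫ reindex e' ψ =
      reindex (fun i => e' (e i)) (fun i => φ i ≫ ψ (e i)) := by
  ext i k
  rw [reindex_comp_apply]
  by_cases h : e' (e i) = k
  · subst h
    rw [reindex_self, reindex_self (fun i => e' (e i))]
  · rw [reindex_of_ne _ _ h, reindex_of_ne (fun i => e' (e i)) _ h, Limits.comp_zero]

theorem reindex_id (M : Mat_ C) : reindex (fun i => i) (fun i => 𝟙 (M.X i)) = 𝟙 M := by
  ext i j
  by_cases h : i = j
  · subst h
    rw [reindex_self (fun i => i), Mat_.id_apply_self]
  · rw [reindex_of_ne (fun i => i) _ h, Mat_.id_apply_of_ne _ _ _ h]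

/-- Relabelling the summands of a formal direct sum along a bijection and isomorphisms. -/
def reindexIso {M N : Mat_ C} (e : M.ι ≃ N.ι) (φ : ∀ i, M.X i ≅ N.X (e i)) : M ≅ N where
  hom := reindex e (fun i => (φ i).hom)
  inv := reindex e.symm (fun j => eqToHom (congrArg N.X (e.apply_symm_apply j).symm) ≫
    (φ (e.symm j)).inv)
  hom_inv_id := by
    ext i j
    rw [reindex_comp_apply]
    by_cases h : i = j
    · subst h
      rw [Mat_.id_apply_self]
      simp only [reindex]
      rw [dif_pos (e.symm_apply_apply i)]
      have key : ∀ (i' : M.ι) (h : i' = i) (h' : N.X (e i) = N.X (e i')),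
          (φ i).hom ≫ (eqToHom h' ≫ (φ i').inv) ≫ eqToHom (congrArg M.X h) = 𝟙 _ := by
        intro i' h h'
        subst h
        simp
      exact key _ (e.symm_apply_apply i) _
    · rw [Mat_.id_apply_of_ne _ _ _ h, reindex_of_ne, Limits.comp_zero]
      simpa using h
  inv_hom_id := by
    rw [reindex_comp_reindex, ← reindex_id]
    ext i j
    by_cases h : i = j
    · simp [reindex, h]
    · have h' : ¬ e (e.symm i) = j := by rwa [e.apply_symm_apply]
      rw [reindex_of_ne (fun i => i) _ h, reindex_of_ne (fun i => e (e.symm i)) _ h']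

variable [MonoidalCategory C]

instance instMonoidalCategoryStruct : MonoidalCategoryStruct (Mat_ C) where
  tensorObj M N := ⟨M.ι × N.ι, fun p => M.X p.1 ⊗ N.X p.2⟩
  tensorUnit := ⟨Unit, fun _ => 𝟙_ C⟩
  tensorHom f g := fun p q => f p.1 q.1 ⊗ₘ g p.2 q.2
  whiskerLeft M _ _ g := fun p q => (𝟙 M : M ⟶ M) p.1 q.1 ⊗ₘ g p.2 q.2
  whiskerRight f N := fun p q => f p.1 q.1 ⊗ₘ (𝟙 N : N ⟶ N) p.2 q.2
  associator M N K := reindexIso (Equiv.prodAssoc M.ι N.ι K.ι)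
    (fun p => α_ (M.X p.1.1) (N.X p.1.2) (K.X p.2))
  leftUnitor M := reindexIso (Equiv.punitProd M.ι) (fun p => λ_ (M.X p.2))
  rightUnitor M := reindexIso (Equiv.prodPUnit M.ι) (fun p => ρ_ (M.X p.1))

theorem tensorHom_apply {M N M' N' : Mat_ C} (f : M ⟶ N) (g : M' ⟶ N') (p : M.ι × M'.ι)
    (q : N.ι × N'.ι) : (f ⊗ₘ g) p q = f p.1 q.1 ⊗ₘ g p.2 q.2 := rfl

variable [MonoidalPreadditive C]

theorem reindex_tensor_reindex {M N M' N' : Mat_ C} (e : M.ι → N.ι)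
    (φ : ∀ i, M.X i ⟶ N.X (e i)) (e' : M'.ι → N'.ι) (φ' : ∀ i, M'.X i ⟶ N'.X (e' i)) :
    (reindex e φ ⊗ₘ reindex e' φ') =
      reindex (M := M ⊗ M') (N := N ⊗ N') (fun p => (e p.1, e' p.2))
        (fun p => φ p.1 ⊗ₘ φ' p.2) := by
  ext ⟨i, i'⟩ ⟨j, j'⟩
  rw [tensorHom_apply]
  by_cases h : e i = j
  · by_cases h' : e' i' = j'
    · subst h
      subst h'
      exact (congrArg₂ _ (reindex_self e φ i) (reindex_self e' φ' i')).trans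
        (reindex_self (M := M ⊗ M') (N := N ⊗ N') (fun p => (e p.1, e' p.2))
          (fun p => φ p.1 ⊗ₘ φ' p.2) (i, i')).symm
    · rw [reindex_of_ne e' φ' h', MonoidalPreadditive.tensor_zero, reindex_of_ne]
      exact fun h => h' (congrArg Prod.snd h)
  · rw [reindex_of_ne e φ h, MonoidalPreadditive.zero_tensor, reindex_of_ne]
    exact fun h' => h (congrArg Prod.fst h')

theorem id_tensor_id (M N : Mat_ C) : (𝟙 M ⊗ₘ 𝟙 N) = 𝟙 (M ⊗ N) := by
  rw [← reindex_id M, ← reindex_id N, reindex_tensor_reindex, ← reindex_id]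
  congr 1
  funext p
  exact id_tensorHom_id _ _

theorem tensor_comp_tensor {M N K M' N' K' : Mat_ C} (f : M ⟶ N) (f' : M' ⟶ N') (g : N ⟶ K)
    (g' : N' ⟶ K') : (f ⊗ₘ f') ≫ (g ⊗ₘ g') = (f ≫ g) ⊗ₘ (f' ≫ g') := by
  ext ⟨i, i'⟩ ⟨k, k'⟩
  rw [tensorHom_apply, Mat_.comp_apply, Mat_.comp_apply, Mat_.comp_apply,
    sum_tensor]
  simp_rw [tensor_sum, ← tensorHom_comp_tensorHom]
  exact Fintype.sum_prod_type _

instance instMonoidalCategory : MonoidalCategory (Mat_ C) :=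
  MonoidalCategory.ofTensorHom
    (id_tensorHom_id := id_tensor_id)
    (id_tensorHom := fun _ _ _ _ => rfl)
    (tensorHom_id := fun _ _ => rfl)
    (tensorHom_comp_tensorHom := tensor_comp_tensor)
    (associator_naturality := fun {M₁ M₂ M₃ N₁ N₂ N₃} f₁ f₂ f₃ => by
      ext ⟨⟨i₁, i₂⟩, i₃⟩ ⟨j₁, j₂, j₃⟩
      refine (comp_reindex_apply ((f₁ ⊗ₘ f₂) ⊗ₘ f₃) (Equiv.prodAssoc N₁.ι N₂.ι N₃.ι) _ _
        ((j₁, j₂), j₃)).trans (Eq.trans ?_ (reindex_comp_apply _ _ (f₁ ⊗ₘ f₂ ⊗ₘ f₃) _ _).symm)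
      exact MonoidalCategory.associator_naturality (f₁ i₁ j₁) (f₂ i₂ j₂) (f₃ i₃ j₃))
    (leftUnitor_naturality := fun {M N} f => by
      ext ⟨⟨⟩, i⟩ j
      refine (comp_reindex_apply (𝟙 (𝟙_ (Mat_ C)) ⊗ₘ f) (Equiv.punitProd N.ι) _ _
        ((), j)).trans (Eq.trans ?_ (reindex_comp_apply _ _ f _ _).symm)
      rw [tensorHom_apply, Mat_.id_apply_self]
      exact (congrArg (· ≫ _) (id_tensorHom _ _)).trans
        (MonoidalCategory.leftUnitor_naturality (f i j)))
    (rightUnitor_naturality := fun {M N} f => by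
      ext ⟨i, ⟨⟩⟩ j
      refine (comp_reindex_apply (f ⊗ₘ 𝟙 (𝟙_ (Mat_ C))) (Equiv.prodPUnit N.ι) _ _
        (j, ())).trans (Eq.trans ?_ (reindex_comp_apply _ _ f _ _).symm)
      rw [tensorHom_apply, Mat_.id_apply_self]
      exact (congrArg (· ≫ _) (tensorHom_id _ _)).trans
        (MonoidalCategory.rightUnitor_naturality (f i j)))
    (pentagon := fun M N K L => by
      rw [← reindex_id M, ← reindex_id L]
      simp only [MonoidalCategoryStruct.associator, reindexIso]
      rw [reindex_tensor_reindex, reindex_tensor_reindex, reindex_comp_reindex,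
        reindex_comp_reindex, reindex_comp_reindex]
      congr 1
      funext p
      have h := MonoidalCategory.pentagon (M.X p.1.1.1) (N.X p.1.1.2) (K.X p.1.2) (L.X p.2)
      rw [← id_tensorHom, ← tensorHom_id] at h
      exact h)
    (triangle := fun M N => by
      rw [← reindex_id M, ← reindex_id N]
      simp only [MonoidalCategoryStruct.associator, MonoidalCategoryStruct.leftUnitor,
        MonoidalCategoryStruct.rightUnitor, reindexIso]
      rw [reindex_tensor_reindex, reindex_tensor_reindex, reindex_comp_reindex]
      congr 1
      funext p
      have h := MonoidalCategory.triangle (M.X p.1.1) (N.X p.2)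
      rw [← id_tensorHom, ← tensorHom_id] at h
      exact h)

instance instMonoidalPreadditive : MonoidalPreadditive (Mat_ C) where
  whiskerLeft_zero := by
    intro X Y Z
    ext p q
    exact MonoidalPreadditive.tensor_zero _
  zero_whiskerRight := by
    intro X Y Z
    ext p q
    exact MonoidalPreadditive.zero_tensor _
  whiskerLeft_add := by
    intro X Y Z f g
    ext p q
    exact MonoidalPreadditive.tensor_add _ _ _
  add_whiskerRight := by
    intro X Y Z f g
    ext p q
    exact MonoidalPreadditive.add_tensor _ _ _

end

end AdditiveEnvelope

/-! ### Diagrammatic shorthands -/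

namespace Diag

open Ori

variable {R : Type u} {G : Word → Word → Type}

/-- The diagram `f` with vertical strands added on its left. -/
def padL (u : Word) {a b : Word} (f : Diag R G a b) : Diag R G (u ++ a) (u ++ b) := idd u ⊠ f

/-- The diagram `f` with vertical strands added on its right. -/
def padR {a b : Word} (f : Diag R G a b) (u : Word) : Diag R G (a ++ u) (b ++ u) := f ⊠ idd u

/-- A finite sum of parallel diagrams. -/
def sum {a b : Word} : (n : ℕ) → (Fin n → Diag R G a b) → Diag R G a b
  | 0, _ => Diag.zero a b
  | n + 1, f => (sum n (fun i => f i.castSucc)).add (f (Fin.last n))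

/-- The difference of two parallel diagrams. -/
def sub [CommRing R] {a b : Word} (f g : Diag R G a b) : Diag R G a b := f.add (g.smul (-1))

/-- The `n`-th power of an endomorphism: a dot labelled `n`. -/
def pow {a : Word} (x : Diag R G a a) : ℕ → Diag R G a a
  | 0 => Diag.idd a
  | n + 1 => pow x n ⨾ x

/-- The rightward crossing `↑↓ ⟶ ↓↑`: the upward crossing `s` rotated using the rightward cup `c`
and the rightward cap `d`. -/
def rightCrossing (s : Diag R G [up, up] [up, up]) (c : Diag R G [] [dn, up])
    (d : Diag R G [up, dn] []) : Diag R G [up, dn] [dn, up] :=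
  (padR c [up, dn] :) ⨾ (padR (padL [dn] s) [dn] :) ⨾ (padL [dn, up] d :)

/-- The leftward crossing `↓↑ ⟶ ↑↓`: the upward crossing `s` rotated using the leftward cup `c'`
and the leftward cap `d'`. -/
def leftCrossing (s : Diag R G [up, up] [up, up]) (c' : Diag R G [] [up, dn])
    (d' : Diag R G [dn, up] []) : Diag R G [dn, up] [up, dn] :=
  (padL [dn, up] c' :) ⨾
    (padR (padL [dn] s) [dn] :) ⨾
    (padR d' [up, dn] :)

/-- The left curl `↑ ⟶ ↑`. -/
def leftCurl (s : Diag R G [up, up] [up, up]) (c : Diag R G [] [dn, up])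
    (d' : Diag R G [dn, up] []) : Diag R G [up] [up] :=
  (padR c [up] :) ⨾ (padL [dn] s :) ⨾
    (padR d' [up] :)

/-- The right curl `↑ ⟶ ↑`. -/
def rightCurl (s : Diag R G [up, up] [up, up]) (d : Diag R G [up, dn] [])
    (c' : Diag R G [] [up, dn]) : Diag R G [up] [up] :=
  (padL [up] c' :) ⨾ (padR s [dn] :) ⨾
    (padL [up] d :)

/-- The rightward cup with `r` dots on its upward strand. -/
def dottedCup (x : Diag R G [up] [up]) (c : Diag R G [] [dn, up]) (r : ℕ) :
    Diag R G [] [dn, up] :=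
  c ⨾ (padL [dn] (x.pow r) :)

/-- The leftward cap with `r` dots on its upward strand. -/
def dottedCap (x : Diag R G [up] [up]) (leftCap : Diag R G [dn, up] []) (r : ℕ) :
    Diag R G [dn, up] [] :=
  (padL [dn] (x.pow r) :) ⨾ leftCap

/-- The counterclockwise bubble with `r` dots. -/
def bubble (x : Diag R G [up] [up]) (c : Diag R G [] [dn, up]) (leftCap : Diag R G [dn, up] [])
    (r : ℕ) : Diag R G [] [] :=
  dottedCup x c r ⨾ leftCap

/-- The coefficients `c₀ = 1`, `cₙ₊₁ = - ∑ᵢ b (m + n - i) cᵢ` (sum over `0 ≤ i ≤ n`), i.e. `cₙ` is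
the determinant of the `n × n` matrix with entries `- b (m + i - j)` once `b (m - 1) = 1` and
`b r = 0` for `r < m - 1`. -/
def coeff [CommRing R] (m : ℕ) (b : ℕ → Diag R G [] []) : ℕ → Diag R G [] []
  | 0 => idd []
  | n + 1 => (sum (n + 1) (fun i => b (m + (n - i.val)) ⨾ coeff m b i.val)).smul (-1)

/-- The rotation of an endomorphism `x` of `↑` through 180 degrees to an endomorphism of `↓`, using
the rightward cup and cap. -/
def rotateDotRight (x : Diag R G [up] [up]) (c : Diag R G [] [dn, up])
    (d : Diag R G [up, dn] []) : Diag R G [dn] [dn] :=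
  (padR c [dn] :) ⨾
    (padR (padL [dn] x) [dn] :) ⨾
    (padL [dn] d :)

/-- The rotation of an endomorphism `x` of `↑` through 180 degrees in the other direction, using
the leftward cup and cap. -/
def rotateDotLeft (x : Diag R G [up] [up]) (c' : Diag R G [] [up, dn])
    (d' : Diag R G [dn, up] []) : Diag R G [dn] [dn] :=
  (padL [dn] c' :) ⨾
    (padR (padL [dn] x) [dn] :) ⨾
    (padR d' [dn] :)

/-- Two nested rightward cups. -/
def nestedRightCup (c : Diag R G [] [dn, up]) : Diag R G [] [dn, dn, up, up] :=
  c ⨾ (padR (padL [dn] c) [up] :)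

/-- Two nested rightward caps. -/
def nestedRightCap (d : Diag R G [up, dn] []) : Diag R G [up, up, dn, dn] [] :=
  (padR (padL [up] d) [dn] :) ⨾ d

/-- Two nested leftward cups. -/
def nestedLeftCup (c' : Diag R G [] [up, dn]) : Diag R G [] [up, up, dn, dn] :=
  c' ⨾ (padR (padL [up] c') [dn] :)

/-- Two nested leftward caps. -/
def nestedLeftCap (leftCap : Diag R G [dn, up] []) : Diag R G [dn, dn, up, up] [] :=
  (padR (padL [dn] leftCap) [up] :) ⨾ leftCap

/-- The rotation of the crossing `s` through 180 degrees to an endomorphism of `↓↓`, using nested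
rightward cups and caps. -/
def rotateCrossingRight (s : Diag R G [up, up] [up, up]) (c : Diag R G [] [dn, up])
    (d : Diag R G [up, dn] []) : Diag R G [dn, dn] [dn, dn] :=
  (padR (nestedRightCup c) [dn, dn] :) ⨾ (padR (padL [dn, dn] s) [dn, dn] :) ⨾
    (padL [dn, dn] (nestedRightCap d) :)

/-- The rotation of the crossing `s` through 180 degrees in the other direction, using nested
leftward cups and caps. -/
def rotateCrossingLeft (s : Diag R G [up, up] [up, up]) (c' : Diag R G [] [up, dn])
    (d' : Diag R G [dn, up] []) : Diag R G [dn, dn] [dn, dn] :=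
  (padL [dn, dn] (nestedLeftCup c') :) ⨾ (padR (padL [dn, dn] s) [dn, dn] :) ⨾
    (padR (nestedLeftCap d') [dn, dn] :)

end Diag

/-! ### Families of relations shared by the categories below -/

open Ori Diag

/-- The symmetric group relations for the crossing `s`. -/
inductive SymmetricRel {R : Type u} [CommRing R] {G : Word → Word → Type}
    (s : Diag R G [up, up] [up, up]) :
    ∀ ⦃a b : Word⦄, Diag R G a b → Diag R G a b → Prop
  | square : SymmetricRel s (s ⨾ s) (idd [up, up])
  | braid : SymmetricRel s (a := [up, up, up]) (b := [up, up, up])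
      ((padR s [up] :) ⨾ (padL [up] s :) ⨾
        (padR s [up] :))
      ((padL [up] s :) ⨾ (padR s [up] :) ⨾
        (padL [up] s :))

/-- The degenerate affine Hecke algebra relation `(x ⊗ 1) ∘ s - s ∘ (1 ⊗ x) = 1`. -/
inductive DotSlideRel {R : Type u} [CommRing R] {G : Word → Word → Type}
    (x : Diag R G [up] [up]) (s : Diag R G [up, up] [up, up]) :
    ∀ ⦃a b : Word⦄, Diag R G a b → Diag R G a b → Prop
  | slide : DotSlideRel x s
      (sub (s ⨾ (padR x [up] :))
        ((padL [up] x :) ⨾ s))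
      (idd [up, up])

/-- The zigzag relations making `↓` right dual to `↑`. -/
inductive RightAdjunctionRel {R : Type u} [CommRing R] {G : Word → Word → Type}
    (c : Diag R G [] [dn, up]) (d : Diag R G [up, dn] []) :
    ∀ ⦃a b : Word⦄, Diag R G a b → Diag R G a b → Prop
  | up_zigzag : RightAdjunctionRel c d
      ((padL [up] c :) ⨾ (padR d [up] :))
      (idd [up])
  | dn_zigzag : RightAdjunctionRel c d
      ((padR c [dn] :) ⨾ (padL [dn] d :))
      (idd [dn])

/-- The zigzag relations making `↓` left dual to `↑`. -/
inductive LeftAdjunctionRel {R : Type u} [CommRing R] {G : Word → Word → Type}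
    (c' : Diag R G [] [up, dn]) (d' : Diag R G [dn, up] []) :
    ∀ ⦃a b : Word⦄, Diag R G a b → Diag R G a b → Prop
  | up_zigzag : LeftAdjunctionRel c' d'
      ((padR c' [up] :) ⨾ (padL [up] d' :))
      (idd [up])
  | dn_zigzag : LeftAdjunctionRel c' d'
      ((padL [dn] c' :) ⨾ (padR d' [dn] :))
      (idd [dn])

/-! ### The Heisenberg category `Heis_k` for `k = -m < 0` -/

/-- Generating morphisms of `Heis_{-m}`: the dot `x`, the crossing `s`, the rightward cup `c` and
cap `d`, and the entries `leftCross` and `capDec r` (`0 ≤ r < m`) of the matrix which is adjoined as an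
inverse in the inversion relation. -/
inductive HeisGen (m : ℕ) : Word → Word → Type
  | x : HeisGen m [up] [up]
  | s : HeisGen m [up, up] [up, up]
  | c : HeisGen m [] [dn, up]
  | d : HeisGen m [up, dn] []
  | leftCross : HeisGen m [dn, up] [up, dn]
  | capDec (r : Fin m) : HeisGen m [dn, up] []

namespace Heis

variable (R : Type u) (m : ℕ)

/-- The dot on an upward strand. -/
def x : Diag R (HeisGen m) [up] [up] := gen HeisGen.x

/-- The upward crossing. -/
def s : Diag R (HeisGen m) [up, up] [up, up] := gen HeisGen.s

/-- The rightward cup. -/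
def c : Diag R (HeisGen m) [] [dn, up] := gen HeisGen.c

/-- The rightward cap. -/
def d : Diag R (HeisGen m) [up, dn] [] := gen HeisGen.d

/-- The rightward crossing. -/
def t : Diag R (HeisGen m) [up, dn] [dn, up] := rightCrossing (s R m) (c R m) (d R m)

/-- The leftward crossing. -/
def t' : Diag R (HeisGen m) [dn, up] [up, dn] := gen HeisGen.leftCross

/-- The remaining entries of the inverse matrix. -/
def capDec (r : Fin m) : Diag R (HeisGen m) [dn, up] [] := gen (HeisGen.capDec r)

/-- The leftward cup: the cup with `m` dots followed by the leftward crossing. -/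
def c' : Diag R (HeisGen m) [] [up, dn] := dottedCup (x R m) (c R m) m ⨾ t' R m

variable {m} in
/-- The leftward cap: the last entry of the inverse matrix. -/
def d' (hm : m ≠ 0) : Diag R (HeisGen m) [dn, up] [] :=
  capDec R m ⟨m - 1, Nat.sub_one_lt hm⟩

end Heis

/-- Defining relations of `Heis_{-m}`: the degenerate affine Hecke relations, the right adjunction
relations, and the inversion relation: the matrix `[t, c, (1 ⊗ x) c, …, (1 ⊗ x ^ (m - 1)) c]` from
`↑↓ ⊕ 1 ^ m` to `↓↑` is invertible with inverse the column with entries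
`t', capDec 0, …, capDec (m - 1)`. -/
inductive HeisRel (R : Type u) [CommRing R] (m : ℕ) :
    ∀ ⦃a b : Word⦄, Diag R (HeisGen m) a b → Diag R (HeisGen m) a b → Prop
  | symmetric {a b : Word} {f g : Diag R (HeisGen m) a b} :
      SymmetricRel (Heis.s R m) f g → HeisRel R m f g
  | dotSlide {a b : Word} {f g : Diag R (HeisGen m) a b} :
      DotSlideRel (Heis.x R m) (Heis.s R m) f g → HeisRel R m f g
  | rightAdjunction {a b : Word} {f g : Diag R (HeisGen m) a b} :
      RightAdjunctionRel (Heis.c R m) (Heis.d R m) f g → HeisRel R m f g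
  | inv_right : HeisRel R m
      ((Heis.t' R m ⨾ Heis.t R m).add (Diag.sum m (fun r => Heis.capDec R m r ⨾
        dottedCup (Heis.x R m) (Heis.c R m) r.val)))
      (idd [dn, up])
  | inv_left_crossing : HeisRel R m (Heis.t R m ⨾ Heis.t' R m) (idd [up, dn])
  | inv_left_crossing_cap (r : Fin m) : HeisRel R m
      (Heis.t R m ⨾ Heis.capDec R m r) (Diag.zero [up, dn] [])
  | inv_left_cup_crossing (r : Fin m) : HeisRel R m
      (dottedCup (Heis.x R m) (Heis.c R m) r.val ⨾ Heis.t' R m) (Diag.zero [] [up, dn])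
  | inv_left_cup_cap_self (r : Fin m) : HeisRel R m
      (dottedCup (Heis.x R m) (Heis.c R m) r.val ⨾ Heis.capDec R m r) (idd [])
  | inv_left_cup_cap_of_ne (r q : Fin m) : r ≠ q → HeisRel R m
      (dottedCup (Heis.x R m) (Heis.c R m) r.val ⨾ Heis.capDec R m q) (Diag.zero [] [])

/-- Defining relations of the specialization `Heis_{-m}(δ)`: the counterclockwise bubble with `m`
dots is the scalar `δ`. -/
inductive HeisSpecRel (R : Type u) [CommRing R] {m : ℕ} (hm : m ≠ 0) (δ : R) :
    ∀ ⦃a b : Word⦄, Diag R (HeisGen m) a b → Diag R (HeisGen m) a b → Prop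
  | heis {a b : Word} {f g : Diag R (HeisGen m) a b} : HeisRel R m f g → HeisSpecRel R hm δ f g
  | bubble : HeisSpecRel R hm δ
      (bubble (Heis.x R m) (Heis.c R m) (Heis.d' R hm) m) ((idd []).smul δ)

/-! ### The Mackaay–Savage category -/

/-- Generating morphisms of the Mackaay–Savage category: dot, crossing, and the four cups and
caps. -/
inductive MSGen : Word → Word → Type
  | x : MSGen [up] [up]
  | s : MSGen [up, up] [up, up]
  | c : MSGen [] [dn, up]
  | d : MSGen [up, dn] []
  | leftCup : MSGen [] [up, dn]
  | leftCap : MSGen [dn, up] []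

namespace MS

variable (R : Type u)

/-- The dot on an upward strand. -/
def x : Diag R MSGen [up] [up] := gen MSGen.x

/-- The upward crossing. -/
def s : Diag R MSGen [up, up] [up, up] := gen MSGen.s

/-- The rightward cup. -/
def c : Diag R MSGen [] [dn, up] := gen MSGen.c

/-- The rightward cap. -/
def d : Diag R MSGen [up, dn] [] := gen MSGen.d

/-- The leftward cup. -/
def c' : Diag R MSGen [] [up, dn] := gen MSGen.leftCup

/-- The leftward cap. -/
def d' : Diag R MSGen [dn, up] [] := gen MSGen.leftCap

/-- The rightward crossing. -/
def t : Diag R MSGen [up, dn] [dn, up] := rightCrossing (s R) (c R) (d R)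

/-- The leftward crossing. -/
def t' : Diag R MSGen [dn, up] [up, dn] := leftCrossing (s R) (c' R) (d' R)

/-- The counterclockwise bubble with `r` dots. -/
def b (r : ℕ) : Diag R MSGen [] [] := bubble (x R) (c R) (d' R) r

end MS

/-- Defining relations of the category of dotted oriented planar diagrams up to isotopy modulo the
Mackaay–Savage local relations, for a dominant weight of level `m` and `δ = ∑ i λ_i`.  Invariance
under planar isotopy is imposed by the zigzag relations and by the cyclicity of the dot and of the
crossing. -/
inductive MSRel (R : Type u) [CommRing R] (m : ℕ) (δ : R) :
    ∀ ⦃a b : Word⦄, Diag R MSGen a b → Diag R MSGen a b → Prop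
  -- planar isotopy
  | rightAdjunction {a b : Word} {f g : Diag R MSGen a b} :
      RightAdjunctionRel (MS.c R) (MS.d R) f g → MSRel R m δ f g
  | leftAdjunction {a b : Word} {f g : Diag R MSGen a b} :
      LeftAdjunctionRel (MS.c' R) (MS.d' R) f g → MSRel R m δ f g
  | cyclic_dot : MSRel R m δ
      (rotateDotRight (MS.x R) (MS.c R) (MS.d R)) (rotateDotLeft (MS.x R) (MS.c' R) (MS.d' R))
  | cyclic_crossing : MSRel R m δ
      (rotateCrossingRight (MS.s R) (MS.c R) (MS.d R))
      (rotateCrossingLeft (MS.s R) (MS.c' R) (MS.d' R))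
  -- local relations
  | symmetric {a b : Word} {f g : Diag R MSGen a b} :
      SymmetricRel (MS.s R) f g → MSRel R m δ f g
  | dotSlide {a b : Word} {f g : Diag R MSGen a b} :
      DotSlideRel (MS.x R) (MS.s R) f g → MSRel R m δ f g
  | right_left_crossing : MSRel R m δ (MS.t R ⨾ MS.t' R) (idd [up, dn])
  | left_right_crossing : MSRel R m δ (MS.t' R ⨾ MS.t R)
      (sub (idd [dn, up]) (Diag.sum m (fun r => Diag.sum (m - r.val) (fun q =>
        coeff m (MS.b R) (m - 1 - r.val - q.val) ⊠
          (dottedCap (MS.x R) (MS.d' R) r.val ⨾ dottedCup (MS.x R) (MS.c R) q.val)))))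
  | leftCurl : MSRel R m δ (leftCurl (MS.s R) (MS.c R) (MS.d' R)) (Diag.zero [up] [up])
  | bubble_zero (r : ℕ) : r + 1 < m → MSRel R m δ (MS.b R r) (Diag.zero [] [])
  | bubble_one (r : ℕ) : r + 1 = m → MSRel R m δ (MS.b R r) (idd [])
  | bubble_scalar : MSRel R m δ (MS.b R m) ((idd []).smul δ)

/-! ### Khovanov's category -/

/-- Generating morphisms of Khovanov's category: crossing and the four cups and caps. -/
inductive KhovanovGen : Word → Word → Type
  | s : KhovanovGen [up, up] [up, up]
  | c : KhovanovGen [] [dn, up]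
  | d : KhovanovGen [up, dn] []
  | leftCup : KhovanovGen [] [up, dn]
  | leftCap : KhovanovGen [dn, up] []

namespace Khovanov

variable (R : Type u)

/-- The upward crossing. -/
def s : Diag R KhovanovGen [up, up] [up, up] := gen KhovanovGen.s

/-- The rightward cup. -/
def c : Diag R KhovanovGen [] [dn, up] := gen KhovanovGen.c

/-- The rightward cap. -/
def d : Diag R KhovanovGen [up, dn] [] := gen KhovanovGen.d

/-- The leftward cup. -/
def c' : Diag R KhovanovGen [] [up, dn] := gen KhovanovGen.leftCup

/-- The leftward cap. -/
def d' : Diag R KhovanovGen [dn, up] [] := gen KhovanovGen.leftCap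

/-- The rightward crossing. -/
def t : Diag R KhovanovGen [up, dn] [dn, up] := rightCrossing (s R) (c R) (d R)

/-- The leftward crossing. -/
def t' : Diag R KhovanovGen [dn, up] [up, dn] := leftCrossing (s R) (c' R) (d' R)

end Khovanov

/-- Khovanov's local relations together with the zigzag relations, but without cyclicity of the
crossing. -/
inductive KhovanovLocalRel (R : Type u) [CommRing R] :
    ∀ ⦃a b : Word⦄, Diag R KhovanovGen a b → Diag R KhovanovGen a b → Prop
  | rightAdjunction {a b : Word} {f g : Diag R KhovanovGen a b} :
      RightAdjunctionRel (Khovanov.c R) (Khovanov.d R) f g → KhovanovLocalRel R f g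
  | leftAdjunction {a b : Word} {f g : Diag R KhovanovGen a b} :
      LeftAdjunctionRel (Khovanov.c' R) (Khovanov.d' R) f g → KhovanovLocalRel R f g
  | symmetric {a b : Word} {f g : Diag R KhovanovGen a b} :
      SymmetricRel (Khovanov.s R) f g → KhovanovLocalRel R f g
  | right_left_crossing : KhovanovLocalRel R (Khovanov.t R ⨾ Khovanov.t' R) (idd [up, dn])
  | left_right_crossing : KhovanovLocalRel R (Khovanov.t' R ⨾ Khovanov.t R)
      (sub (idd [dn, up]) (Khovanov.d' R ⨾ Khovanov.c R))
  | leftCurl : KhovanovLocalRel R (leftCurl (Khovanov.s R) (Khovanov.c R) (Khovanov.d' R))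
      (Diag.zero [up] [up])
  | bubble : KhovanovLocalRel R (Khovanov.c R ⨾ Khovanov.d' R) (idd [])

/-- Defining relations of Khovanov's category: oriented planar diagrams up to isotopy modulo
Khovanov's local relations.  Invariance under planar isotopy amounts to the zigzag relations and
the cyclicity of the crossing. -/
inductive KhovanovRel (R : Type u) [CommRing R] :
    ∀ ⦃a b : Word⦄, Diag R KhovanovGen a b → Diag R KhovanovGen a b → Prop
  | ofLocal {a b : Word} {f g : Diag R KhovanovGen a b} :
      KhovanovLocalRel R f g → KhovanovRel R f g
  | cyclic_crossing : KhovanovRel R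
      (rotateCrossingRight (Khovanov.s R) (Khovanov.c R) (Khovanov.d R))
      (rotateCrossingLeft (Khovanov.s R) (Khovanov.c' R) (Khovanov.d' R))

/-! ### Isomorphisms of linear monoidal categories -/

/-- An isomorphism of `R`-linear monoidal categories: an `R`-linear strict monoidal functor which
is bijective on objects and on morphisms. -/
structure StrictMonoidalIso (R : Type u) [CommRing R]
    (A : Type*) [Category* A] [Preadditive A] [Linear R A] [MonoidalCategory A]
    (B : Type*) [Category* B] [Preadditive B] [Linear R B] [MonoidalCategory B] where
  functor : A ⥤ B
  additive : functor.Additive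
  linear : functor.Linear R
  bijective_obj : Function.Bijective functor.obj
  bijective_map (X Y : A) : Function.Bijective (fun f : X ⟶ Y => functor.map f)
  monoidal : functor.Monoidal
  unit_obj : functor.obj (𝟙_ A) = 𝟙_ B
  tensor_obj (X Y : A) : functor.obj (X ⊗ Y) = functor.obj X ⊗ functor.obj Y
  unit_strict : Functor.LaxMonoidal.ε functor = eqToHom unit_obj.symm
  tensor_strict (X Y : A) : Functor.LaxMonoidal.μ functor X Y = eqToHom (tensor_obj X Y).symm

/-- The additive envelope of the category presented by `rel`. -/
abbrev Envelope {R : Type u} [CommRing R] {G : Word → Word → Type} (rel : Relations R G) :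
    Type 1 :=
  Mat_ (Pres rel)

/-- `Sends Φ f g`: the isomorphism `Φ` of additive envelopes sends the morphism represented by the
diagram `f` to the morphism represented by the diagram `g`, where both have the same source and
target words. -/
def Sends {R : Type u} [CommRing R] {G G' : Word → Word → Type} {rel : Relations R G}
    {rel' : Relations R G'} (Φ : StrictMonoidalIso R (Envelope rel) (Envelope rel'))
    {a b : Word} (f : Diag R G a b) (g : Diag R G' a b) : Prop :=
  Arrow.mk (Φ.functor.map ((Mat_.embedding (Pres rel)).map (Pres.mor rel f))) =
    Arrow.mk ((Mat_.embedding (Pres rel')).map (Pres.mor rel' g))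

/-! ### Dominant weights -/

/-- The level `∑ λ_i` of the dominant weight `∑ λ_i ω_i`. -/
def level {I : Type*} (lam : I →₀ ℕ) : ℕ := lam.sum (fun _ n => n)

/-- The element `∑ i λ_i` of the ground ring, for a dominant weight `∑ λ_i ω_i` of `sl_∞` (`p = 0`,
indices in `ZMod 0 = ℤ`) or of affine `sl_p` (indices in `ZMod p`). -/
def charge (R : Type u) [CommRing R] {p : ℕ} [Algebra (ZMod p) R] (lam : ZMod p →₀ ℕ) : R :=
  lam.sum (fun i n => n • algebraMap (ZMod p) R i)

theorem level_ne_zero {I : Type*} {lam : I →₀ ℕ} (h : lam ≠ 0) : level lam ≠ 0 := by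
  intro h0
  refine h (Finsupp.ext fun i => ?_)
  by_cases hi : i ∈ lam.support
  · exact Finset.sum_eq_zero_iff.mp h0 i hi
  · simpa using hi

end HeisenbergCategory

/-! ### Crossings, rightward cups and caps as natural transformations. -/

namespace HeisenbergCategory

/-! All the categories have words as objects, so an isomorphism amounts to substitutions of
generators in both directions that respect the defining relations and are mutually inverse on
generators (`PresEquiv`); such a pair extends entrywise to additive envelopes. The content is to
derive each set of relations from the other.

From the Heisenberg side everything rests on the inversion relation. It makes `t` and the cups with
fewer than `m` dots jointly epimorphic onto ↓↑, even after further strands are added on the left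
(`HeisAction.hom_ext`), so an identity between maps out of ↓↑ may be tested on them. There the Hecke
relation moves dots through crossings; each move leaves a bubble, and `b r` is 0 for `r < m - 1` and
1 for `r = m - 1`. In this way an upward strand is seen to pass over `d'` (`HeisAction.t_s_cap`).
This yields the left zigzags, the identification of the adjoined `t'` with the rotated crossing τ,
and the cyclicity of `x` and `s`. A descending recursion then expresses the other entries of the
inverse through dotted caps and the coefficients `c_n` (`HeisAction.e_eq_sum`).

Conversely, the `c_n` are the coefficients of the power series inverse to ∑ `b (m - 1 + j)` uʲ. In
the Mackaay–Savage category the same combinations of dotted caps are therefore dual to the dotted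
cups (`MSAction.cup_e_self`, `MSAction.cup_e_of_ne`). The remaining entries of the inversion
relation follow formally, and the leftward cup is recovered by evaluating a left curl with `m` dots.

In Khovanov's category the right curl plays the role of the dot. Its Hecke relation comes from the
braid relation and the formula for the double crossing (`KhovanovAction.s_x_s`), and δ = 0 matches
the vanishing of the bubble with one dot. These arguments avoid (C_s), whereas (C_s) holds in the
Heisenberg category; going there and back shows that (C_s) is redundant.

To compute without associators, a presented category acts on itself: `U` and `D` prepend ↑ and ↓ to
a word, and a diagram with vertical strands added on its right becomes a natural transformation.
`Represents` translates between diagrams and these transformations. -/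

/-- The action of the crossing, the rightward cup and the rightward cap on a preadditive category
through additive endofunctors `U` and `D`, subject to the symmetric group relations and the right
adjunction relations. -/
structure CrossingAction (C : Type u) [Category.{v} C] [Preadditive C] where
  U : C ⥤ C
  D : C ⥤ C
  additive_U : U.Additive
  additive_D : D.Additive
  s (X : C) : U.obj (U.obj X) ⟶ U.obj (U.obj X)
  c (X : C) : X ⟶ D.obj (U.obj X)
  d (X : C) : U.obj (D.obj X) ⟶ X
  s_nat {X Y : C} (f : X ⟶ Y) : U.map (U.map f) ≫ s Y = s X ≫ U.map (U.map f)
  c_nat {X Y : C} (f : X ⟶ Y) : f ≫ c Y = c X ≫ D.map (U.map f)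
  d_nat {X Y : C} (f : X ⟶ Y) : U.map (D.map f) ≫ d Y = d X ≫ f
  square (X : C) : s X ≫ s X = 𝟙 _
  braid (X : C) : s (U.obj X) ≫ U.map (s X) ≫ s (U.obj X) =
    U.map (s X) ≫ s (U.obj X) ≫ U.map (s X)
  up_zigzag (X : C) : U.map (c X) ≫ d (U.obj X) = 𝟙 _
  dn_zigzag (X : C) : c (D.obj X) ≫ D.map (d X) = 𝟙 _

attribute [instance] CrossingAction.additive_U CrossingAction.additive_D

namespace CrossingAction

variable {C : Type u} [Category.{v} C] [Preadditive C] (A : CrossingAction C)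

/-- The rightward crossing. -/
def t (X : C) : A.U.obj (A.D.obj X) ⟶ A.D.obj (A.U.obj X) :=
  A.c (A.U.obj (A.D.obj X)) ≫ A.D.map (A.s (A.D.obj X)) ≫ A.D.map (A.U.map (A.d X))

theorem t_nat {X Y : C} (f : X ⟶ Y) :
    A.U.map (A.D.map f) ≫ A.t Y = A.t X ≫ A.D.map (A.U.map f) := by
  simp only [t, Category.assoc, ← Functor.map_comp]
  rw [reassoc_of% A.c_nat]
  simp only [← Functor.map_comp]
  rw [reassoc_of% A.s_nat]
  simp only [← Functor.map_comp, A.d_nat]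

/-- A zigzag undoes the rotation that made `t` out of `s`; here the cap inside `t` is straightened,
and in `t_cap` the cup. -/
theorem cup_t (X : C) :
    A.U.map (A.c X) ≫ A.t (A.U.obj X) = A.c (A.U.obj X) ≫ A.D.map (A.s X) := by
  simp only [t, ← Functor.map_comp]
  rw [reassoc_of% A.c_nat]
  simp only [← Functor.map_comp]
  rw [reassoc_of% A.s_nat]
  simp only [← Functor.map_comp, A.up_zigzag]
  simp

theorem t_cap (X : C) :
    A.U.map (A.t X) ≫ A.d (A.U.obj X) = A.s (A.D.obj X) ≫ A.U.map (A.d X) := by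
  simp only [t, Functor.map_comp, Category.assoc]
  rw [A.d_nat, reassoc_of% A.d_nat, reassoc_of% A.up_zigzag]

/-- When two upward strands cross a downward one, the two rotations can share one cup and one cap.
What remains between them is a word in upward crossings, to which `braid` applies. -/
theorem map_t_comp_t (X : C) :
    A.U.map (A.t X) ≫ A.t (A.U.obj X) = A.c (A.U.obj (A.U.obj (A.D.obj X))) ≫
      A.D.map (A.s (A.U.obj (A.D.obj X)) ≫ A.U.map (A.s (A.D.obj X)) ≫
        A.U.map (A.U.map (A.d X))) := by
  rw [t, t, reassoc_of% A.c_nat]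
  simp only [← Functor.map_comp]
  rw [reassoc_of% A.s_nat]
  simp only [← Functor.map_comp]
  have h := A.t_cap X
  simp only [t, ← Functor.map_comp] at h
  rw [h]

/-- The braid relation with one strand turned downward: by `map_t_comp_t` the extra crossing on
either side completes one of the two words in `braid`. -/
theorem braid_t (X : C) :
    A.U.map (A.t X) ≫ A.t (A.U.obj X) ≫ A.D.map (A.s X) =
      A.s (A.D.obj X) ≫ A.U.map (A.t X) ≫ A.t (A.U.obj X) := by
  rw [← Category.assoc, map_t_comp_t, reassoc_of% A.c_nat]
  simp only [Category.assoc, ← Functor.map_comp A.D]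
  rw [A.s_nat, reassoc_of% A.braid]

/-- The downward crossing, obtained by rotating `s` using nested rightward cups and caps. -/
def downCrossing (X : C) : A.D.obj (A.D.obj X) ⟶ A.D.obj (A.D.obj X) :=
  A.c (A.D.obj (A.D.obj X)) ≫ A.D.map (A.t (A.D.obj X)) ≫ A.D.map (A.D.map (A.d X))

/-- The nested form in which `rotateCrossingRight` presents the rotation; the definition absorbs the
inner cup and cap into `t`. -/
theorem downCrossing_eq (X : C) : A.downCrossing X =
    (A.c (A.D.obj (A.D.obj X)) ≫ A.D.map (A.c (A.U.obj (A.D.obj (A.D.obj X))))) ≫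
      A.D.map (A.D.map (A.s (A.D.obj (A.D.obj X)))) ≫
        A.D.map (A.D.map (A.U.map (A.d (A.D.obj X)) ≫ A.d X)) := by
  simp only [downCrossing, t, Functor.map_comp, Category.assoc]

theorem downCrossing_nat {X Y : C} (f : X ⟶ Y) :
    A.D.map (A.D.map f) ≫ A.downCrossing Y = A.downCrossing X ≫ A.D.map (A.D.map f) := by
  simp only [downCrossing, Category.assoc, ← Functor.map_comp]
  rw [reassoc_of% A.c_nat]
  simp only [← Functor.map_comp]
  rw [reassoc_of% A.t_nat]
  simp only [← Functor.map_comp, A.d_nat]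

end CrossingAction

/-! ### Dots and the degenerate affine Hecke relation. -/

/-- A `CrossingAction` with a dot `x` satisfying the degenerate affine Hecke relation. -/
structure DottedAction (C : Type u) [Category.{v} C] [Preadditive C] extends
    CrossingAction C where
  x (X : C) : U.obj X ⟶ U.obj X
  x_nat {X Y : C} (f : X ⟶ Y) : U.map f ≫ x Y = x X ≫ U.map f
  slide (X : C) : s X ≫ x (U.obj X) - U.map (x X) ≫ s X = 𝟙 _

namespace DottedAction

variable {C : Type u} [Category.{v} C] [Preadditive C] (A : DottedAction C)

theorem s_x (X : C) :
    A.s X ≫ A.x (A.U.obj X) = A.U.map (A.x X) ≫ A.s X + 𝟙 _ := by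
  rw [← A.slide X]; abel

/-- Composing `s_x` with `s` on both sides and using `s² = 1` gives the mirrored relation. -/
theorem x_s (X : C) :
    A.x (A.U.obj X) ≫ A.s X = A.s X ≫ A.U.map (A.x X) + 𝟙 _ := by
  have h : A.s X ≫ (A.s X ≫ A.x (A.U.obj X)) ≫ A.s X =
      A.s X ≫ (A.U.map (A.x X) ≫ A.s X + 𝟙 _) ≫ A.s X := by rw [s_x]
  simp only [Category.assoc, Preadditive.add_comp, Preadditive.comp_add, A.square,
    reassoc_of% A.square, Category.comp_id, Category.id_comp] at h
  exact h

/-- This is the Hecke relation after rotation: its identity term bends into the cap `d` followed by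
the cup `c`. The dot on the downward strand leaves the same term in `t_y`. -/
theorem t_dot (X : C) :
    A.t X ≫ A.D.map (A.x X) = A.x (A.D.obj X) ≫ A.t X + A.d X ≫ A.c X := by
  simp only [CrossingAction.t, Category.assoc, ← Functor.map_comp]
  rw [A.x_nat, reassoc_of% A.s_x]
  simp only [Preadditive.add_comp, Functor.map_add, Preadditive.comp_add, Category.assoc,
    Category.id_comp]
  rw [← A.c_nat, reassoc_of% A.c_nat]
  simp only [Functor.map_comp]

/-- The dot on a downward strand, obtained by rotating `x` using the rightward cup and cap. -/
def y (X : C) : A.D.obj X ⟶ A.D.obj X :=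
  A.c (A.D.obj X) ≫ A.D.map (A.x (A.D.obj X)) ≫ A.D.map (A.d X)

theorem y_nat {X Y : C} (f : X ⟶ Y) : A.D.map f ≫ A.y Y = A.y X ≫ A.D.map f := by
  simp only [y, Category.assoc, ← Functor.map_comp]
  rw [reassoc_of% A.c_nat]
  simp only [← Functor.map_comp]
  rw [reassoc_of% A.x_nat, A.d_nat]

/-- Since `y` is `x` rotated by the same cup and cap, a zigzag lets a dot travel around `c`, and
likewise around `d` in `y_cap`. -/
theorem cup_y (X : C) :
    A.c X ≫ A.y (A.U.obj X) = A.c X ≫ A.D.map (A.x X) := by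
  simp only [y]
  rw [reassoc_of% A.c_nat]
  simp only [← Functor.map_comp]
  rw [reassoc_of% A.x_nat, A.up_zigzag, Category.comp_id]

theorem y_cap (X : C) : A.U.map (A.y X) ≫ A.d X = A.x (A.D.obj X) ≫ A.d X := by
  simp only [y, Functor.map_comp, Category.assoc]
  rw [A.d_nat, reassoc_of% A.d_nat, reassoc_of% A.up_zigzag]

theorem t_y (X : C) :
    A.t X ≫ A.y (A.U.obj X) = A.U.map (A.y X) ≫ A.t X + A.d X ≫ A.c X := by
  simp only [CrossingAction.t, Category.assoc, ← Functor.map_comp]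
  rw [A.y_nat, reassoc_of% A.cup_y]
  simp only [← Functor.map_comp]
  rw [reassoc_of% A.x_s]
  simp only [Preadditive.add_comp, Functor.map_add, Preadditive.comp_add, Category.assoc,
    Category.id_comp]
  rw [← A.c_nat, reassoc_of% A.c_nat, ← Functor.map_comp, ← Functor.map_comp, reassoc_of% A.s_nat]
  simp only [← Functor.map_comp, A.y_cap]

/-- Powers of the dot. -/
def xpow (X : C) : ℕ → (A.U.obj X ⟶ A.U.obj X)
  | 0 => 𝟙 _
  | n + 1 => xpow X n ≫ A.x X

theorem xpow_nat {X Y : C} (f : X ⟶ Y) (n : ℕ) :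
    A.U.map f ≫ A.xpow Y n = A.xpow X n ≫ A.U.map f := by
  induction n with
  | zero => simp [xpow]
  | succ n ih => simp only [xpow, Category.assoc]; rw [reassoc_of% ih, A.x_nat]

theorem xpow_succ' (X : C) (n : ℕ) : A.xpow X (n + 1) = A.x X ≫ A.xpow X n := by
  induction n with
  | zero => simp [xpow]
  | succ n ih =>
    conv_lhs => rw [xpow, ih, Category.assoc]
    rfl

/-- The rightward cup with `r` dots. -/
def cup (r : ℕ) (X : C) : X ⟶ A.D.obj (A.U.obj X) := A.c X ≫ A.D.map (A.xpow X r)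

theorem cup_zero (X : C) : A.cup 0 X = A.c X := by simp [cup, xpow]

theorem cup_succ (r : ℕ) (X : C) : A.cup (r + 1) X = A.cup r X ≫ A.D.map (A.x X) := by
  simp [cup, xpow]

theorem cup_nat (r : ℕ) {X Y : C} (f : X ⟶ Y) :
    f ≫ A.cup r Y = A.cup r X ≫ A.D.map (A.U.map f) := by
  simp only [cup, Category.assoc]
  rw [reassoc_of% A.c_nat]
  simp only [← Functor.map_comp, A.xpow_nat]

theorem cup_comp_y (r : ℕ) (X : C) : A.cup r X ≫ A.y (A.U.obj X) = A.cup (r + 1) X := by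
  simp only [cup, Category.assoc]
  rw [A.y_nat, reassoc_of% A.cup_y, xpow_succ', Functor.map_comp]

theorem map_cup_t (r : ℕ) (X : C) :
    A.U.map (A.cup r X) ≫ A.t (A.U.obj X) =
      A.c (A.U.obj X) ≫ A.D.map (A.s X) ≫ A.D.map (A.U.map (A.xpow X r)) := by
  simp only [cup, Functor.map_comp, Category.assoc]
  rw [A.t_nat, reassoc_of% A.cup_t]

theorem map_cup_cap (r : ℕ) (X : C) :
    A.U.map (A.cup r X) ≫ A.d (A.U.obj X) = A.xpow X r := by
  simp only [cup, Functor.map_comp, Category.assoc]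
  rw [A.d_nat, reassoc_of% A.up_zigzag]

end DottedAction

/-! ### Leftward caps, bubbles and left curls. -/

/-- A `DottedAction` with a leftward cap. -/
structure CapAction (C : Type u) [Category.{v} C] [Preadditive C] extends DottedAction C where
  d' (X : C) : D.obj (U.obj X) ⟶ X
  d'_nat {X Y : C} (f : X ⟶ Y) : D.map (U.map f) ≫ d' Y = d' X ≫ f

namespace CapAction

variable {C : Type u} [Category.{v} C] [Preadditive C] (A : CapAction C)

/-- The leftward cap with `r` dots. -/
def cap (r : ℕ) (X : C) : A.D.obj (A.U.obj X) ⟶ X := A.D.map (A.xpow X r) ≫ A.d' X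

theorem cap_zero (X : C) : A.cap 0 X = A.d' X := by simp [cap, DottedAction.xpow]

theorem cap_succ (r : ℕ) (X : C) : A.cap (r + 1) X = A.D.map (A.x X) ≫ A.cap r X := by
  simp [cap, A.xpow_succ']

theorem cap_nat (r : ℕ) {X Y : C} (f : X ⟶ Y) :
    A.D.map (A.U.map f) ≫ A.cap r Y = A.cap r X ≫ f := by
  simp only [cap, Category.assoc]
  rw [← A.d'_nat]
  simp only [← Functor.map_comp_assoc, A.xpow_nat]

/-- The counterclockwise bubble with `r` dots. -/
def b (r : ℕ) (X : C) : X ⟶ X := A.cup r X ≫ A.d' X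

theorem b_nat (r : ℕ) {X Y : C} (f : X ⟶ Y) : f ≫ A.b r Y = A.b r X ≫ f := by
  simp only [b, Category.assoc]
  rw [reassoc_of% A.cup_nat, A.d'_nat]

theorem cup_cap (j r : ℕ) (X : C) : A.cup j X ≫ A.cap r X = A.b (j + r) X := by
  induction r generalizing j with
  | zero => rw [cap_zero, b]; rfl
  | succ r ih => rw [cap_succ, ← Category.assoc, ← A.cup_succ, ih]; congr 1; omega

/-- The coefficients of the inverse of the generating function of bubbles. -/
def coeff (m : ℕ) (X : C) : ℕ → (X ⟶ X)
  | 0 => 𝟙 X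
  | n + 1 => -∑ i : Fin (n + 1), A.b (m + (n - i.val)) X ≫ coeff m X i.val

theorem coeff_succ (m n : ℕ) (X : C) :
    A.coeff m X (n + 1) =
      -∑ i ∈ Finset.range (n + 1), A.b (m + (n - i)) X ≫ A.coeff m X i := by
  rw [coeff, Finset.sum_range (fun i => A.b (m + (n - i)) X ≫ A.coeff m X i)]

theorem coeff_nat (m n : ℕ) {X Y : C} (f : X ⟶ Y) :
    f ≫ A.coeff m Y n = A.coeff m X n ≫ f := by
  induction n using Nat.strong_induction_on with
  | _ n ih =>
    cases n with
    | zero => simp [coeff]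
    | succ n =>
      simp only [coeff_succ, Preadditive.comp_neg, Preadditive.neg_comp, Preadditive.comp_sum,
        Preadditive.sum_comp, Category.assoc]
      refine congrArg _ (Finset.sum_congr rfl fun i hi => ?_)
      rw [reassoc_of% A.b_nat, ih i (Finset.mem_range.mp hi)]

/-- The recursion for `coeff` says that ∑ `c_i` uⁱ is inverse to ∑ `b (m - 1 + j)` uʲ once the
latter has constant term 1. This is the vanishing of the product in the positive degree `n + 1`. -/
theorem sum_coeff_b (m n : ℕ) (X : C) (h : A.b (m - 1) X = 𝟙 X) (hm : m ≠ 0) :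
    ∑ i ∈ Finset.range (n + 2), A.b (m - 1 + (n + 1 - i)) X ≫ A.coeff m X i = 0 := by
  rw [Finset.sum_range_succ, coeff_succ, Nat.sub_self, Nat.add_zero (m - 1), h, Category.id_comp,
    add_neg_eq_zero]
  refine Finset.sum_congr rfl fun i hi => ?_
  rw [Finset.mem_range] at hi
  congr 2
  omega

/-- Moving one dot of a dotted left curl through the crossing. -/
theorem cup_s_cap_succ (r : ℕ) (X : C) :
    A.cup (r + 1) (A.U.obj X) ≫ A.D.map (A.s X) ≫ A.d' (A.U.obj X) =
      (A.cup r (A.U.obj X) ≫ A.D.map (A.s X) ≫ A.d' (A.U.obj X)) ≫ A.x X +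
        A.b r (A.U.obj X) := by
  rw [A.cup_succ, b]
  simp only [Category.assoc]
  rw [← Functor.map_comp_assoc, A.x_s]
  simp only [Functor.map_add, Functor.map_comp, CategoryTheory.Functor.map_id, Preadditive.add_comp,
    Preadditive.comp_add, Category.assoc, Category.id_comp]
  rw [A.d'_nat]

variable {m : ℕ}

/-- By `cup_s_cap_succ` each dot slid through the crossing leaves a bubble, and all the bubbles met
here vanish. -/
theorem cup_s_cap_of_lt (hb : ∀ r X, r + 1 < m → A.b r X = 0)
    (h0 : ∀ X, A.c (A.U.obj X) ≫ A.D.map (A.s X) ≫ A.d' (A.U.obj X) = 0) {r : ℕ} (hr : r < m)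
    (X : C) : A.cup r (A.U.obj X) ≫ A.D.map (A.s X) ≫ A.d' (A.U.obj X) = 0 := by
  induction r with
  | zero => rw [A.cup_zero, h0]
  | succ r ih => rw [cup_s_cap_succ, ih (by omega), hb _ _ hr]; simp

/-- The last of the `m` dots leaves `b (m - 1) = 1`, the first surviving bubble. This is why exactly
`m` dots occur in the definition of the leftward cup. -/
theorem cup_s_cap_self (hm : m ≠ 0) (hb : ∀ r X, r + 1 < m → A.b r X = 0)
    (hb' : ∀ X, A.b (m - 1) X = 𝟙 X)
    (h0 : ∀ X, A.c (A.U.obj X) ≫ A.D.map (A.s X) ≫ A.d' (A.U.obj X) = 0)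
    (X : C) : A.cup m (A.U.obj X) ≫ A.D.map (A.s X) ≫ A.d' (A.U.obj X) = 𝟙 _ := by
  obtain ⟨n, rfl⟩ := Nat.exists_eq_succ_of_ne_zero hm
  rw [cup_s_cap_succ, cup_s_cap_of_lt A hb h0 (by omega), ← hb' (A.U.obj X)]; simp

end CapAction

end HeisenbergCategory

/-! ### Consequences of the inversion relation. -/

namespace HeisenbergCategory

/-- An action of `Heis_{-m}` (with `m ≠ 0`): the cap `d'` is the last entry `e (m - 1)` of the
inverse matrix with entries `t'`, `e 0`, …, `e (m - 1)`. -/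
structure HeisAction (C : Type u) [Category.{v} C] [Preadditive C] (m : ℕ) extends
    CapAction C where
  t' (X : C) : D.obj (U.obj X) ⟶ U.obj (D.obj X)
  e (r : ℕ) (X : C) : D.obj (U.obj X) ⟶ X
  t'_nat {X Y : C} (f : X ⟶ Y) : D.map (U.map f) ≫ t' Y = t' X ≫ U.map (D.map f)
  ne_zero : m ≠ 0
  e_last (X : C) : e (m - 1) X = d' X
  inv_right (X : C) : t' X ≫ toCrossingAction.t X +
    ∑ r ∈ Finset.range m, e r X ≫ toDottedAction.cup r X = 𝟙 _
  t_t' (X : C) : toCrossingAction.t X ≫ t' X = 𝟙 _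
  t_e (r : ℕ) (X : C) : r < m → toCrossingAction.t X ≫ e r X = 0
  cup_t' (r : ℕ) (X : C) : r < m → toDottedAction.cup r X ≫ t' X = 0
  cup_e_self (r : ℕ) (X : C) : r < m → toDottedAction.cup r X ≫ e r X = 𝟙 X
  cup_e_of_ne (r q : ℕ) (X : C) : r < m → q < m → r ≠ q → toDottedAction.cup r X ≫ e q X = 0

namespace HeisAction

variable {C : Type u} [Category.{v} C] [Preadditive C] {m : ℕ} (A : HeisAction C m)

/-- The leftward cup. -/
def c' (X : C) : X ⟶ A.U.obj (A.D.obj X) := A.cup m X ≫ A.t' X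

/-- `inv_right` factors the identity of ↓↑ through `t` and the cups with fewer than `m` dots, so
these are jointly epimorphic. An additive functor preserves such a factorization; `F = U` or `F = D`
allows the test beside one more strand on the left. -/
theorem hom_ext (F : C ⥤ C) [F.Additive] {X Y : C} {h k : F.obj (A.D.obj (A.U.obj X)) ⟶ Y}
    (ht : F.map (A.t X) ≫ h = F.map (A.t X) ≫ k)
    (hc : ∀ r, r < m → F.map (A.cup r X) ≫ h = F.map (A.cup r X) ≫ k) : h = k := by
  have key : ∀ l : F.obj (A.D.obj (A.U.obj X)) ⟶ Y, l = F.map (A.t' X) ≫ F.map (A.t X) ≫ l +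
      ∑ r ∈ Finset.range m, F.map (A.e r X) ≫ F.map (A.cup r X) ≫ l := by
    intro l
    have h1 := congrArg (fun f => F.map f ≫ l) (A.inv_right X)
    simp only [Functor.map_add, Functor.map_sum, Functor.map_comp, CategoryTheory.Functor.map_id,
      Category.id_comp, Preadditive.add_comp, Preadditive.sum_comp, Category.assoc] at h1
    exact h1.symm
  rw [key h, key k, ht]
  congr 1
  exact Finset.sum_congr rfl fun r hr => by rw [hc r (Finset.mem_range.mp hr)]

theorem hom_ext_id {X Y : C} {h k : A.D.obj (A.U.obj X) ⟶ Y}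
    (ht : A.t X ≫ h = A.t X ≫ k)
    (hc : ∀ r, r < m → A.cup r X ≫ h = A.cup r X ≫ k) : h = k :=
  A.hom_ext (𝟭 C) ht hc

theorem pred_lt (A : HeisAction C m) : m - 1 < m := Nat.sub_one_lt A.ne_zero

theorem t_d' (X : C) : A.t X ≫ A.d' X = 0 := by
  rw [← A.e_last, A.t_e _ _ A.pred_lt]

theorem b_of_lt (r : ℕ) (X : C) (hr : r + 1 < m) : A.b r X = 0 := by
  rw [CapAction.b, ← A.e_last]
  exact A.cup_e_of_ne _ _ _ (by omega) A.pred_lt (by omega)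

theorem b_pred (X : C) : A.b (m - 1) X = 𝟙 X := by
  rw [CapAction.b, ← A.e_last]
  exact A.cup_e_self _ _ A.pred_lt

theorem t_cap_succ (r : ℕ) (X : C) :
    A.t X ≫ A.cap (r + 1) X = A.x (A.D.obj X) ≫ A.t X ≫ A.cap r X + A.d X ≫ A.b r X := by
  rw [A.cap_succ, ← Category.assoc, A.t_dot, Preadditive.add_comp, Category.assoc, Category.assoc,
    ← A.cup_zero, A.cup_cap, Nat.zero_add]

/-- Starting from `t ≫ d' = 0`, an entry of the inversion relation, each dot moved through `t` adds
a bubble that is still zero. -/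
theorem t_cap_of_lt {r : ℕ} (hr : r < m) (X : C) : A.t X ≫ A.cap r X = 0 := by
  induction r with
  | zero => rw [A.cap_zero, A.t_d']
  | succ r ih => rw [t_cap_succ, ih (by omega), A.b_of_lt _ _ hr]; simp

/-- The `m`-th dot is the first to leave a nonzero bubble, `b (m - 1) = 1`, and with it the
rightward cap. -/
theorem t_cap_self (X : C) : A.t X ≫ A.cap m X = A.d X := by
  have h := A.t_cap_succ (m - 1) X
  rw [A.t_cap_of_lt A.pred_lt, A.b_pred, Nat.sub_add_cancel (Nat.pos_of_ne_zero A.ne_zero)] at h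
  rw [h]; simp

/-- By `cup_t` such a curl contains `t` followed by a dotted cap. -/
theorem s_cap_of_lt {r : ℕ} (hr : r < m) (X : C) :
    A.c (A.U.obj X) ≫ A.D.map (A.s X) ≫ A.cap r (A.U.obj X) = 0 := by
  rw [← reassoc_of% A.cup_t, A.t_cap_of_lt hr, Limits.comp_zero]

theorem leftCurl (X : C) : A.c (A.U.obj X) ≫ A.D.map (A.s X) ≫ A.d' (A.U.obj X) = 0 := by
  rw [← A.cap_zero, A.s_cap_of_lt (Nat.pos_of_ne_zero A.ne_zero)]

theorem cup_s_cap_of_lt {r : ℕ} (hr : r < m) (X : C) :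
    A.cup r (A.U.obj X) ≫ A.D.map (A.s X) ≫ A.d' (A.U.obj X) = 0 :=
  A.toCapAction.cup_s_cap_of_lt A.b_of_lt A.leftCurl hr X

theorem cup_s_cap_self (X : C) :
    A.cup m (A.U.obj X) ≫ A.D.map (A.s X) ≫ A.d' (A.U.obj X) = 𝟙 _ :=
  A.toCapAction.cup_s_cap_self A.ne_zero A.b_of_lt A.b_pred A.leftCurl X

/-- Dots pass one at a time through the second crossing and join the cap; each correction term is a
left curl killed by `s_cap_of_lt`, as fewer than `m` dots sit on the cap. When none are left between
the crossings, `s² = 1` leaves a bubble. -/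
theorem cup_sandwich (a r : ℕ) (h : a + r < m) (X : C) :
    A.c (A.U.obj X) ≫ A.D.map (A.s X ≫ A.U.map (A.xpow X r) ≫ A.s X) ≫ A.cap a (A.U.obj X) =
      A.b (a + r) (A.U.obj X) := by
  induction r generalizing a with
  | zero =>
    simp only [DottedAction.xpow, CategoryTheory.Functor.map_id, Category.id_comp, A.square]
    rw [← A.cup_zero, A.cup_cap, Nat.zero_add, Nat.add_zero]
  | succ r ih =>
    have hs : A.U.map (A.x X) ≫ A.s X = A.s X ≫ A.x (A.U.obj X) - 𝟙 _ := by
      rw [A.s_x, add_sub_cancel_right]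
    rw [DottedAction.xpow, Functor.map_comp A.U, Category.assoc, hs]
    simp only [Preadditive.comp_sub, Preadditive.sub_comp, Functor.map_sub, Functor.map_comp,
      Category.assoc, Category.comp_id]
    rw [← A.cap_succ, A.cap_nat, reassoc_of% A.s_cap_of_lt (show a < m by omega)]
    have := ih (a + 1) (by omega)
    simp only [Functor.map_comp, Category.assoc] at this
    rw [this, Limits.zero_comp, sub_zero]
    congr 1
    omega

/-- An upward strand passes over the leftward cap. -/
theorem t_s_cap (X : C) :
    A.t (A.U.obj X) ≫ A.D.map (A.s X) ≫ A.d' (A.U.obj X) = A.U.map (A.d' X) := by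
  refine A.hom_ext A.U ?_ fun r hr => ?_
  -- The braid relation brings `t` directly before `d'`, so both sides vanish on this test.
  · have h := A.braid_t X
    rw [reassoc_of% h, A.t_d', ← Functor.map_comp, A.t_d']
    simp
  · have h := A.cup_sandwich 0 r (by omega) X
    rw [A.cap_zero] at h
    simp only [Functor.map_comp, Category.assoc] at h
    rw [reassoc_of% A.map_cup_t, h, ← Functor.map_comp, Nat.zero_add]
    change _ = A.U.map (A.b r X)
    -- The bubble lies to the left of the strand on one side and to its right on the other; for `r <
    -- m` it is the scalar 0 or 1, so its position does not matter.
    by_cases hr' : r + 1 < m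
    · rw [A.b_of_lt _ _ hr', A.b_of_lt _ _ hr', Functor.map_zero]
    · obtain rfl : r = m - 1 := by omega
      rw [A.b_pred, A.b_pred, CategoryTheory.Functor.map_id]

/-- On `t` this is `t_s_cap`, because `t ≫ t' = 𝟙`; on the cups with fewer than `m` dots both sides
are zero. -/
theorem t'_cap (X : C) :
    A.t' (A.U.obj X) ≫ A.U.map (A.d' X) = A.D.map (A.s X) ≫ A.d' (A.U.obj X) := by
  refine A.hom_ext_id ?_ fun r hr => ?_
  · rw [reassoc_of% A.t_t', A.t_s_cap]
  · rw [reassoc_of% A.cup_t' _ _ hr, A.cup_s_cap_of_lt hr, Limits.zero_comp]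

/-- Pulling the crossing in `c'` across the cap turns the zigzag into a left curl with `m` dots,
which is the identity. -/
theorem left_up_zigzag (X : C) : A.c' (A.U.obj X) ≫ A.U.map (A.d' X) = 𝟙 _ := by
  rw [c', Category.assoc, A.t'_cap, A.cup_s_cap_self]

/-- This is `t_s_cap` rotated by the rightward cup and cap, so that the strand crossing `d'` points
downward. -/
theorem map_t_downCrossing_cap (X : C) :
    A.D.map (A.t X) ≫ A.downCrossing (A.U.obj X) ≫ A.D.map (A.d' X) = A.d' (A.D.obj X) := by
  simp only [CrossingAction.downCrossing, Category.assoc]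
  rw [reassoc_of% A.c_nat]
  simp only [← Functor.map_comp]
  rw [reassoc_of% A.t_nat, ← Functor.map_comp_assoc A.D, A.t_cap, Functor.map_comp A.D (A.s _),
    Category.assoc, A.d'_nat, reassoc_of% A.t_s_cap, Functor.map_comp, ← reassoc_of% A.c_nat,
      A.dn_zigzag,
    Category.comp_id]

/-- Straightening the rotated crossing against the cup moves its dots onto the cap. The result
vanishes for `r < m`, and for `r = m` it is a rightward zigzag by `t_cap_self`. -/
theorem map_cup_downCrossing_cap (r : ℕ) (X : C) :
    A.D.map (A.cup r X) ≫ A.downCrossing (A.U.obj X) ≫ A.D.map (A.d' X) =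
      A.c (A.D.obj X) ≫ A.D.map (A.t X ≫ A.cap r X) := by
  simp only [CrossingAction.downCrossing, Category.assoc]
  rw [reassoc_of% A.c_nat]
  simp only [← Functor.map_comp]
  rw [reassoc_of% A.t_nat, ← Functor.map_comp_assoc A.D, A.map_cup_cap, CapAction.cap]

/-- The counterpart of `t'_cap` for a downward strand, tested on `t` and the dotted cups placed
under `D`. -/
theorem map_t'_cap (X : C) :
    A.D.map (A.t' X) ≫ A.d' (A.D.obj X) = A.downCrossing (A.U.obj X) ≫ A.D.map (A.d' X) := by
  refine A.hom_ext A.D ?_ fun r hr => ?_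
  · rw [← Functor.map_comp_assoc, A.t_t', A.map_t_downCrossing_cap]
    simp
  · rw [← Functor.map_comp_assoc, A.cup_t' _ _ hr, A.map_cup_downCrossing_cap, A.t_cap_of_lt hr]
    simp

theorem left_dn_zigzag (X : C) : A.D.map (A.c' X) ≫ A.d' (A.D.obj X) = 𝟙 _ := by
  rw [c', Functor.map_comp, Category.assoc, A.map_t'_cap, A.map_cup_downCrossing_cap, A.t_cap_self,
    A.dn_zigzag]

/-- The adjoined leftward crossing is the rotation of `s` by the leftward cup and cap. -/
theorem leftCrossing_eq (X : C) :
    A.D.map (A.U.map (A.c' X)) ≫ A.D.map (A.s (A.D.obj X)) ≫ A.d' (A.U.obj (A.D.obj X)) =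
      A.t' X := by
  -- Once the crossing under the cap is replaced by `t'`, naturality of `t'` brings `c'` and `d'`
  -- together into a zigzag.
  rw [← A.t'_cap, reassoc_of% A.t'_nat, ← Functor.map_comp, A.left_dn_zigzag,
    CategoryTheory.Functor.map_id, Category.comp_id]

/-- The inner cup, the crossing and the inner cap make up `t'` by `leftCrossing_eq`. `map_t'_cap`
turns it into `downCrossing`, and the outer cup and cap then straighten. -/
theorem cyclic_crossing (X : C) :
    A.D.map (A.D.map (A.c' X ≫ A.U.map (A.c' (A.D.obj X)))) ≫
      A.D.map (A.D.map (A.s (A.D.obj (A.D.obj X)))) ≫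
      A.D.map (A.d' (A.U.obj (A.D.obj (A.D.obj X)))) ≫ A.d' (A.D.obj (A.D.obj X)) =
      A.downCrossing X := by
  have h := A.leftCrossing_eq (A.D.obj X)
  simp only [← Functor.map_comp_assoc] at h ⊢
  simp only [Functor.map_comp, Category.assoc] at h ⊢
  have h' := congrArg (fun f => A.D.map f) h
  simp only [Functor.map_comp] at h'
  rw [reassoc_of% h', A.map_t'_cap, reassoc_of% A.downCrossing_nat, ← Functor.map_comp,
    A.left_dn_zigzag, CategoryTheory.Functor.map_id, Category.comp_id]

/-- The corrections in `t_y` and `t_dot` are the same `d ≫ c`, and their main terms die against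
`d'`; on a cup, either dot just raises the number of dots by one. -/
theorem y_cap' (X : C) : A.y (A.U.obj X) ≫ A.d' X = A.D.map (A.x X) ≫ A.d' X := by
  refine A.hom_ext_id ?_ fun r _ => ?_
  · rw [reassoc_of% A.t_y, reassoc_of% A.t_dot, Preadditive.add_comp, Preadditive.add_comp]
    simp only [Category.assoc]
    rw [A.t_d', Limits.comp_zero, Limits.comp_zero]
  · rw [reassoc_of% A.cup_comp_y, A.cup_succ, Category.assoc]

theorem cyclic_dot (X : C) :
    A.D.map (A.c' X) ≫ A.D.map (A.x (A.D.obj X)) ≫ A.d' (A.D.obj X) = A.y X := by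
  rw [← A.y_cap', reassoc_of% A.y_nat, A.left_dn_zigzag, Category.comp_id]

/-- Joining the cup to the dotted caps produces the bubbles in the recursion for `coeff`. -/
theorem cup_b_coeff (n : ℕ) (X : C) :
    A.cup m X ≫ (∑ q ∈ Finset.range (n + 1), A.cap q X ≫ A.coeff m X (n - q)) =
      -A.coeff m X (n + 1) := by
  rw [A.coeff_succ, neg_neg, Preadditive.comp_sum, ← Finset.sum_range_reflect]
  refine Finset.sum_congr rfl fun q hq => ?_
  rw [Finset.mem_range] at hq
  rw [← Category.assoc, A.cup_cap]
  congr 2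
  all_goals omega

/-- An extra dot on `e (r + 1)` turns the test cup with `j` dots into the one with `j + 1`, which
shifts the dual index down by one. Only `j = m - 1` leaves the range; the subtracted term corrects
exactly this case, since `d'` detects only that cup. -/
theorem e_pred (r : ℕ) (hr : r + 1 < m) (X : C) :
    A.e r X = A.D.map (A.x X) ≫ A.e (r + 1) X - A.d' X ≫ A.cup m X ≫ A.e (r + 1) X := by
  refine A.hom_ext_id ?_ fun j hj => ?_
  · rw [A.t_e _ _ (by omega), Preadditive.comp_sub, reassoc_of% A.t_dot, reassoc_of% A.t_d',
      Preadditive.add_comp, Category.assoc, Category.assoc, A.t_e _ _ hr, ← A.cup_zero,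
      A.cup_e_of_ne _ _ _ (by omega) hr (by omega)]
    simp
  · rw [Preadditive.comp_sub, ← Category.assoc, ← A.cup_succ]
    have hb : A.cup j X ≫ A.d' X = A.b j X := rfl
    rw [reassoc_of% hb]
    by_cases h : j + 1 < m
    · rw [A.b_of_lt _ _ h, Limits.zero_comp, sub_zero]
      by_cases h' : j = r
      · subst h'
        rw [A.cup_e_self _ _ hj, A.cup_e_self _ _ h]
      · rw [A.cup_e_of_ne _ _ _ hj (by omega) h', A.cup_e_of_ne _ _ _ h hr (by omega)]
    · obtain rfl : j = m - 1 := by omega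
      rw [A.b_pred, Category.id_comp, Nat.sub_add_cancel (by omega), sub_self,
        A.cup_e_of_ne _ _ _ hj (by omega) (by omega)]

/-- The entries of the inverse matrix in terms of dotted caps and bubbles. -/
theorem e_eq_sum (n : ℕ) (hn : n < m) (X : C) :
    A.e (m - 1 - n) X = ∑ q ∈ Finset.range (n + 1), A.cap q X ≫ A.coeff m X (n - q) := by
  induction n with
  | zero => simp [A.e_last, A.cap_zero, CapAction.coeff]
  | succ n ih =>
    have hm : m - 1 - (n + 1) + 1 = m - 1 - n := by omega
    -- The correction term of `e_pred` becomes `d' ≫ c_{n+1}` by `cup_b_coeff`, which is the summand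
    -- `q = 0`.
    rw [A.e_pred _ (by omega), hm, ih (by omega), A.cup_b_coeff, Finset.sum_range_succ' _ (n + 1),
      Preadditive.comp_sum, A.cap_zero, Preadditive.comp_neg, sub_neg_eq_add, Nat.sub_zero]
    congr 1
    refine Finset.sum_congr rfl fun q _ => ?_
    rw [A.cap_succ, Category.assoc, Nat.add_sub_add_right]

/-- Substitute `e_eq_sum` into `inv_right`: the double sum runs over the triangle `r + q ≤ m - 1`,
so the order of summation may be exchanged, and centrality moves the coefficients in front of the
caps. -/
theorem t'_t_eq (X : C) : A.t' X ≫ A.t X = 𝟙 _ - ∑ r : Fin m, ∑ q : Fin (m - r.val),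
    A.coeff m (A.D.obj (A.U.obj X)) (m - 1 - r.val - q.val) ≫ A.cap r.val X ≫
      A.cup q.val X := by
  rw [eq_sub_iff_add_eq, ← A.inv_right X]
  congr 1
  rw [← Finset.sum_range (fun r => ∑ q : Fin (m - r),
    A.coeff m (A.D.obj (A.U.obj X)) (m - 1 - r - q.val) ≫ A.cap r X ≫ A.cup q.val X)]
  simp only [fun r => (Finset.sum_range (n := m - r) (fun q =>
    A.coeff m (A.D.obj (A.U.obj X)) (m - 1 - r - q) ≫ A.cap r X ≫ A.cup q X)).symm]
  rw [Finset.sum_comm' (s' := fun q => Finset.range (m - q)) (t' := Finset.range m)]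
  · refine Finset.sum_congr rfl fun q hq => ?_
    rw [Finset.mem_range] at hq
    have h := A.e_eq_sum (m - 1 - q) (by omega) X
    rw [show m - 1 - (m - 1 - q) = q by omega, show m - 1 - q + 1 = m - q by omega] at h
    rw [h, Preadditive.sum_comp]
    refine Finset.sum_congr rfl fun r _ => ?_
    rw [← Category.assoc (A.coeff _ _ _), ← A.coeff_nat, Nat.sub_right_comm]
  · intro q r
    simp only [Finset.mem_range]
    omega

/-- For `m = 1` the cup defining `c'` has one dot, so this is `inv_right` composed with that cup. -/
theorem t_c' (h : m = 1) (X : C) : A.c' X ≫ A.t X = A.cup 1 X - A.b 1 X ≫ A.c X := by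
  subst h
  have h1 := congrArg (fun f => A.cup 1 X ≫ f) (A.inv_right X)
  simp only [Finset.sum_range_one, Preadditive.comp_add, Category.comp_id] at h1
  have h0 : A.e 0 X = A.d' X := A.e_last X
  rw [h0, A.cup_zero] at h1
  rw [c', Category.assoc, CapAction.b, Category.assoc, eq_sub_iff_add_eq, h1]

/-- The composite of the leftward cup and the rightward crossing is a right curl on a cup. -/
theorem rightCurl_eq (h : m = 1) (hb : ∀ X, A.b 1 X = 0) (X : C) :
    A.U.map (A.c' X) ≫ A.s (A.D.obj X) ≫ A.U.map (A.d X) = A.x X := by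
  rw [← A.t_cap, ← Functor.map_comp_assoc, A.t_c' h, hb, Limits.zero_comp, sub_zero, A.map_cup_cap]
  simp [DottedAction.xpow]

end HeisAction

end HeisenbergCategory

/-! ### Recovering the inversion relation from the Mackaay–Savage relations. -/

namespace HeisenbergCategory

/-- An action of the Mackaay–Savage category of level `m` (without the isotopy relations which are
not needed to recover the Heisenberg category). -/
structure MSAction (C : Type u) [Category.{v} C] [Preadditive C] (m : ℕ) extends
    CapAction C where
  c' (X : C) : X ⟶ U.obj (D.obj X)
  ne_zero : m ≠ 0
  t_leftCrossing (X : C) : toCrossingAction.t X ≫ D.map (U.map (c' X)) ≫ D.map (s (D.obj X)) ≫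
    d' (U.obj (D.obj X)) = 𝟙 _
  leftCrossing_t (X : C) : (D.map (U.map (c' X)) ≫ D.map (s (D.obj X)) ≫
    d' (U.obj (D.obj X))) ≫ toCrossingAction.t X = 𝟙 _ -
      ∑ r ∈ Finset.range m, ∑ q ∈ Finset.range (m - r),
        toCapAction.coeff m (D.obj (U.obj X)) (m - 1 - r - q) ≫ toCapAction.cap r X ≫
          toDottedAction.cup q X
  leftCurl (X : C) : c (U.obj X) ≫ D.map (s X) ≫ d' (U.obj X) = 0
  b_of_lt (r : ℕ) (X : C) : r + 1 < m → toCapAction.b r X = 0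
  b_pred (X : C) : toCapAction.b (m - 1) X = 𝟙 X

namespace MSAction

variable {C : Type u} [Category.{v} C] [Preadditive C] {m : ℕ} (A : MSAction C m)

/-- The leftward crossing. -/
def t' (X : C) : A.D.obj (A.U.obj X) ⟶ A.U.obj (A.D.obj X) :=
  A.D.map (A.U.map (A.c' X)) ≫ A.D.map (A.s (A.D.obj X)) ≫ A.d' (A.U.obj (A.D.obj X))

/-- The combination of dotted caps dual to the cup with `r` dots. -/
def e (r : ℕ) (X : C) : A.D.obj (A.U.obj X) ⟶ X :=
  ∑ q ∈ Finset.range (m - r), A.cap q X ≫ A.coeff m X (m - 1 - r - q)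

theorem t_t' (X : C) : A.t X ≫ A.t' X = 𝟙 _ := A.t_leftCrossing X

theorem inv_right (X : C) :
    A.t' X ≫ A.t X + ∑ r ∈ Finset.range m, A.e r X ≫ A.cup r X = 𝟙 _ := by
  have h := A.leftCrossing_t X
  rw [t', h, sub_add_eq_add_sub, add_sub_assoc, sub_eq_zero.mpr, add_zero]
  simp only [e, Preadditive.sum_comp]
  rw [Finset.sum_comm' (s' := fun q => Finset.range (m - q)) (t' := Finset.range m)]
  · refine Finset.sum_congr rfl fun q _ => Finset.sum_congr rfl fun r _ => ?_
    rw [← Category.assoc (A.coeff _ _ _), ← A.coeff_nat, Nat.sub_right_comm]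
  · intro q r
    simp only [Finset.mem_range]
    omega

/-- Pairing a cup with `e r` is a truncated convolution of bubbles with the coefficients of their
inverse series. -/
theorem cup_e (j r : ℕ) (X : C) : A.cup j X ≫ A.e r X =
    ∑ i ∈ Finset.range (m - r), A.b (j + (m - r - 1 - i)) X ≫ A.coeff m X i := by
  rw [e, Preadditive.comp_sum, ← Finset.sum_range_reflect]
  refine Finset.sum_congr rfl fun i hi => ?_
  rw [Finset.mem_range] at hi
  rw [← Category.assoc, A.cup_cap]
  congr 2
  omega

/-- The `i`-th bubble has `m - 1 - i` dots, so only `i = 0` survives. -/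
theorem cup_e_self (r : ℕ) (X : C) (hr : r < m) : A.cup r X ≫ A.e r X = 𝟙 X := by
  rw [cup_e, Finset.sum_eq_single 0]
  · rw [Nat.sub_zero, show r + (m - r - 1) = m - 1 by omega, A.b_pred]
    simp [CapAction.coeff]
  · intro i hi h0
    rw [Finset.mem_range] at hi
    rw [A.b_of_lt _ _ (by omega), Limits.zero_comp]
  · simp; omega

/-- If `j < r`, every bubble has fewer than `m - 1` dots. If `j > r`, this is the coefficient of
degree `j - r` in a product of inverse series; the surplus terms again have too few dots. -/
theorem cup_e_of_ne (j r : ℕ) (X : C) (hj : j < m) (hr : r < m) (h : j ≠ r) :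
    A.cup j X ≫ A.e r X = 0 := by
  rw [cup_e]
  by_cases hjr : j < r
  · refine Finset.sum_eq_zero fun i hi => ?_
    rw [Finset.mem_range] at hi
    rw [A.b_of_lt _ _ (by omega), Limits.zero_comp]
  · obtain ⟨n, rfl⟩ : ∃ n, j = r + n + 1 := ⟨j - r - 1, by omega⟩
    rw [← A.sum_coeff_b m n X (A.b_pred X) A.ne_zero]
    symm
    refine Finset.sum_subset_zero_on_sdiff (fun i => ?_) (fun i hi => ?_) fun i hi => ?_
    · simp only [Finset.mem_range]
      omega
    · simp only [Finset.mem_sdiff, Finset.mem_range] at hi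
      rw [A.b_of_lt _ _ (by omega), Limits.zero_comp]
    · rw [Finset.mem_range] at hi
      congr 2
      omega

/-- Composing `inv_right` with the cup before and `t'` after gives `f + f = f` for `f` the composite
in question, by duality and `t ≫ t' = 𝟙`. The same trick proves `t_e`. -/
theorem cup_t' (r : ℕ) (X : C) (hr : r < m) : A.cup r X ≫ A.t' X = 0 := by
  have h := congrArg (fun f => A.cup r X ≫ f ≫ A.t' X) (A.inv_right X)
  simp only [Preadditive.add_comp, Preadditive.comp_add, Category.assoc, Category.id_comp,
    A.t_t', Category.comp_id, Preadditive.sum_comp, Preadditive.comp_sum] at h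
  rw [add_eq_left, Finset.sum_eq_single r] at h
  · rwa [reassoc_of% A.cup_e_self r X hr] at h
  · intro q hq hqr
    rw [reassoc_of% A.cup_e_of_ne r q X hr (Finset.mem_range.mp hq) hqr.symm, Limits.zero_comp]
  · simp; omega

theorem t_e (r : ℕ) (X : C) (hr : r < m) : A.t X ≫ A.e r X = 0 := by
  have h := congrArg (fun f => A.t X ≫ f ≫ A.e r X) (A.inv_right X)
  simp only [Preadditive.add_comp, Preadditive.comp_add, Category.assoc, Category.id_comp,
    Preadditive.sum_comp, Preadditive.comp_sum] at h
  rw [reassoc_of% A.t_t', add_eq_left, Finset.sum_eq_single r] at h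
  · rwa [A.cup_e_self r X hr, Category.comp_id] at h
  · intro q hq hqr
    rw [A.cup_e_of_ne q r X (Finset.mem_range.mp hq) hr hqr, Limits.comp_zero, Limits.comp_zero]
  · simp; omega

theorem e_last (X : C) : A.e (m - 1) X = A.d' X := by
  have hm := A.ne_zero
  rw [e, show m - (m - 1) = 1 by omega]
  simp [CapAction.coeff, A.cap_zero]

/-- Naturality moves the cup past `c'`, where it closes up to a left curl with `m` dots, equal to
the identity. -/
theorem cup_t'_self (X : C) : A.cup m X ≫ A.t' X = A.c' X := by
  simp only [t']
  have h := A.cup_s_cap_self A.ne_zero A.b_of_lt A.b_pred A.leftCurl (A.D.obj X)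
  rw [← reassoc_of% A.cup_nat m (A.c' X), h, Category.comp_id]

end MSAction

/-! ### Khovanov's relations and the right curl. -/

/-- An action of Khovanov's category, without assuming cyclicity of the crossing. -/
structure KhovanovAction (C : Type u) [Category.{v} C] [Preadditive C] extends
    CrossingAction C where
  c' (X : C) : X ⟶ U.obj (D.obj X)
  d' (X : C) : D.obj (U.obj X) ⟶ X
  c'_nat {X Y : C} (f : X ⟶ Y) : f ≫ c' Y = c' X ≫ U.map (D.map f)
  left_up_zigzag (X : C) : c' (U.obj X) ≫ U.map (d' X) = 𝟙 _
  t_leftCrossing (X : C) : toCrossingAction.t X ≫ D.map (U.map (c' X)) ≫ D.map (s (D.obj X)) ≫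
    d' (U.obj (D.obj X)) = 𝟙 _
  leftCrossing_t (X : C) : (D.map (U.map (c' X)) ≫ D.map (s (D.obj X)) ≫
    d' (U.obj (D.obj X))) ≫ toCrossingAction.t X = 𝟙 _ - d' X ≫ c X
  bubble (X : C) : c X ≫ d' X = 𝟙 X

namespace KhovanovAction

variable {C : Type u} [Category.{v} C] [Preadditive C] (A : KhovanovAction C)

/-- The leftward crossing. -/
def t' (X : C) : A.D.obj (A.U.obj X) ⟶ A.U.obj (A.D.obj X) :=
  A.D.map (A.U.map (A.c' X)) ≫ A.D.map (A.s (A.D.obj X)) ≫ A.d' (A.U.obj (A.D.obj X))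

theorem t_t' (X : C) : A.t X ≫ A.t' X = 𝟙 _ := A.t_leftCrossing X

theorem t'_t (X : C) : A.t' X ≫ A.t X = 𝟙 _ - A.d' X ≫ A.c X := by
  rw [← A.leftCrossing_t, t']

/-- Compose the formula for `t' ≫ t` with `t` and `d'`: since the bubble is 1, the factor `𝟙 - d' ≫
c` kills `d'`. It also kills `c` from the other side, whence `cup_t'`. -/
theorem t_d' (X : C) : A.t X ≫ A.d' X = 0 := by
  have h := congrArg (fun f => A.t X ≫ f ≫ A.d' X) (A.t'_t X)
  simp only [Category.assoc, Preadditive.sub_comp, Category.id_comp, A.bubble, Category.comp_id,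
    sub_self, Limits.comp_zero] at h
  rwa [reassoc_of% A.t_t'] at h

theorem cup_t' (X : C) : A.c X ≫ A.t' X = 0 := by
  have h := congrArg (fun f => A.c X ≫ f ≫ A.t' X) (A.t'_t X)
  simp only [Category.assoc, Preadditive.sub_comp, Preadditive.comp_sub, Category.id_comp,
    A.t_t', Category.comp_id, reassoc_of% A.bubble, sub_self] at h
  exact h

/-- The right curl, which plays the role of the dot. -/
def x (X : C) : A.U.obj X ⟶ A.U.obj X :=
  A.U.map (A.c' X) ≫ A.s (A.D.obj X) ≫ A.U.map (A.d X)

/-- The leftward analogue of `cup_t`: a zigzag undoes the rotation in `t'`. -/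
theorem cup_map_t' (X : C) :
    A.c' (A.U.obj X) ≫ A.U.map (A.t' X) = A.U.map (A.c' X) ≫ A.s (A.D.obj X) := by
  simp only [t', Functor.map_comp]
  rw [← reassoc_of% A.c'_nat, ← reassoc_of% A.c'_nat, A.left_up_zigzag, Category.comp_id]

/-- The braid relation pushes the free strand through the curl, which creates a double crossing `t'
≫ t` inside it. Of its two terms, the identity leaves the curl on the other strand, and `d' ≫ c`
cuts the loop so that the zigzags leave a single `s`. -/
theorem s_x_s (X : C) : A.s X ≫ A.U.map (A.x X) ≫ A.s X = A.x (A.U.obj X) - A.s X := by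
  have h1 : A.s X ≫ A.U.map (A.x X) ≫ A.s X =
      A.U.map (A.U.map (A.c' X)) ≫ (A.s (A.U.obj (A.D.obj X)) ≫ A.U.map (A.s (A.D.obj X)) ≫
        A.s (A.U.obj (A.D.obj X))) ≫ A.U.map (A.U.map (A.d X)) := by
    simp only [x, Functor.map_comp, Category.assoc]
    rw [A.s_nat, reassoc_of% A.s_nat]
  have h2 : A.s X ≫ A.U.map (A.x X) ≫ A.s X =
      A.U.map (A.U.map (A.c' X) ≫ A.s (A.D.obj X)) ≫ A.s (A.U.obj (A.D.obj X)) ≫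
        A.U.map (A.s (A.D.obj X) ≫ A.U.map (A.d X)) := by
    rw [h1, A.braid]
    simp only [Functor.map_comp, Category.assoc]
  rw [h2, ← A.t_cap, ← A.cup_map_t', Functor.map_comp, Functor.map_comp, Category.assoc,
    reassoc_of% A.s_nat, ← Functor.map_comp_assoc A.U (A.U.map (A.t' X)), ← Functor.map_comp A.U
      (A.t' X),
    A.t'_t]
  simp only [Functor.map_sub, Functor.map_comp, CategoryTheory.Functor.map_id, Category.id_comp,
    Preadditive.sub_comp, Preadditive.comp_sub, Category.assoc]
  rw [← Functor.map_comp A.U (A.U.map (A.c X)), A.up_zigzag, CategoryTheory.Functor.map_id,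
    Category.comp_id, ← A.s_nat, ← Functor.map_comp_assoc, A.left_up_zigzag,
    CategoryTheory.Functor.map_id, Category.id_comp]
  rfl

/-- Composing `s_x_s` with `s` in front turns it into the Hecke relation. -/
theorem slide (X : C) : A.s X ≫ A.x (A.U.obj X) - A.U.map (A.x X) ≫ A.s X = 𝟙 _ := by
  have h := congrArg (fun f => A.s X ≫ f) (A.s_x_s X)
  simp only [Preadditive.comp_sub, A.square, reassoc_of% A.square] at h
  rw [h, sub_sub_cancel]

/-- Placed on the cup, the curl unrolls. With `t ≫ t' = 𝟙` this gives the Heisenberg formula for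
`c'`, and with `t ≫ d' = 0` the vanishing of the bubble with one dot. -/
theorem cup_x (X : C) : A.c X ≫ A.D.map (A.x X) = A.c' X ≫ A.t X := by
  rw [CrossingAction.t, reassoc_of% A.c_nat, x]
  simp only [Functor.map_comp]

theorem cup_x_t' (X : C) : A.c X ≫ A.D.map (A.x X) ≫ A.t' X = A.c' X := by
  rw [reassoc_of% A.cup_x, A.t_t', Category.comp_id]

theorem cup_x_cap (X : C) : A.c X ≫ A.D.map (A.x X) ≫ A.d' X = 0 := by
  rw [reassoc_of% A.cup_x, A.t_d', Limits.comp_zero]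

end KhovanovAction

end HeisenbergCategory

namespace HeisenbergCategory

/-! ### Substituting diagrams for generators -/

namespace Diag

variable {R : Type u} {G G' : Word → Word → Type}

/-- Replaces every generating morphism of a diagram by a diagram. -/
def subst (φ : ∀ ⦃a b : Word⦄, G a b → Diag R G' a b) :
    ∀ {a b : Word}, Diag R G a b → Diag R G' a b
  | _, _, gen g => φ g
  | _, _, idd a => idd a
  | _, _, seq f g => seq (subst φ f) (subst φ g)
  | _, _, beside f g => beside (subst φ f) (subst φ g)
  | _, _, zero a b => zero a b
  | _, _, add f g => add (subst φ f) (subst φ g)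
  | _, _, smul r f => smul r (subst φ f)

variable (φ : ∀ ⦃a b : Word⦄, G a b → Diag R G' a b)

theorem subst_pow {a : Word} (x : Diag R G a a) (n : ℕ) :
    (x.pow n).subst φ = (x.subst φ).pow n := by
  induction n with
  | zero => rfl
  | succ n ih => simp only [pow, subst, ih]

theorem subst_sum {a b : Word} (n : ℕ) (f : Fin n → Diag R G a b) :
    (sum n f).subst φ = sum n (fun i => (f i).subst φ) := by
  induction n with
  | zero => rfl
  | succ n ih => simp only [sum, subst, ih]

theorem subst_dottedCup (x : Diag R G [Ori.up] [Ori.up]) (c : Diag R G [] [Ori.dn, Ori.up])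
    (r : ℕ) : (dottedCup x c r).subst φ = dottedCup (x.subst φ) (c.subst φ) r := by
  simp only [dottedCup, padL, subst, subst_pow]

theorem subst_dottedCap (x : Diag R G [Ori.up] [Ori.up]) (d' : Diag R G [Ori.dn, Ori.up] [])
    (r : ℕ) : (dottedCap x d' r).subst φ = dottedCap (x.subst φ) (d'.subst φ) r := by
  simp only [dottedCap, padL, subst, subst_pow]

theorem subst_bubble (x : Diag R G [Ori.up] [Ori.up]) (c : Diag R G [] [Ori.dn, Ori.up])
    (d' : Diag R G [Ori.dn, Ori.up] []) (r : ℕ) :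
    (bubble x c d' r).subst φ = bubble (x.subst φ) (c.subst φ) (d'.subst φ) r := by
  simp only [bubble, subst, subst_dottedCup]

theorem subst_coeff [CommRing R] (m : ℕ) (b : ℕ → Diag R G [] []) (n : ℕ) :
    (coeff m b n).subst φ = coeff m (fun r => (b r).subst φ) n := by
  induction n using Nat.strong_induction_on with
  | _ n ih =>
    cases n with
    | zero => simp only [coeff, subst]
    | succ n =>
      simp only [coeff, subst, subst_sum]
      congr 2
      funext i
      rw [ih _ i.isLt]

end Diag

section Subst

variable {R : Type u} [CommRing R] {G G' : Word → Word → Type} {rel : Relations R G}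
  {rel' : Relations R G'}

theorem Cong.subst {φ : ∀ ⦃a b : Word⦄, G a b → Diag R G' a b}
    (hφ : ∀ ⦃a b : Word⦄ (f g : Diag R G a b), rel f g → Cong rel' (f.subst φ) (g.subst φ))
    {a b a' b' : Word} {f : Diag R G a b} {g : Diag R G a' b'} (h : Cong rel f g) :
    Cong rel' (f.subst φ) (g.subst φ) := by
  induction h with
  | of h => exact hφ _ _ h
  | refl => exact .refl _
  | symm _ ih => exact ih.symm
  | trans _ _ ih ih' => exact ih.trans ih'
  | seq _ _ ih ih' => exact .seq ih ih'
  | beside _ _ ih ih' => exact .beside ih ih'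
  | add _ _ ih ih' => exact .add ih ih'
  | smul r _ ih => exact .smul r ih
  | idd_seq => exact .idd_seq _
  | seq_idd => exact .seq_idd _
  | seq_assoc => exact .seq_assoc _ _ _
  | idd_beside_idd => exact .idd_beside_idd _ _
  | interchange => exact .interchange _ _ _ _
  | beside_assoc => exact .beside_assoc _ _ _
  | one_beside => exact .one_beside _
  | beside_one => exact .beside_one _
  | add_comm => exact .add_comm _ _
  | add_assoc => exact .add_assoc _ _ _
  | zero_add => exact .zero_add _
  | neg_add => exact .neg_add _
  | one_smul => exact .one_smul _
  | mul_smul => exact .mul_smul _ _ _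
  | smul_add => exact .smul_add _ _ _
  | add_smul => exact .add_smul _ _ _
  | add_seq => exact .add_seq _ _ _
  | seq_add => exact .seq_add _ _ _
  | smul_seq => exact .smul_seq _ _ _
  | seq_smul => exact .seq_smul _ _ _
  | add_beside => exact .add_beside _ _ _
  | beside_add => exact .beside_add _ _ _
  | smul_beside => exact .smul_beside _ _ _
  | beside_smul => exact .beside_smul _ _ _

theorem Cong.subst_subst {φ : ∀ ⦃a b : Word⦄, G a b → Diag R G' a b}
    {ψ : ∀ ⦃a b : Word⦄, G' a b → Diag R G a b}
    (h : ∀ ⦃a b : Word⦄ (g : G a b), Cong rel ((φ g).subst ψ) (Diag.gen g))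
    {a b : Word} (f : Diag R G a b) : Cong rel ((f.subst φ).subst ψ) f := by
  induction f with
  | gen g => exact h g
  | idd => exact .refl _
  | seq _ _ ih ih' => exact .seq ih ih'
  | beside _ _ ih ih' => exact .beside ih ih'
  | zero => exact .refl _
  | add _ _ ih ih' => exact .add ih ih'
  | smul r _ ih => exact .smul r ih

theorem Cong.of_eq {a b : Word} {f g : Diag R G a b} (h : f = g) : Cong rel f g := h ▸ .refl _

variable (rel rel') in
/-- Mutually inverse substitutions between two presentations with the same objects. -/
structure PresEquiv where
  toFun : ∀ ⦃a b : Word⦄, G a b → Diag R G' a b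
  invFun : ∀ ⦃a b : Word⦄, G' a b → Diag R G a b
  toFun_rel : ∀ ⦃a b : Word⦄ (f g : Diag R G a b), rel f g →
    Cong rel' (f.subst toFun) (g.subst toFun)
  invFun_rel : ∀ ⦃a b : Word⦄ (f g : Diag R G' a b), rel' f g →
    Cong rel (f.subst invFun) (g.subst invFun)
  left_inv : ∀ ⦃a b : Word⦄ (g : G a b), Cong rel ((toFun g).subst invFun) (Diag.gen g)
  right_inv : ∀ ⦃a b : Word⦄ (g : G' a b), Cong rel' ((invFun g).subst toFun) (Diag.gen g)

namespace PresEquiv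

variable (E : PresEquiv rel rel')

/-- The functor between presented categories given by a substitution. -/
def functor : Pres rel ⥤ Pres rel' where
  obj X := ⟨X.word⟩
  map {X Y} f := Quotient.map (sa := Pres.homSetoid rel X.word Y.word)
    (sb := Pres.homSetoid rel' X.word Y.word) (fun f => f.subst E.toFun)
    (fun _ _ h => Cong.subst E.toFun_rel h) f
  map_id _ := rfl
  map_comp f g := by
    induction f using Quotient.inductionOn
    induction g using Quotient.inductionOn
    rfl

instance : E.functor.Additive where
  map_add {X Y f g} := by
    induction f using Quotient.inductionOn
    induction g using Quotient.inductionOn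
    rfl

instance : E.functor.Linear R where
  map_smul {X Y} f r := by
    induction f using Quotient.inductionOn
    rfl

theorem functor_bijective_map (X Y : Pres rel) :
    Function.Bijective (fun f : X ⟶ Y => E.functor.map f) := by
  constructor
  · intro f g h
    obtain ⟨f, rfl⟩ := Pres.mor_surjective f
    obtain ⟨g, rfl⟩ := Pres.mor_surjective g
    have h' : Cong rel' (f.subst E.toFun) (g.subst E.toFun) := Quotient.exact h
    exact Pres.mor_eq ((Cong.subst_subst E.left_inv f).symm.trans
      ((h'.subst E.invFun_rel).trans (Cong.subst_subst E.left_inv g)))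
  · intro f
    obtain ⟨f, rfl⟩ := Pres.mor_surjective f
    exact ⟨Pres.mor rel (f.subst E.invFun), Pres.mor_eq (Cong.subst_subst E.right_inv f)⟩

theorem functor_tensorHom {X Y X' Y' : Pres rel} (f : X ⟶ Y) (g : X' ⟶ Y') :
    E.functor.map (f ⊗ₘ g) = (E.functor.map f ⊗ₘ E.functor.map g) := by
  obtain ⟨f, rfl⟩ := Pres.mor_surjective f
  obtain ⟨g, rfl⟩ := Pres.mor_surjective g
  rfl

end PresEquiv

end Subst

end HeisenbergCategory

/-! ### Extending substitutions to additive envelopes. -/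

namespace HeisenbergCategory

namespace AdditiveEnvelope

/-- The associators and unitors of `Mat_` are reindexings of those of the underlying category; this
reduces their preservation to that of `eqToHom`. -/
theorem map_reindex {C : Type u} [Category.{w} C] [Preadditive C] {D : Type v} [Category.{w} D]
    [Preadditive D] (F : C ⥤ D) [F.Additive] {M N : Mat_ C} (e : M.ι → N.ι)
    (φ : ∀ i, M.X i ⟶ N.X (e i)) :
    F.mapMat_.map (reindex e φ) =
      reindex (M := F.mapMat_.obj M) (N := F.mapMat_.obj N) e (fun i => F.map (φ i)) := by
  refine Mat_.hom_ext _ _ fun (i : M.ι) (j : N.ι) => ?_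
  change F.map (reindex e φ i j) = _
  by_cases h : e i = j
  · subst h
    rw [reindex_self]
    exact (reindex_self (M := F.mapMat_.obj M) (N := F.mapMat_.obj N) e
      (fun i => F.map (φ i)) i).symm
  · rw [reindex_of_ne e φ h, F.map_zero]
    exact (reindex_of_ne (M := F.mapMat_.obj M) (N := F.mapMat_.obj N) e
      (fun i => F.map (φ i)) h).symm

end AdditiveEnvelope

namespace PresEquiv

open AdditiveEnvelope

variable {R : Type u} [CommRing R] {G G' : Word → Word → Type} {rel : Relations R G}
  {rel' : Relations R G'} (E : PresEquiv rel rel')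

/-- The functor between additive envelopes given by a substitution. -/
noncomputable def matFunctor : Envelope rel ⥤ Envelope rel' := E.functor.mapMat_

theorem matFunctor_associator (X Y Z : Envelope rel) :
    E.matFunctor.map (α_ X Y Z).hom =
      (α_ (E.matFunctor.obj X) (E.matFunctor.obj Y) (E.matFunctor.obj Z)).hom := by
  refine (map_reindex E.functor _ _).trans ?_
  refine congrArg (reindex (M := (E.matFunctor.obj X ⊗ E.matFunctor.obj Y) ⊗ E.matFunctor.obj Z)
    (N := E.matFunctor.obj X ⊗ E.matFunctor.obj Y ⊗ E.matFunctor.obj Z)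
    (Equiv.prodAssoc X.ι Y.ι Z.ι)) ?_
  refine funext fun (p : (X.ι × Y.ι) × Z.ι) => ?_
  exact eqToHom_map E.functor (congrArg Pres.mk
    (List.append_assoc (X.X p.1.1).word (Y.X p.1.2).word (Z.X p.2).word))

theorem matFunctor_leftUnitor (X : Envelope rel) :
    E.matFunctor.map (λ_ X).hom = (λ_ (E.matFunctor.obj X)).hom := by
  refine (map_reindex E.functor _ _).trans ?_
  refine congrArg (reindex (M := 𝟙_ (Envelope rel') ⊗ E.matFunctor.obj X)
    (N := E.matFunctor.obj X) (Equiv.punitProd X.ι)) ?_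
  refine funext fun (p : PUnit × X.ι) => ?_
  exact eqToHom_map E.functor (congrArg Pres.mk (List.nil_append (X.X p.2).word))

theorem matFunctor_rightUnitor (X : Envelope rel) :
    E.matFunctor.map (ρ_ X).hom = (ρ_ (E.matFunctor.obj X)).hom := by
  refine (map_reindex E.functor _ _).trans ?_
  refine congrArg (reindex (M := E.matFunctor.obj X ⊗ 𝟙_ (Envelope rel'))
    (N := E.matFunctor.obj X) (Equiv.prodPUnit X.ι)) ?_
  refine funext fun (p : X.ι × PUnit) => ?_
  exact eqToHom_map E.functor (congrArg Pres.mk (List.append_nil (X.X p.1).word))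

theorem matFunctor_tensorHom {X Y X' Y' : Envelope rel} (f : X ⟶ Y) (g : X' ⟶ Y') :
    E.matFunctor.map (f ⊗ₘ g) = (E.matFunctor.map f ⊗ₘ E.matFunctor.map g) := by
  ext p q
  exact E.functor_tensorHom _ _

/-- The strict monoidal structure of `matFunctor`. -/
noncomputable def matCoreMonoidal : E.matFunctor.CoreMonoidal where
  εIso := Iso.refl (𝟙_ (Envelope rel'))
  μIso X Y := Iso.refl (E.matFunctor.obj X ⊗ E.matFunctor.obj Y)
  μIso_hom_natural_left {X Y} f X' := by
    refine (Category.comp_id _).trans (Eq.trans ?_ (Category.id_comp _).symm)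
    rw [← tensorHom_id, ← tensorHom_id, ← E.matFunctor.map_id]
    exact (E.matFunctor_tensorHom f (𝟙 X')).symm
  μIso_hom_natural_right {X Y} X' f := by
    refine (Category.comp_id _).trans (Eq.trans ?_ (Category.id_comp _).symm)
    rw [← id_tensorHom, ← id_tensorHom, ← E.matFunctor.map_id]
    exact (E.matFunctor_tensorHom (𝟙 X') f).symm
  associativity X Y Z := by
    rw [matFunctor_associator]
    refine Eq.trans (congrArg₂ (· ≫ ·) (id_whiskerRight _ _) (Category.id_comp _)) ?_
    refine (Category.id_comp _).trans (Eq.symm ?_)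
    refine (congrArg (_ ≫ ·) ((congrArg₂ (· ≫ ·) (whiskerLeft_id _ _) rfl).trans
      (Category.id_comp _))).trans ?_
    exact Category.comp_id _
  left_unitality X := by
    rw [matFunctor_leftUnitor]
    exact ((congrArg₂ (· ≫ ·) (id_whiskerRight _ _) (Category.id_comp _)).trans
      (Category.id_comp _)).symm
  right_unitality X := by
    rw [matFunctor_rightUnitor]
    exact ((congrArg₂ (· ≫ ·) (whiskerLeft_id _ _) (Category.id_comp _)).trans
      (Category.id_comp _)).symm

/-- The isomorphism of additive envelopes given by mutually inverse substitutions. -/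
noncomputable def toIso : StrictMonoidalIso R (Envelope rel) (Envelope rel') where
  functor := E.matFunctor
  additive := ⟨fun {X Y f g} => by
    ext i j
    exact E.functor.map_add⟩
  linear := ⟨fun {X Y} f r => by
    ext i j
    exact E.functor.map_smul r (f i j)⟩
  bijective_obj := by
    constructor
    · rintro ⟨ι, X⟩ ⟨ι', X'⟩ h
      have h' := congrArg (fun M : Envelope rel' => (⟨M.ι, fun i => ⟨(M.X i).word⟩⟩ : Envelope
        rel)) h
      exact h'
    · exact fun M => ⟨⟨M.ι, fun i => ⟨(M.X i).word⟩⟩, rfl⟩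
  bijective_map X Y := by
    constructor
    · intro f g h
      ext i j
      exact (E.functor_bijective_map _ _).1 (congrFun (congrFun h i) j)
    · intro f
      choose g hg using fun i j => (E.functor_bijective_map (X.X i) (Y.X j)).2 (f i j)
      exact ⟨g, funext fun i => funext fun j => hg i j⟩
  monoidal := E.matCoreMonoidal.toMonoidal
  unit_obj := rfl
  tensor_obj _ _ := rfl
  unit_strict := rfl
  tensor_strict _ _ := rfl

theorem sends {a b : Word} (f : Diag R G a b) (g : Diag R G' a b)
    (h : Cong rel' (f.subst E.toFun) g) : Sends E.toIso f g := by
  have h' : E.functor.map (Pres.mor rel f) = Pres.mor rel' g := Pres.mor_eq h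
  exact congrArg (fun k => Arrow.mk ((Mat_.embedding (Pres rel')).map k)) h'

end PresEquiv

end HeisenbergCategory

/-! ### A presented category acting on itself. -/

namespace HeisenbergCategory

open Ori Diag

section Strand

variable {R : Type u} [CommRing R] {G : Word → Word → Type} {rel : Relations R G}

/-- Adding a vertical strand on the left. -/
def strand (rel : Relations R G) (o : Ori) : Pres rel ⥤ Pres rel where
  obj X := ⟨o :: X.word⟩
  map f := Pres.tensorHom' (𝟙 (⟨[o]⟩ : Pres rel)) f
  map_id X := Pres.id_tensor_id ⟨[o]⟩ X
  map_comp f g := MonoidalCategory.whiskerLeft_comp (⟨[o]⟩ : Pres rel) f g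

instance (o : Ori) : (strand rel o).Additive where
  map_add {_ _ f g} := Pres.tensor_add' (𝟙 (⟨[o]⟩ : Pres rel)) f g

/-- The morphism represented by a diagram with vertical strands added on its right. -/
def act (rel : Relations R G) {a b : Word} (f : Diag R G a b) (X : Pres rel) :
    (⟨a ++ X.word⟩ : Pres rel) ⟶ ⟨b ++ X.word⟩ :=
  Pres.mor rel (f ⊠ idd X.word)

/-- `φ` is the morphism represented by the diagram `f` with the strands `w` added on its right, up
to strict associativity. -/
def Represents {a b : Word} (f : Diag R G a b) (w : Word) {X Y : Pres rel} (φ : X ⟶ Y) : Prop :=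
  ∃ F : Diag R G X.word Y.word, Pres.mor rel F = φ ∧ Cong rel (f ⊠ idd w) F

namespace Represents

variable {a b c : Word} {f : Diag R G a b} {g : Diag R G b c} {w : Word} {X Y Z : Pres rel}
  {φ : X ⟶ Y} {ψ : Y ⟶ Z}

theorem act (f : Diag R G a b) (X : Pres rel) : Represents f X.word (act rel f X) :=
  ⟨_, rfl, .refl _⟩

theorem seq (hf : Represents f w φ) (hg : Represents g w ψ) : Represents (f ⨾ g) w (φ ≫ ψ) := by
  obtain ⟨F, rfl, hF⟩ := hf
  obtain ⟨F', rfl, hF'⟩ := hg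
  exact ⟨F ⨾ F', rfl, ((Cong.beside (.refl _) (Cong.seq_idd _).symm).trans
    (Cong.interchange _ _ _ _).symm).trans (.seq hF hF')⟩

theorem seq_three {e : Word} {h : Diag R G c e} {W : Pres rel} {χ : Z ⟶ W}
    (hf : Represents f w φ) (hg : Represents g w ψ) (hh : Represents h w χ) :
    Represents (f ⨾ g ⨾ h) w (φ ≫ ψ ≫ χ) := by
  rw [← Category.assoc]
  exact (hf.seq hg).seq hh

theorem idd (X : Pres rel) (a : Word) :
    Represents (Diag.idd a : Diag R G a a) X.word (𝟙 (⟨a ++ X.word⟩ : Pres rel)) :=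
  ⟨Diag.idd _, rfl, .idd_beside_idd _ _⟩

theorem padR {u : Word} (hf : Represents f (u ++ w) φ) : Represents (padR f u) w φ := by
  obtain ⟨F, rfl, hF⟩ := hf
  exact ⟨F, rfl, (Cong.beside_assoc _ _ _).trans
    ((Cong.beside (.refl _) (.idd_beside_idd _ _)).trans hF)⟩

theorem padL {o : Ori} (hf : Represents f w φ) :
    Represents (padL [o] f) w ((strand rel o).map φ) := by
  obtain ⟨F, rfl, hF⟩ := hf
  exact ⟨Diag.idd [o] ⊠ F, rfl, (Cong.beside_assoc _ _ _).trans (.beside (.refl _) hF)⟩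

theorem padL_two {o o' : Ori} (hf : Represents f w φ) :
    Represents (Diag.padL [o, o'] f) w ((strand rel o).map ((strand rel o').map φ)) := by
  obtain ⟨F, rfl, hF⟩ := hf
  refine ⟨Diag.idd [o] ⊠ (Diag.idd [o'] ⊠ F), rfl, (Cong.beside_assoc _ _ _).trans
    ((Cong.beside (Cong.idd_beside_idd [o] [o']).symm hF).trans (.beside_assoc _ _ _))⟩

/-- By interchange, a closed diagram drawn beside another may be composed with it vertically. -/
theorem bubble_beside {f : Diag R G [] []} {g : Diag R G a b} {φ : X ⟶ X}
    {ψ : X ⟶ Y} (hf : Represents f (a ++ w) φ) (hg : Represents g w ψ) :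
    Represents (f ⊠ g) w (φ ≫ ψ) := by
  obtain ⟨F, rfl, hF⟩ := hf
  obtain ⟨F', rfl, hF'⟩ := hg
  refine ⟨F ⨾ F', rfl, Cong.trans ?_ (.seq hF hF')⟩
  refine (Cong.beside_assoc _ _ _).trans ?_
  refine Cong.trans (Cong.beside (Cong.seq_idd f).symm (Cong.idd_seq _).symm) ?_
  refine (Cong.interchange _ _ _ _).symm.trans ?_
  exact .seq (.refl _) (.one_beside _)

theorem zero (X : Pres rel) (a b : Word) : Represents (Diag.zero a b : Diag R G a b) X.word
    (0 : (⟨a ++ X.word⟩ : Pres rel) ⟶ ⟨b ++ X.word⟩) := by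
  refine ⟨Diag.zero a b ⊠ Diag.idd _, ?_, .refl _⟩
  exact MonoidalPreadditive.zero_tensor (W := (⟨a⟩ : Pres rel)) (X := ⟨b⟩) (𝟙 X)

theorem add {f g : Diag R G a b} {φ ψ : X ⟶ Y} (hf : Represents f w φ) (hg : Represents g w ψ) :
    Represents (f.add g) w (φ + ψ) := by
  obtain ⟨F, rfl, hF⟩ := hf
  obtain ⟨F', rfl, hF'⟩ := hg
  exact ⟨F.add F', rfl, (Cong.add_beside _ _ _).trans (.add hF hF')⟩

theorem smul (r : R) (hf : Represents f w φ) : Represents (f.smul r) w (r • φ) := by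
  obtain ⟨F, rfl, hF⟩ := hf
  exact ⟨F.smul r, rfl, (Cong.smul_beside _ _ _).trans (.smul _ hF)⟩

theorem neg (hf : Represents f w φ) : Represents (f.smul (-1)) w (-φ) := by
  have h := hf.smul (-1)
  rwa [neg_one_smul] at h

theorem sub {f g : Diag R G a b} {φ ψ : X ⟶ Y} (hf : Represents f w φ) (hg : Represents g w ψ) :
    Represents (f.sub g) w (φ - ψ) := by
  rw [sub_eq_add_neg]
  exact hf.add hg.neg

theorem sum (X : Pres rel) (n : ℕ) {f : Fin n → Diag R G a b}
    {φ : Fin n → ((⟨a ++ X.word⟩ : Pres rel) ⟶ ⟨b ++ X.word⟩)}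
    (h : ∀ i, Represents (f i) X.word (φ i)) :
    Represents (Diag.sum n f) X.word (∑ i, φ i) := by
  induction n with
  | zero => exact zero X a b
  | succ n ih =>
    rw [Fin.sum_univ_castSucc]
    exact (ih fun i => h i.castSucc).add (h (Fin.last n))

/-- The passage from relations to the fields of an action, valid with any strands `w` on the right.
-/
theorem eq_of_cong {f g : Diag R G a b} {φ ψ : X ⟶ Y} (hf : Represents f w φ)
    (hg : Represents g w ψ) (h : Cong rel f g) : φ = ψ := by
  obtain ⟨F, rfl, hF⟩ := hf
  obtain ⟨F', rfl, hF'⟩ := hg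
  exact Pres.mor_eq (hF.symm.trans ((Cong.beside h (.refl _)).trans hF'))

/-- The passage back: with no strands on the right, nothing of the diagram is lost. -/
theorem cong_of_eq {f g : Diag R G a b} {φ ψ : X ⟶ Y} (hf : Represents f [] φ)
    (hg : Represents g [] ψ) (h : φ = ψ) : Cong rel f g := by
  obtain ⟨F, rfl, hF⟩ := hf
  obtain ⟨F', rfl, hF'⟩ := hg
  have h' : Cong rel F F' := Quotient.exact h
  exact (Cong.beside_one f).symm.trans (hF.trans (h'.trans (hF'.symm.trans (.beside_one g))))

end Represents

/-- Diagrams drawn side by side may be moved past each other. -/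
theorem Cong.exchange {a b p q p' q' r r' : Word} (g : Diag R G a b) (f : Diag R G p q)
    {F : Diag R G p' q'} {F' : Diag R G r r'} {g₁ : Diag R G q' r'} {g₂ : Diag R G p' r}
    (h : Cong rel (idd a ⊠ f) F) (h' : Cong rel (idd b ⊠ f) F')
    (h₁ : Cong rel (g ⊠ idd q) g₁) (h₂ : Cong rel (g ⊠ idd p) g₂) :
    Cong rel (F ⨾ g₁) (g₂ ⨾ F') := by
  refine (Cong.seq h.symm h₁.symm).trans (Cong.trans ?_ (Cong.seq h₂ h'))
  refine (Cong.interchange _ _ _ _).trans (Cong.trans ?_ (Cong.interchange _ _ _ _).symm)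
  exact .beside ((Cong.idd_seq _).trans (Cong.seq_idd _).symm)
    ((Cong.seq_idd _).trans (Cong.idd_seq _).symm)

theorem Cong.idd_two_beside (o o' : Ori) {a b : Word} (f : Diag R G a b) :
    Cong rel (idd [o, o'] ⊠ f) (idd [o] ⊠ (idd [o'] ⊠ f)) :=
  (Cong.beside (Cong.idd_beside_idd [o] [o']).symm (.refl f)).trans (.beside_assoc _ _ _)

/-- Naturality is the interchange law. Separate versions for the lengths of the words are needed
because iterated strands agree with `idd` of a word only up to congruence. -/
theorem act_nat_two_two {o₁ o₂ o₃ o₄ : Ori} (g : Diag R G [o₁, o₂] [o₃, o₄]) {X Y : Pres rel}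
    (f : X ⟶ Y) : (strand rel o₁).map ((strand rel o₂).map f) ≫ act rel g Y =
      act rel g X ≫ (strand rel o₃).map ((strand rel o₄).map f) := by
  obtain ⟨f, rfl⟩ := Pres.mor_surjective f
  exact Pres.mor_eq (rel := rel) (Cong.exchange g f (.idd_two_beside _ _ _) (.idd_two_beside _ _
    _) (.refl _) (.refl _))

theorem act_nat_zero_two {o₃ o₄ : Ori} (g : Diag R G [] [o₃, o₄]) {X Y : Pres rel}
    (f : X ⟶ Y) : f ≫ act rel g Y =
      act rel g X ≫ (strand rel o₃).map ((strand rel o₄).map f) := by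
  obtain ⟨f, rfl⟩ := Pres.mor_surjective f
  exact Pres.mor_eq (rel := rel) (Cong.exchange g f (.one_beside _) (.idd_two_beside _ _ _)
    (.refl _) (.refl _))

theorem act_nat_two_zero {o₁ o₂ : Ori} (g : Diag R G [o₁, o₂] []) {X Y : Pres rel}
    (f : X ⟶ Y) : (strand rel o₁).map ((strand rel o₂).map f) ≫ act rel g Y =
      act rel g X ≫ f := by
  obtain ⟨f, rfl⟩ := Pres.mor_surjective f
  exact Pres.mor_eq (rel := rel) (Cong.exchange g f (.idd_two_beside _ _ _) (.one_beside _)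
    (.refl _) (.refl _))

theorem act_nat_one_one {o₁ o₂ : Ori} (g : Diag R G [o₁] [o₂]) {X Y : Pres rel}
    (f : X ⟶ Y) : (strand rel o₁).map f ≫ act rel g Y = act rel g X ≫ (strand rel o₂).map f := by
  obtain ⟨f, rfl⟩ := Pres.mor_surjective f
  exact Pres.mor_eq (rel := rel) (Cong.exchange g f (.refl _) (.refl _) (.refl _) (.refl _))

end Strand

section Actions

variable {R : Type u} [CommRing R] {G : Word → Word → Type} {rel : Relations R G}

/-- The action of crossing, cup and cap by diagrams. -/
def crossingAction (s : Diag R G [up, up] [up, up]) (c : Diag R G [] [dn, up])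
    (d : Diag R G [up, dn] [])
    (hS : ∀ ⦃a b : Word⦄ (f g : Diag R G a b), SymmetricRel s f g → Cong rel f g)
    (hR : ∀ ⦃a b : Word⦄ (f g : Diag R G a b), RightAdjunctionRel c d f g → Cong rel f g) :
    CrossingAction (Pres rel) where
  U := strand rel up
  D := strand rel dn
  additive_U := inferInstance
  additive_D := inferInstance
  s := act rel s
  c := act rel c
  d := act rel d
  s_nat := act_nat_two_two s
  c_nat := act_nat_zero_two c
  d_nat := act_nat_two_zero d
  square X := ((Represents.act s X).seq (.act s X)).eq_of_cong (.idd X [up, up])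
    (hS _ _ .square)
  braid X := by
    have h1 := Represents.padR (u := [up]) (.act (rel := rel) s ⟨up :: X.word⟩)
    have h2 := (Represents.act (rel := rel) s X).padL (o := up)
    exact (h1.seq_three h2 h1).eq_of_cong (h2.seq_three h1 h2) (hS _ _ .braid)
  up_zigzag X := by
    have h1 := Represents.padR (u := [up]) (.act (rel := rel) d ⟨up :: X.word⟩)
    have h2 := (Represents.act (rel := rel) c X).padL (o := up)
    exact (h2.seq h1).eq_of_cong (.idd X [up]) (hR _ _ .up_zigzag)
  dn_zigzag X := by
    have h1 := Represents.padR (u := [dn]) (.act (rel := rel) c ⟨dn :: X.word⟩)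
    have h2 := (Represents.act (rel := rel) d X).padL (o := dn)
    exact (h1.seq h2).eq_of_cong (.idd X [dn]) (hR _ _ .dn_zigzag)

end Actions

end HeisenbergCategory

/-! ### Rotations, dots and bubbles as natural transformations. -/

namespace HeisenbergCategory

open Ori Diag

section Actions

variable {R : Type u} [CommRing R] {G : Word → Word → Type} {rel : Relations R G}

theorem Represents.leftCrossing (s : Diag R G [up, up] [up, up]) (c' : Diag R G [] [up, dn])
    (d' : Diag R G [dn, up] []) (X : Pres rel) :
    Represents (leftCrossing s c' d') X.word
      ((strand rel dn).map ((strand rel up).map (HeisenbergCategory.act rel c' X)) ≫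
        (strand rel dn).map (HeisenbergCategory.act rel s ⟨dn :: X.word⟩) ≫
        HeisenbergCategory.act rel d' ⟨up :: dn :: X.word⟩) :=
  (Represents.act (rel := rel) c' X).padL_two.seq_three
    (Represents.padR (u := [dn]) (.padL (.act (rel := rel) s ⟨dn :: X.word⟩)))
    (Represents.padR (u := [up, dn]) (.act (rel := rel) d' ⟨up :: dn :: X.word⟩))

theorem Represents.leftCurl (s : Diag R G [up, up] [up, up]) (c : Diag R G [] [dn, up])
    (d' : Diag R G [dn, up] []) (X : Pres rel) :
    Represents (leftCurl s c d') X.word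
      (HeisenbergCategory.act rel c ⟨up :: X.word⟩ ≫
        (strand rel dn).map (HeisenbergCategory.act rel s X) ≫
        HeisenbergCategory.act rel d' ⟨up :: X.word⟩) :=
  (Represents.padR (u := [up]) (.act (rel := rel) c ⟨up :: X.word⟩)).seq_three
    (.padL (.act (rel := rel) s X))
    (Represents.padR (u := [up]) (.act (rel := rel) d' ⟨up :: X.word⟩))

theorem Represents.rightCurl (s : Diag R G [up, up] [up, up]) (d : Diag R G [up, dn] [])
    (c' : Diag R G [] [up, dn]) (X : Pres rel) :
    Represents (rightCurl s d c') X.word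
      ((strand rel up).map (HeisenbergCategory.act rel c' X) ≫
        HeisenbergCategory.act rel s ⟨dn :: X.word⟩ ≫
        (strand rel up).map (HeisenbergCategory.act rel d X)) :=
  (Represents.padL (.act (rel := rel) c' X)).seq_three
    (Represents.padR (u := [dn]) (.act (rel := rel) s ⟨dn :: X.word⟩))
    (.padL (.act (rel := rel) d X))

theorem Represents.left_up_zigzag (c' : Diag R G [] [up, dn]) (d' : Diag R G [dn, up] [])
    (X : Pres rel) :
    Represents ((Diag.padR c' [up] : Diag R G [up] [up, dn, up]) ⨾
      (Diag.padL [up] d' : Diag R G [up, dn, up] [up])) X.word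
      (HeisenbergCategory.act rel c' ⟨up :: X.word⟩ ≫
        (strand rel up).map (HeisenbergCategory.act rel d' X)) :=
  (Represents.padR (u := [up]) (.act (rel := rel) c' ⟨up :: X.word⟩)).seq
    (.padL (.act (rel := rel) d' X))

theorem Represents.left_dn_zigzag (c' : Diag R G [] [up, dn]) (d' : Diag R G [dn, up] [])
    (X : Pres rel) :
    Represents ((Diag.padL [dn] c' : Diag R G [dn] [dn, up, dn]) ⨾
      (Diag.padR d' [dn] : Diag R G [dn, up, dn] [dn])) X.word
      ((strand rel dn).map (HeisenbergCategory.act rel c' X) ≫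
        HeisenbergCategory.act rel d' ⟨dn :: X.word⟩) :=
  (Represents.padL (.act (rel := rel) c' X)).seq
    (Represents.padR (u := [dn]) (.act (rel := rel) d' ⟨dn :: X.word⟩))

theorem Represents.rotateDotRight (x : Diag R G [up] [up]) (c : Diag R G [] [dn, up])
    (d : Diag R G [up, dn] []) (X : Pres rel) :
    Represents (rotateDotRight x c d) X.word
      (HeisenbergCategory.act rel c ⟨dn :: X.word⟩ ≫
        (strand rel dn).map (HeisenbergCategory.act rel x ⟨dn :: X.word⟩) ≫
        (strand rel dn).map (HeisenbergCategory.act rel d X)) :=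
  (Represents.padR (u := [dn]) (.act (rel := rel) c ⟨dn :: X.word⟩)).seq_three
    (Represents.padR (u := [dn]) (.padL (.act (rel := rel) x ⟨dn :: X.word⟩)))
    (.padL (.act (rel := rel) d X))

theorem Represents.rotateDotLeft (x : Diag R G [up] [up]) (c' : Diag R G [] [up, dn])
    (d' : Diag R G [dn, up] []) (X : Pres rel) :
    Represents (rotateDotLeft x c' d') X.word
      ((strand rel dn).map (HeisenbergCategory.act rel c' X) ≫
        (strand rel dn).map (HeisenbergCategory.act rel x ⟨dn :: X.word⟩) ≫
        HeisenbergCategory.act rel d' ⟨dn :: X.word⟩) :=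
  (Represents.padL (.act (rel := rel) c' X)).seq_three
    (Represents.padR (u := [dn]) (.padL (.act (rel := rel) x ⟨dn :: X.word⟩)))
    (Represents.padR (u := [dn]) (.act (rel := rel) d' ⟨dn :: X.word⟩))

theorem Represents.rotateCrossingLeft (s : Diag R G [up, up] [up, up])
    (c' : Diag R G [] [up, dn]) (d' : Diag R G [dn, up] []) (X : Pres rel) :
    Represents (rotateCrossingLeft s c' d') X.word
      ((strand rel dn).map ((strand rel dn).map (HeisenbergCategory.act rel c' X ≫
          (strand rel up).map (HeisenbergCategory.act rel c' ⟨dn :: X.word⟩))) ≫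
        (strand rel dn).map ((strand rel dn).map
          (HeisenbergCategory.act rel s ⟨dn :: dn :: X.word⟩)) ≫
        (strand rel dn).map (HeisenbergCategory.act rel d' ⟨up :: dn :: dn :: X.word⟩) ≫
          HeisenbergCategory.act rel d' ⟨dn :: dn :: X.word⟩) := by
  refine Represents.seq_three (.padL_two (.seq (.act (rel := rel) c' X) ?_)) ?_
    (Represents.padR (u := [dn, dn]) (.seq ?_ (.act (rel := rel) d' ⟨dn :: dn :: X.word⟩)))
  · exact Represents.padR (u := [dn]) (.padL (.act (rel := rel) c' ⟨dn :: X.word⟩))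
  · exact Represents.padR (u := [dn, dn]) (.padL_two (.act (rel := rel) s ⟨dn :: dn :: X.word⟩))
  · exact Represents.padR (u := [up])
      (.padL (.act (rel := rel) d' ⟨up :: dn :: dn :: X.word⟩))

variable {s : Diag R G [up, up] [up, up]} {c : Diag R G [] [dn, up]} {d : Diag R G [up, dn] []}
  (hS : ∀ ⦃a b : Word⦄ (f g : Diag R G a b), SymmetricRel s f g → Cong rel f g)
  (hR : ∀ ⦃a b : Word⦄ (f g : Diag R G a b), RightAdjunctionRel c d f g → Cong rel f g)

theorem Represents.rightCrossing (X : Pres rel) :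
    Represents (rightCrossing s c d) X.word ((crossingAction s c d hS hR).t X) :=
  (Represents.padR (u := [up, dn]) (.act (rel := rel) c ⟨up :: dn :: X.word⟩)).seq_three
    (Represents.padR (u := [dn]) (.padL (.act (rel := rel) s ⟨dn :: X.word⟩)))
    (.padL_two (.act (rel := rel) d X))

theorem Represents.rotateCrossingRight (X : Pres rel) :
    Represents (rotateCrossingRight s c d) X.word
      ((crossingAction s c d hS hR).downCrossing X) := by
  have h1 : Represents (nestedRightCup c) (dn :: dn :: X.word)
      (HeisenbergCategory.act rel c ⟨dn :: dn :: X.word⟩ ≫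
        (strand rel dn).map (HeisenbergCategory.act rel c ⟨up :: dn :: dn :: X.word⟩)) :=
    (Represents.act (rel := rel) c ⟨dn :: dn :: X.word⟩).seq
      (Represents.padR (u := [up]) (.padL (.act (rel := rel) c ⟨up :: dn :: dn :: X.word⟩)))
  have h2 : Represents (nestedRightCap d) X.word
      ((strand rel up).map (HeisenbergCategory.act rel d ⟨dn :: X.word⟩) ≫
        HeisenbergCategory.act rel d X) :=
    (Represents.padR (u := [dn]) (.padL (.act (rel := rel) d ⟨dn :: X.word⟩))).seq
      (.act (rel := rel) d X)
  have h := (Represents.padR (u := [dn, dn]) h1).seq_three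
    (Represents.padR (u := [dn, dn]) (.padL_two (.act (rel := rel) s ⟨dn :: dn :: X.word⟩)))
    (.padL_two h2)
  rw [CrossingAction.downCrossing_eq]
  exact h

/-- The action of crossing, cup, cap and dot by diagrams. -/
def dottedAction (x : Diag R G [up] [up])
    (hx : ∀ ⦃a b : Word⦄ (f g : Diag R G a b), DotSlideRel x s f g → Cong rel f g) :
    DottedAction (Pres rel) where
  toCrossingAction := crossingAction s c d hS hR
  x := act rel x
  x_nat := act_nat_one_one x
  slide X := ((Represents.seq (.act s X)
      (Represents.padR (u := [up]) (.act (rel := rel) x ⟨up :: X.word⟩))).sub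
    (Represents.seq (.padL (.act (rel := rel) x X)) (.act s X))).eq_of_cong (.idd X [up, up])
    (hx _ _ .slide)

variable {x : Diag R G [up] [up]}
  (hx : ∀ ⦃a b : Word⦄ (f g : Diag R G a b), DotSlideRel x s f g → Cong rel f g)

theorem Represents.pow (X : Pres rel) (r : ℕ) :
    Represents (x.pow r) X.word ((dottedAction hS hR x hx).xpow X r) := by
  induction r with
  | zero => exact .idd X [up]
  | succ r ih => exact ih.seq (.act x X)

theorem Represents.dottedCup (X : Pres rel) (r : ℕ) :
    Represents (dottedCup x c r) X.word ((dottedAction hS hR x hx).cup r X) :=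
  (Represents.act c X).seq (Represents.pow hS hR hx X r).padL

/-- The action of crossing, cups, caps and dot by diagrams. -/
def capAction (d' : Diag R G [dn, up] []) : CapAction (Pres rel) where
  toDottedAction := dottedAction hS hR x hx
  d' := act rel d'
  d'_nat := act_nat_two_zero d'

variable (d' : Diag R G [dn, up] [])

theorem Represents.dottedCap (X : Pres rel) (r : ℕ) :
    Represents (dottedCap x d' r) X.word ((capAction hS hR hx d').cap r X) :=
  (Represents.pow hS hR hx X r).padL.seq (.act d' X)

theorem Represents.bubble (X : Pres rel) (r : ℕ) :
    Represents (bubble x c d' r) X.word ((capAction hS hR hx d').b r X) :=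
  (Represents.dottedCup hS hR hx X r).seq (.act d' X)

theorem Represents.coeff (m : ℕ) (X : Pres rel) (n : ℕ) :
    Represents (coeff m (Diag.bubble x c d') n) X.word
      ((capAction hS hR hx d').coeff m X n) := by
  induction n using Nat.strong_induction_on with
  | _ n ih =>
    cases n with
    | zero =>
      rw [Diag.coeff, CapAction.coeff]
      exact .idd X []
    | succ n =>
      rw [Diag.coeff, CapAction.coeff]
      exact (Represents.sum X (n + 1) fun i =>
        (Represents.bubble hS hR hx d' X _).seq (ih i.val i.isLt)).neg

end Actions

end HeisenbergCategory

namespace HeisenbergCategory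

open Ori Diag

/-! ### Relations in the Heisenberg category -/

namespace Heis

variable (R : Type u) [CommRing R] {m : ℕ} (hm : m ≠ 0) (δ : R)

theorem cong_of_symmetricRel ⦃a b : Word⦄ (f g : Diag R (HeisGen m) a b)
    (h : SymmetricRel (s R m) f g) : Cong (HeisSpecRel R hm δ) f g :=
  .of (.heis (.symmetric h))

theorem cong_of_rightAdjunctionRel ⦃a b : Word⦄ (f g : Diag R (HeisGen m) a b)
    (h : RightAdjunctionRel (c R m) (d R m) f g) : Cong (HeisSpecRel R hm δ) f g :=
  .of (.heis (.rightAdjunction h))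

theorem cong_of_dotSlideRel ⦃a b : Word⦄ (f g : Diag R (HeisGen m) a b)
    (h : DotSlideRel (x R m) (s R m) f g) : Cong (HeisSpecRel R hm δ) f g :=
  .of (.heis (.dotSlide h))

/-- The action of the dot, crossing, cups and caps of the Heisenberg category on itself. -/
def capAction : CapAction (Pres (HeisSpecRel R hm δ)) :=
  HeisenbergCategory.capAction (cong_of_symmetricRel R hm δ) (cong_of_rightAdjunctionRel R hm δ)
    (cong_of_dotSlideRel R hm δ) (d' R hm)

theorem represents_t (X : Pres (HeisSpecRel R hm δ)) :
    Represents (t R m) X.word ((capAction R hm δ).t X) :=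
  Represents.rightCrossing (cong_of_symmetricRel R hm δ) (cong_of_rightAdjunctionRel R hm δ) X

theorem represents_cup (r : ℕ) (X : Pres (HeisSpecRel R hm δ)) :
    Represents (dottedCup (x R m) (c R m) r) X.word ((capAction R hm δ).cup r X) :=
  Represents.dottedCup (cong_of_symmetricRel R hm δ) (cong_of_rightAdjunctionRel R hm δ)
    (cong_of_dotSlideRel R hm δ) X r

theorem represents_cap (r : ℕ) (X : Pres (HeisSpecRel R hm δ)) :
    Represents (dottedCap (x R m) (d' R hm) r) X.word ((capAction R hm δ).cap r X) :=
  Represents.dottedCap (cong_of_symmetricRel R hm δ) (cong_of_rightAdjunctionRel R hm δ)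
    (cong_of_dotSlideRel R hm δ) (d' R hm) X r

theorem represents_coeff (n : ℕ) (X : Pres (HeisSpecRel R hm δ)) :
    Represents (coeff m (bubble (x R m) (c R m) (d' R hm)) n) X.word
      ((capAction R hm δ).coeff m X n) :=
  Represents.coeff (cong_of_symmetricRel R hm δ) (cong_of_rightAdjunctionRel R hm δ)
    (cong_of_dotSlideRel R hm δ) (d' R hm) m X n

/-- The action of the entries of the inverse matrix. -/
def entry (r : ℕ) (X : Pres (HeisSpecRel R hm δ)) :
    (capAction R hm δ).D.obj ((capAction R hm δ).U.obj X) ⟶ X :=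
  if h : r < m then act _ (capDec R m ⟨r, h⟩) X else 0

theorem represents_entry {r : ℕ} (hr : r < m) (X : Pres (HeisSpecRel R hm δ)) :
    Represents (capDec R m ⟨r, hr⟩) X.word (entry R hm δ r X) := by
  have h : entry R hm δ r X = act _ (capDec R m ⟨r, hr⟩) X := dif_pos hr
  rw [h]
  exact .act _ X

/-- The action of the Heisenberg category on itself. -/
def action : HeisAction (Pres (HeisSpecRel R hm δ)) m where
  toCapAction := capAction R hm δ
  t' := act _ (t' R m)
  e := entry R hm δ
  t'_nat := act_nat_two_two (t' R m)
  ne_zero := hm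
  e_last X := dif_pos _
  inv_right X := by
    rw [Finset.sum_range]
    exact Represents.eq_of_cong (((Represents.act (t' R m) X).seq (represents_t R hm δ X)).add
      (Represents.sum X m fun i => (represents_entry R hm δ i.isLt X).seq
        (represents_cup R hm δ i.val X))) (.idd X [dn, up]) (.of (.heis .inv_right))
  t_t' X := Represents.eq_of_cong ((represents_t R hm δ X).seq (.act _ X)) (.idd X [up, dn])
    (.of (.heis .inv_left_crossing))
  t_e r X hr := ((represents_t R hm δ X).seq (represents_entry R hm δ hr X)).eq_of_cong
    (.zero X [up, dn] []) (.of (.heis (.inv_left_crossing_cap ⟨r, hr⟩)))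
  cup_t' r X hr := Represents.eq_of_cong ((represents_cup R hm δ r X).seq (.act _ X))
    (.zero X [] [up, dn]) (.of (.heis (.inv_left_cup_crossing ⟨r, hr⟩)))
  cup_e_self r X hr := ((represents_cup R hm δ r X).seq (represents_entry R hm δ hr X)).eq_of_cong
    (.idd X []) (.of (.heis (.inv_left_cup_cap_self ⟨r, hr⟩)))
  cup_e_of_ne r q X hr hq h := ((represents_cup R hm δ r X).seq
    (represents_entry R hm δ hq X)).eq_of_cong (.zero X [] [])
    (.of (.heis (.inv_left_cup_cap_of_ne ⟨r, hr⟩ ⟨q, hq⟩ (by simpa using h))))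

theorem act_c' (X : Pres (HeisSpecRel R hm δ)) : act _ (c' R m) X = (action R hm δ).c' X :=
  (Represents.act (c' R m) X).eq_of_cong ((represents_cup R hm δ m X).seq (.act _ X)) (.refl _)

theorem represents_leftCrossing (X : Pres (HeisSpecRel R hm δ)) :
    Represents (leftCrossing (s R m) (c' R m) (d' R hm)) X.word ((action R hm δ).t' X) := by
  rw [← (action R hm δ).leftCrossing_eq, ← act_c']
  exact .leftCrossing _ _ _ X

/-- Evaluating the identity of transformations at the empty word turns it into a relation between
diagrams; the relations below are obtained in the same way. -/
theorem cong_leftCrossing : Cong (HeisSpecRel R hm δ)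
    (leftCrossing (s R m) (c' R m) (d' R hm)) (t' R m) :=
  (represents_leftCrossing R hm δ ⟨[]⟩).cong_of_eq (.act _ ⟨[]⟩) rfl

theorem cong_of_leftAdjunctionRel ⦃a b : Word⦄ (f g : Diag R (HeisGen m) a b)
    (h : LeftAdjunctionRel (c' R m) (d' R hm) f g) : Cong (HeisSpecRel R hm δ) f g := by
  cases h with
  | up_zigzag =>
    refine (Represents.left_up_zigzag _ _ ⟨[]⟩).cong_of_eq (.idd ⟨[]⟩ [up]) ?_
    rw [act_c']
    exact (action R hm δ).left_up_zigzag ⟨[]⟩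
  | dn_zigzag =>
    refine (Represents.left_dn_zigzag _ _ ⟨[]⟩).cong_of_eq (.idd ⟨[]⟩ [dn]) ?_
    rw [act_c']
    exact (action R hm δ).left_dn_zigzag ⟨[]⟩

theorem cong_cyclic_dot : Cong (HeisSpecRel R hm δ)
    (rotateDotRight (x R m) (c R m) (d R m)) (rotateDotLeft (x R m) (c' R m) (d' R hm)) := by
  refine (Represents.rotateDotRight _ _ _ ⟨[]⟩).cong_of_eq (.rotateDotLeft _ _ _ ⟨[]⟩) ?_
  rw [act_c']
  exact ((action R hm δ).cyclic_dot ⟨[]⟩).symm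

theorem cong_cyclic_crossing : Cong (HeisSpecRel R hm δ)
    (rotateCrossingRight (s R m) (c R m) (d R m))
    (rotateCrossingLeft (s R m) (c' R m) (d' R hm)) := by
  refine (Represents.rotateCrossingRight (cong_of_symmetricRel R hm δ)
    (cong_of_rightAdjunctionRel R hm δ) ⟨[]⟩).cong_of_eq (.rotateCrossingLeft _ _ _ ⟨[]⟩) ?_
  rw [act_c', act_c']
  exact ((action R hm δ).cyclic_crossing ⟨[]⟩).symm

theorem cong_leftCurl : Cong (HeisSpecRel R hm δ)
    (leftCurl (s R m) (c R m) (d' R hm)) (Diag.zero [up] [up]) :=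
  (Represents.leftCurl _ _ _ ⟨[]⟩).cong_of_eq (.zero ⟨[]⟩ [up] [up])
    ((action R hm δ).leftCurl ⟨[]⟩)

/-- As `d'` is the last entry of the inverse matrix, these bubbles are entries of the inversion
relation. -/
theorem cong_bubble_of_lt (r : ℕ) (hr : r + 1 < m) : Cong (HeisSpecRel R hm δ)
    (bubble (x R m) (c R m) (d' R hm) r) (Diag.zero [] []) :=
  .of (.heis (.inv_left_cup_cap_of_ne ⟨r, by omega⟩ ⟨m - 1, by omega⟩ (by simp; omega)))

theorem cong_bubble_self (r : ℕ) (hr : r + 1 = m) : Cong (HeisSpecRel R hm δ)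
    (bubble (x R m) (c R m) (d' R hm) r) (idd []) := by
  obtain rfl : r = m - 1 := by omega
  exact .of (.heis (.inv_left_cup_cap_self ⟨m - 1, by omega⟩))

theorem cong_right_left_crossing : Cong (HeisSpecRel R hm δ)
    (t R m ⨾ leftCrossing (s R m) (c' R m) (d' R hm)) (idd [up, dn]) :=
  (Cong.seq (.refl _) (cong_leftCrossing R hm δ)).trans (.of (.heis .inv_left_crossing))

/-- The entries of the inverse matrix are combinations of dotted caps. -/
theorem cong_capDec (r : Fin m) : Cong (HeisSpecRel R hm δ)
    (Diag.sum (m - r.val) (fun q => dottedCap (x R m) (d' R hm) q.val ⨾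
      coeff m (bubble (x R m) (c R m) (d' R hm)) (m - 1 - r.val - q.val))) (capDec R m r) := by
  refine (Represents.sum ⟨[]⟩ _ fun q => (represents_cap R hm δ q.val ⟨[]⟩).seq
    (represents_coeff R hm δ _ ⟨[]⟩)).cong_of_eq (represents_entry R hm δ r.isLt ⟨[]⟩) ?_
  have h := (action R hm δ).e_eq_sum (m - 1 - r.val) (by omega) ⟨[]⟩
  rw [show m - 1 - (m - 1 - r.val) = r.val by omega,
    show m - 1 - r.val + 1 = m - r.val by omega, Finset.sum_range] at h
  exact h.symm

theorem cong_left_right_crossing : Cong (HeisSpecRel R hm δ)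
    (leftCrossing (s R m) (c' R m) (d' R hm) ⨾ t R m)
    (sub (idd [dn, up]) (Diag.sum m (fun r => Diag.sum (m - r.val) (fun q =>
        coeff m (bubble (x R m) (c R m) (d' R hm)) (m - 1 - r.val - q.val) ⊠
          (dottedCap (x R m) (d' R hm) r.val ⨾ dottedCup (x R m) (c R m) q.val))))) := by
  refine ((represents_leftCrossing R hm δ ⟨[]⟩).seq (represents_t R hm δ ⟨[]⟩)).cong_of_eq
    ((Represents.idd ⟨[]⟩ [dn, up]).sub (.sum ⟨[]⟩ _ fun r => .sum ⟨[]⟩ _ fun q =>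
      .bubble_beside (represents_coeff R hm δ _ ⟨[dn, up]⟩)
        ((represents_cap R hm δ r.val ⟨[]⟩).seq (represents_cup R hm δ q.val ⟨[]⟩)))) ?_
  exact (action R hm δ).t'_t_eq ⟨[]⟩

end Heis

end HeisenbergCategory

namespace HeisenbergCategory

open Ori Diag

/-! ### The Mackaay–Savage category -/

namespace MS

variable (R : Type u) [CommRing R] {m : ℕ} (hm : m ≠ 0) (δ : R)

theorem cong_of_symmetricRel (m : ℕ) ⦃a b : Word⦄ (f g : Diag R MSGen a b)
    (h : SymmetricRel (s R) f g) : Cong (MSRel R m δ) f g :=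
  .of (.symmetric h)

theorem cong_of_rightAdjunctionRel (m : ℕ) ⦃a b : Word⦄ (f g : Diag R MSGen a b)
    (h : RightAdjunctionRel (c R) (d R) f g) : Cong (MSRel R m δ) f g :=
  .of (.rightAdjunction h)

theorem cong_of_dotSlideRel (m : ℕ) ⦃a b : Word⦄ (f g : Diag R MSGen a b)
    (h : DotSlideRel (x R) (s R) f g) : Cong (MSRel R m δ) f g :=
  .of (.dotSlide h)

/-- The action of the dot, crossing, cups and caps of the Mackaay–Savage category on itself. -/
def capAction (m : ℕ) : CapAction (Pres (MSRel R m δ)) :=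
  HeisenbergCategory.capAction (cong_of_symmetricRel R δ m) (cong_of_rightAdjunctionRel R δ m)
    (cong_of_dotSlideRel R δ m) (d' R)

theorem represents_t (X : Pres (MSRel R m δ)) :
    Represents (t R) X.word ((capAction R δ m).t X) :=
  Represents.rightCrossing (cong_of_symmetricRel R δ m) (cong_of_rightAdjunctionRel R δ m) X

theorem represents_cup (r : ℕ) (X : Pres (MSRel R m δ)) :
    Represents (dottedCup (x R) (c R) r) X.word ((capAction R δ m).cup r X) :=
  Represents.dottedCup (cong_of_symmetricRel R δ m) (cong_of_rightAdjunctionRel R δ m)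
    (cong_of_dotSlideRel R δ m) X r

theorem represents_cap (r : ℕ) (X : Pres (MSRel R m δ)) :
    Represents (dottedCap (x R) (d' R) r) X.word ((capAction R δ m).cap r X) :=
  Represents.dottedCap (cong_of_symmetricRel R δ m) (cong_of_rightAdjunctionRel R δ m)
    (cong_of_dotSlideRel R δ m) (d' R) X r

theorem represents_b (r : ℕ) (X : Pres (MSRel R m δ)) :
    Represents (b R r) X.word ((capAction R δ m).b r X) :=
  Represents.bubble (cong_of_symmetricRel R δ m) (cong_of_rightAdjunctionRel R δ m)
    (cong_of_dotSlideRel R δ m) (d' R) X r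

theorem represents_coeff (n : ℕ) (X : Pres (MSRel R m δ)) :
    Represents (coeff m (b R) n) X.word ((capAction R δ m).coeff m X n) :=
  Represents.coeff (cong_of_symmetricRel R δ m) (cong_of_rightAdjunctionRel R δ m)
    (cong_of_dotSlideRel R δ m) (d' R) m X n

/-- The action of the Mackaay–Savage category on itself. -/
def action : MSAction (Pres (MSRel R m δ)) m where
  toCapAction := capAction R δ m
  c' := act _ (c' R)
  ne_zero := hm
  t_leftCrossing X := ((represents_t R δ X).seq (.leftCrossing _ _ _ X)).eq_of_cong
    (.idd X [up, dn]) (.of .right_left_crossing)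
  leftCrossing_t X := by
    have h := ((Represents.leftCrossing (rel := MSRel R m δ) (s R) (c' R) (d' R) X).seq
      (represents_t R δ X)).eq_of_cong
      ((Represents.idd X [dn, up]).sub (.sum X _ fun r => .sum X _ fun q =>
        .bubble_beside (represents_coeff R δ _ ⟨dn :: up :: X.word⟩)
        ((represents_cap R δ r.val X).seq (represents_cup R δ q.val X))))
      (.of .left_right_crossing)
    simp only [Finset.sum_range]
    exact h
  leftCurl X := (Represents.leftCurl _ _ _ X).eq_of_cong (.zero X [up] [up]) (.of .leftCurl)
  b_of_lt r X hr := (represents_b R δ r X).eq_of_cong (.zero X [] []) (.of (.bubble_zero r hr))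
  b_pred X := (represents_b R δ (m - 1) X).eq_of_cong (.idd X [])
    (.of (.bubble_one (m - 1) (Nat.sub_add_cancel (Nat.pos_of_ne_zero hm))))

theorem represents_t' (X : Pres (MSRel R m δ)) :
    Represents (t' R) X.word ((action R hm δ).t' X) :=
  .leftCrossing _ _ _ X

/-- The combination of dotted caps dual to the cup with `r` dots. -/
def capDec (m r : ℕ) : Diag R MSGen [dn, up] [] :=
  Diag.sum (m - r) (fun q => dottedCap (x R) (d' R) q.val ⨾ coeff m (b R) (m - 1 - r - q.val))

theorem represents_capDec (r : ℕ) (X : Pres (MSRel R m δ)) :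
    Represents (capDec R m r) X.word ((action R hm δ).e r X) := by
  rw [MSAction.e, Finset.sum_range]
  exact Represents.sum X _ fun q => (represents_cap R δ q.val X).seq (represents_coeff R δ _ X)

/-- Images of the generators of the Heisenberg category. -/
def ofHeis (m : ℕ) : ∀ ⦃a b : Word⦄, HeisGen m a b → Diag R MSGen a b
  | _, _, .x => x R
  | _, _, .s => s R
  | _, _, .c => c R
  | _, _, .d => d R
  | _, _, .leftCross => t' R
  | _, _, .capDec r => capDec R m r.val

/-- Images of the generators of the Mackaay–Savage category. -/
def toHeis : ∀ ⦃a b : Word⦄, MSGen a b → Diag R (HeisGen m) a b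
  | _, _, .x => Heis.x R m
  | _, _, .s => Heis.s R m
  | _, _, .c => Heis.c R m
  | _, _, .d => Heis.d R m
  | _, _, .leftCup => Heis.c' R m
  | _, _, .leftCap => Heis.d' R hm

theorem represents_subst_cup (r : ℕ) (X : Pres (MSRel R m δ)) :
    Represents ((dottedCup (Heis.x R m) (Heis.c R m) r).subst (ofHeis R m)) X.word
      ((capAction R δ m).cup r X) := by
  rw [subst_dottedCup]
  exact represents_cup R δ r X

theorem cong_heisRel (hm : m ≠ 0) ⦃a b : Word⦄ (f g : Diag R (HeisGen m) a b) (h : HeisRel R m f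
  g) :
    Cong (MSRel R m δ) (f.subst (ofHeis R m)) (g.subst (ofHeis R m)) := by
  cases h with
  | symmetric h =>
    cases h with
    | square => exact .of (.symmetric .square)
    | braid => exact .of (.symmetric .braid)
  | dotSlide h =>
    cases h with
    | slide => exact .of (.dotSlide .slide)
  | rightAdjunction h =>
    cases h with
    | up_zigzag => exact .of (.rightAdjunction .up_zigzag)
    | dn_zigzag => exact .of (.rightAdjunction .dn_zigzag)
  | inv_right =>
    have h := (action R hm δ).inv_right ⟨[]⟩
    rw [Finset.sum_range] at h
    refine Represents.cong_of_eq (((represents_t' R hm δ ⟨[]⟩).seq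
      (represents_t R δ ⟨[]⟩)).add ?_) (.idd ⟨[]⟩ [dn, up]) h
    rw [subst_sum]
    exact Represents.sum ⟨[]⟩ m fun r => (represents_capDec R hm δ r.val ⟨[]⟩).seq
      (represents_subst_cup R δ r.val ⟨[]⟩)
  | inv_left_crossing => exact .of .right_left_crossing
  | inv_left_crossing_cap r =>
    exact ((represents_t R δ ⟨[]⟩).seq (represents_capDec R hm δ r.val ⟨[]⟩)).cong_of_eq
      (.zero ⟨[]⟩ [up, dn] []) ((action R hm δ).t_e _ _ r.isLt)
  | inv_left_cup_crossing r =>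
    exact ((represents_subst_cup R δ r.val ⟨[]⟩).seq (represents_t' R hm δ ⟨[]⟩)).cong_of_eq
      (.zero ⟨[]⟩ [] [up, dn]) ((action R hm δ).cup_t' _ _ r.isLt)
  | inv_left_cup_cap_self r =>
    exact ((represents_subst_cup R δ r.val ⟨[]⟩).seq
      (represents_capDec R hm δ r.val ⟨[]⟩)).cong_of_eq (.idd ⟨[]⟩ [])
      ((action R hm δ).cup_e_self _ _ r.isLt)
  | inv_left_cup_cap_of_ne r q hrq =>
    exact ((represents_subst_cup R δ r.val ⟨[]⟩).seq
      (represents_capDec R hm δ q.val ⟨[]⟩)).cong_of_eq (.zero ⟨[]⟩ [] [])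
      ((action R hm δ).cup_e_of_ne _ _ _ r.isLt q.isLt (Fin.val_ne_of_ne hrq))

theorem cong_capDec_last (hm : m ≠ 0) : Cong (MSRel R m δ) (capDec R m (m - 1)) (d' R) :=
  (represents_capDec R hm δ _ ⟨[]⟩).cong_of_eq (.act _ ⟨[]⟩) ((action R hm δ).e_last _)

theorem cong_leftCup (hm : m ≠ 0) :
    Cong (MSRel R m δ) (dottedCup (x R) (c R) m ⨾ t' R) (c' R) :=
  ((represents_cup R δ m ⟨[]⟩).seq (represents_t' R hm δ ⟨[]⟩)).cong_of_eq (.act _ ⟨[]⟩)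
    ((action R hm δ).cup_t'_self _)

theorem cong_heisSpecRel ⦃a b : Word⦄ (f g : Diag R (HeisGen m) a b)
    (h : HeisSpecRel R hm δ f g) :
    Cong (MSRel R m δ) (f.subst (ofHeis R m)) (g.subst (ofHeis R m)) := by
  cases h with
  | heis h => exact cong_heisRel R δ hm _ _ h
  | bubble =>
    rw [subst_bubble]
    -- After substitution the bubble is closed by `capDec R m (m - 1)`, which equals `d'` only
    -- modulo the relations.
    exact Cong.trans (.seq (.refl _) (cong_capDec_last R δ hm)) (.of .bubble_scalar)

theorem cong_msRel ⦃a b : Word⦄ (f g : Diag R MSGen a b) (h : MSRel R m δ f g) :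
    Cong (HeisSpecRel R hm δ) (f.subst (toHeis R hm)) (g.subst (toHeis R hm)) := by
  have hb : ∀ r, (MS.b R r).subst (toHeis R hm) =
      bubble (Heis.x R m) (Heis.c R m) (Heis.d' R hm) r := subst_bubble _ _ _ _
  cases h with
  | rightAdjunction h =>
    cases h with
    | up_zigzag => exact .of (.heis (.rightAdjunction .up_zigzag))
    | dn_zigzag => exact .of (.heis (.rightAdjunction .dn_zigzag))
  | leftAdjunction h =>
    cases h with
    | up_zigzag => exact Heis.cong_of_leftAdjunctionRel R hm δ _ _ .up_zigzag
    | dn_zigzag => exact Heis.cong_of_leftAdjunctionRel R hm δ _ _ .dn_zigzag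
  | cyclic_dot => exact Heis.cong_cyclic_dot R hm δ
  | cyclic_crossing => exact Heis.cong_cyclic_crossing R hm δ
  | symmetric h =>
    cases h with
    | square => exact .of (.heis (.symmetric .square))
    | braid => exact .of (.heis (.symmetric .braid))
  | dotSlide h =>
    cases h with
    | slide => exact .of (.heis (.dotSlide .slide))
  | right_left_crossing => exact Heis.cong_right_left_crossing R hm δ
  | left_right_crossing =>
    refine (Heis.cong_left_right_crossing R hm δ).trans (.of_eq ?_)
    simp only [Diag.sub, subst, subst_sum, subst_coeff, subst_dottedCap, subst_dottedCup, hb]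
    rfl
  | leftCurl => exact Heis.cong_leftCurl R hm δ
  | bubble_zero r hr => exact (Cong.of_eq (hb r)).trans (Heis.cong_bubble_of_lt R hm δ r hr)
  | bubble_one r hr => exact (Cong.of_eq (hb r)).trans (Heis.cong_bubble_self R hm δ r hr)
  | bubble_scalar => exact (Cong.of_eq (hb m)).trans (.of .bubble)

/-- The Heisenberg category and the Mackaay–Savage category are given by equivalent
presentations. -/
def presEquiv : PresEquiv (HeisSpecRel R hm δ) (MSRel R m δ) where
  toFun := ofHeis R m
  invFun := toHeis R hm
  toFun_rel := cong_heisSpecRel R hm δ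
  invFun_rel := cong_msRel R hm δ
  left_inv a b g := by
    cases g with
    | x => exact .refl _
    | s => exact .refl _
    | c => exact .refl _
    | d => exact .refl _
    | leftCross => exact Heis.cong_leftCrossing R hm δ
    | capDec r =>
      refine Cong.trans (.of_eq ?_) (Heis.cong_capDec R hm δ r)
      change (capDec R m r.val).subst (toHeis R hm) = _
      rw [capDec, subst_sum]
      congr 1
      funext q
      rw [subst, subst_coeff, subst_dottedCap]
      congr 2
      funext r
      exact subst_bubble _ _ _ _ _
  right_inv a b g := by
    cases g with
    | x => exact .refl _
    | s => exact .refl _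
    | c => exact .refl _
    | d => exact .refl _
    | leftCup =>
      refine Cong.trans (.seq (.of_eq ?_) (.refl _)) (cong_leftCup R δ hm)
      exact subst_dottedCup _ _ _ _
    | leftCap => exact cong_capDec_last R δ hm

end MS

end HeisenbergCategory

/-! ### Level one: the dot as a right curl. -/

namespace HeisenbergCategory

open Ori Diag

theorem Diag.subst_gen {R : Type u} {G : Word → Word → Type} {a b : Word} (f : Diag R G a b) :
    f.subst (fun _ _ g => gen g) = f := by
  induction f <;> simp_all [subst]

section Dots

variable {R : Type u} [CommRing R] {G G' : Word → Word → Type} {rel rel' : Relations R G}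

theorem cong_dottedCup_zero (x : Diag R G [up] [up]) (c : Diag R G [] [dn, up]) :
    Cong rel (dottedCup x c 0) c :=
  (Cong.seq (.refl c) (Cong.idd_beside_idd [dn] [up])).trans (.seq_idd c)

/-- Substituting every generator for itself makes this an instance of `Cong.subst`. -/
theorem Cong.mono (h : ∀ ⦃a b : Word⦄ (f g : Diag R G a b), rel f g → Cong rel' f g)
    {a b a' b' : Word} {f : Diag R G a b} {g : Diag R G a' b'} (hfg : Cong rel f g) :
    Cong rel' f g := by
  have key := hfg.subst (rel' := rel') (φ := fun _ _ g => Diag.gen g) fun a b f g hfg => by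
    simpa only [Diag.subst_gen] using h f g hfg
  simpa only [Diag.subst_gen] using key

end Dots

namespace HeisAction

variable {C : Type u} [Category.{v} C] [Preadditive C] (A : HeisAction C 1)

theorem t'_t_one (X : C) : A.t' X ≫ A.t X = 𝟙 _ - A.d' X ≫ A.c X := by
  have h := A.inv_right X
  have h0 : A.e 0 X = A.d' X := A.e_last X
  rw [Finset.sum_range_one, h0, A.cup_zero] at h
  rw [eq_sub_iff_add_eq, h]

end HeisAction

namespace Heis

variable (R : Type u) [CommRing R]

theorem cong_left_right_crossing_one : Cong (HeisSpecRel R one_ne_zero (0 : R))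
    (leftCrossing (s R 1) (c' R 1) (d' R one_ne_zero) ⨾ t R 1)
    (sub (idd [dn, up]) (d' R one_ne_zero ⨾ c R 1)) :=
  ((represents_leftCrossing R one_ne_zero 0 ⟨[]⟩).seq
    (represents_t R one_ne_zero 0 ⟨[]⟩)).cong_of_eq
    ((Represents.idd ⟨[]⟩ [dn, up]).sub ((Represents.act _ ⟨[]⟩).seq (.act _ ⟨[]⟩)))
    ((action R one_ne_zero 0).t'_t_one ⟨[]⟩)

/-- With δ = 0 the bubble with one dot vanishes, and `rightCurl_eq` expresses the dot through the
other generators. -/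
theorem cong_rightCurl : Cong (HeisSpecRel R one_ne_zero (0 : R))
    (rightCurl (s R 1) (d R 1) (c' R 1)) (x R 1) := by
  refine (Represents.rightCurl _ _ _ ⟨[]⟩).cong_of_eq (.act _ ⟨[]⟩) ?_
  rw [act_c']
  refine (action R one_ne_zero 0).rightCurl_eq rfl (fun X => ?_) ⟨[]⟩
  have h := (Represents.bubble (cong_of_symmetricRel R one_ne_zero 0)
    (cong_of_rightAdjunctionRel R one_ne_zero 0) (cong_of_dotSlideRel R one_ne_zero 0)
    (d' R one_ne_zero) X 1).eq_of_cong ((Represents.idd X []).smul 0) (.of .bubble)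
  rw [zero_smul] at h
  exact h

end Heis

/-! ### Khovanov's category -/

namespace Khovanov

variable (R : Type u) [CommRing R]

theorem cong_of_symmetricRel ⦃a b : Word⦄ (f g : Diag R KhovanovGen a b)
    (h : SymmetricRel (s R) f g) : Cong (KhovanovLocalRel R) f g :=
  .of (.symmetric h)

theorem cong_of_rightAdjunctionRel ⦃a b : Word⦄ (f g : Diag R KhovanovGen a b)
    (h : RightAdjunctionRel (c R) (d R) f g) : Cong (KhovanovLocalRel R) f g :=
  .of (.rightAdjunction h)

theorem represents_t (X : Pres (KhovanovLocalRel R)) :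
    Represents (t R) X.word ((crossingAction (s R) (c R) (d R) (cong_of_symmetricRel R)
      (cong_of_rightAdjunctionRel R)).t X) :=
  .rightCrossing _ _ X

/-- The action on itself of Khovanov's category without cyclicity of the crossing. -/
def action : KhovanovAction (Pres (KhovanovLocalRel R)) where
  toCrossingAction := crossingAction (s R) (c R) (d R) (cong_of_symmetricRel R)
    (cong_of_rightAdjunctionRel R)
  c' := act _ (c' R)
  d' := act _ (d' R)
  c'_nat := act_nat_zero_two _
  left_up_zigzag X := (Represents.left_up_zigzag _ _ X).eq_of_cong (.idd X [up])
    (.of (.leftAdjunction .up_zigzag))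
  t_leftCrossing X := ((represents_t R X).seq (.leftCrossing _ _ _ X)).eq_of_cong
    (.idd X [up, dn]) (.of .right_left_crossing)
  leftCrossing_t X := (Represents.seq (.leftCrossing _ _ _ X) (represents_t R X)).eq_of_cong
    ((Represents.idd X [dn, up]).sub (.seq (.act _ X) (.act _ X))) (.of .left_right_crossing)
  bubble X := (Represents.seq (.act _ X) (.act _ X)).eq_of_cong (.idd X []) (.of .bubble)

/-- The right curl, which plays the role of the dot. -/
def x : Diag R KhovanovGen [up] [up] := rightCurl (s R) (d R) (c' R)

theorem represents_x (X : Pres (KhovanovLocalRel R)) :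
    Represents (x R) X.word ((action R).x X) :=
  .rightCurl _ _ _ X

theorem represents_t' (X : Pres (KhovanovLocalRel R)) :
    Represents (t' R) X.word ((action R).t' X) :=
  .leftCrossing _ _ _ X

theorem represents_cup_one (X : Pres (KhovanovLocalRel R)) :
    Represents (dottedCup (x R) (c R) 1) X.word
      ((action R).c X ≫ (action R).D.map ((action R).x X)) := by
  have h := (Represents.act (c R) X).seq
    (((Represents.idd X [up]).seq (represents_x R X)).padL (o := dn))
  have e : 𝟙 ((action R).U.obj X) ≫ (action R).x X = (action R).x X := Category.id_comp _
  exact (congrArg (fun φ => Represents (dottedCup (x R) (c R) 1) X.word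
    ((action R).c X ≫ (action R).D.map φ)) e).mp h

/-- Images of the generators of the Heisenberg category. -/
def ofHeis : ∀ ⦃a b : Word⦄, HeisGen 1 a b → Diag R KhovanovGen a b
  | _, _, .x => x R
  | _, _, .s => s R
  | _, _, .c => c R
  | _, _, .d => d R
  | _, _, .leftCross => t' R
  | _, _, .capDec _ => d' R

/-- Images of the generators of Khovanov's category. -/
def toHeis : ∀ ⦃a b : Word⦄, KhovanovGen a b → Diag R (HeisGen 1) a b
  | _, _, .s => Heis.s R 1
  | _, _, .c => Heis.c R 1
  | _, _, .d => Heis.d R 1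
  | _, _, .leftCup => Heis.c' R 1
  | _, _, .leftCap => Heis.d' R one_ne_zero

theorem cong_subst_cup (r : Fin 1) : Cong (KhovanovLocalRel R)
    ((dottedCup (Heis.x R 1) (Heis.c R 1) r.val).subst (ofHeis R)) (c R) := by
  rw [Fin.val_eq_zero, subst_dottedCup]
  exact cong_dottedCup_zero _ _

/-- The target is the category without (C_s), as the redundancy of cyclicity requires. -/
theorem cong_heisRel ⦃a b : Word⦄ (f g : Diag R (HeisGen 1) a b) (h : HeisRel R 1 f g) :
    Cong (KhovanovLocalRel R) (f.subst (ofHeis R)) (g.subst (ofHeis R)) := by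
  cases h with
  | symmetric h =>
    cases h with
    | square => exact .of (.symmetric .square)
    | braid => exact .of (.symmetric .braid)
  | dotSlide h =>
    cases h with
    | slide =>
      exact (((Represents.act (s R) ⟨[]⟩).seq
        (Represents.padR (u := [up]) (represents_x R ⟨[up]⟩))).sub
        ((represents_x R ⟨[]⟩).padL.seq (.act (s R) ⟨[]⟩))).cong_of_eq (.idd ⟨[]⟩ [up, up])
        ((action R).slide ⟨[]⟩)
  | rightAdjunction h =>
    cases h with
    | up_zigzag => exact .of (.rightAdjunction .up_zigzag)
    | dn_zigzag => exact .of (.rightAdjunction .dn_zigzag)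
  | inv_right =>
    refine Cong.trans (Cong.add (.of .left_right_crossing)
      ((Cong.zero_add _).trans (Cong.seq (.refl (d' R)) (cong_subst_cup R 0)))) ?_
    refine ((Represents.sub (.idd ⟨[]⟩ [dn, up]) (.act (d' R ⨾ c R) ⟨[]⟩)).add
      (.act _ ⟨[]⟩)).cong_of_eq (.idd ⟨[]⟩ [dn, up]) ?_
    exact sub_add_cancel _ _
  | inv_left_crossing => exact .of .right_left_crossing
  | inv_left_crossing_cap r =>
    exact ((represents_t R ⟨[]⟩).seq (.act (d' R) ⟨[]⟩)).cong_of_eq (.zero ⟨[]⟩ [up, dn] [])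
      ((action R).t_d' ⟨[]⟩)
  | inv_left_cup_crossing r =>
    refine (Cong.seq (cong_subst_cup R r) (.refl (t' R))).trans ?_
    exact ((Represents.act (c R) ⟨[]⟩).seq (represents_t' R ⟨[]⟩)).cong_of_eq
      (.zero ⟨[]⟩ [] [up, dn]) ((action R).cup_t' ⟨[]⟩)
  | inv_left_cup_cap_self r =>
    exact (Cong.seq (cong_subst_cup R r) (.refl (d' R))).trans (.of .bubble)
  | inv_left_cup_cap_of_ne r q hrq => exact (hrq (Subsingleton.elim r q)).elim

theorem cong_heisSpecRel ⦃a b : Word⦄ (f g : Diag R (HeisGen 1) a b)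
    (h : HeisSpecRel R one_ne_zero 0 f g) :
    Cong (KhovanovLocalRel R) (f.subst (ofHeis R)) (g.subst (ofHeis R)) := by
  cases h with
  | heis h => exact cong_heisRel R _ _ h
  | bubble =>
    refine ((represents_cup_one R ⟨[]⟩).seq (.act (d' R) ⟨[]⟩)).cong_of_eq
      ((Represents.idd ⟨[]⟩ []).smul 0) ?_
    exact ((Category.assoc _ _ _).trans ((action R).cup_x_cap ⟨[]⟩)).trans (zero_smul R _).symm

theorem cong_leftCup : Cong (KhovanovLocalRel R) (dottedCup (x R) (c R) 1 ⨾ t' R) (c' R) := by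
  refine ((represents_cup_one R ⟨[]⟩).seq (represents_t' R ⟨[]⟩)).cong_of_eq (.act _ ⟨[]⟩) ?_
  exact (Category.assoc _ _ _).trans ((action R).cup_x_t' ⟨[]⟩)

theorem cong_khovanovRel ⦃a b : Word⦄ (f g : Diag R KhovanovGen a b) (h : KhovanovRel R f g) :
    Cong (HeisSpecRel R one_ne_zero 0) (f.subst (toHeis R)) (g.subst (toHeis R)) := by
  cases h with
  | ofLocal h =>
    cases h with
    | rightAdjunction h =>
      cases h with
      | up_zigzag => exact .of (.heis (.rightAdjunction .up_zigzag))
      | dn_zigzag => exact .of (.heis (.rightAdjunction .dn_zigzag))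
    | leftAdjunction h =>
      cases h with
      | up_zigzag => exact Heis.cong_of_leftAdjunctionRel R one_ne_zero 0 _ _ .up_zigzag
      | dn_zigzag => exact Heis.cong_of_leftAdjunctionRel R one_ne_zero 0 _ _ .dn_zigzag
    | symmetric h =>
      cases h with
      | square => exact .of (.heis (.symmetric .square))
      | braid => exact .of (.heis (.symmetric .braid))
    | right_left_crossing => exact Heis.cong_right_left_crossing R one_ne_zero 0
    | left_right_crossing => exact Heis.cong_left_right_crossing_one R
    | leftCurl => exact Heis.cong_leftCurl R one_ne_zero 0
    | bubble =>
      exact Cong.trans (.seq (cong_dottedCup_zero (Heis.x R 1) (Heis.c R 1)).symm (.refl _))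
        (Heis.cong_bubble_self R one_ne_zero 0 0 rfl)
  | cyclic_crossing => exact Heis.cong_cyclic_crossing R one_ne_zero 0

theorem cong_ofHeis_toHeis ⦃a b : Word⦄ (g : KhovanovGen a b) :
    Cong (KhovanovLocalRel R) ((toHeis R g).subst (ofHeis R)) (gen g) := by
  cases g with
  | s => exact .refl _
  | c => exact .refl _
  | d => exact .refl _
  | leftCup =>
    refine Cong.trans (.seq (.of_eq ?_) (.refl _)) (cong_leftCup R)
    exact subst_dottedCup _ _ _ _
  | leftCap => exact .refl _

/-- Cyclicity of the crossing follows from the other relations of Khovanov's category. -/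
theorem cong_local_of_cong {a b : Word} {f g : Diag R KhovanovGen a b}
    (h : Cong (KhovanovRel R) f g) : Cong (KhovanovLocalRel R) f g :=
  -- A congruence is carried to the Heisenberg category, where (C_s) holds, and back to the local
  -- relations; modulo these the round trip fixes `f` and `g`.
  (Cong.subst_subst (cong_ofHeis_toHeis R) f).symm.trans
    (((h.subst (cong_khovanovRel R)).subst (cong_heisSpecRel R)).trans
      (Cong.subst_subst (cong_ofHeis_toHeis R) g))

theorem cong_of_cong_local {a b : Word} {f g : Diag R KhovanovGen a b}
    (h : Cong (KhovanovLocalRel R) f g) : Cong (KhovanovRel R) f g :=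
  h.mono fun _ _ _ _ h => .of (.ofLocal h)

/-- The Heisenberg category of central charge `-1` and Khovanov's category are given by equivalent
presentations. -/
def presEquiv : PresEquiv (HeisSpecRel R one_ne_zero 0) (KhovanovRel R) where
  toFun := ofHeis R
  invFun := toHeis R
  toFun_rel _ _ f g h := cong_of_cong_local R (cong_heisSpecRel R f g h)
  invFun_rel := cong_khovanovRel R
  left_inv a b g := by
    cases g with
    | x => exact Heis.cong_rightCurl R
    | s => exact .refl _
    | c => exact .refl _
    | d => exact .refl _
    | leftCross => exact Heis.cong_leftCrossing R one_ne_zero 0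
    | capDec r =>
      obtain rfl : r = 0 := Subsingleton.elim _ _
      exact .refl _
  right_inv _ _ g := cong_of_cong_local R (cong_ofHeis_toHeis R g)

end Khovanov

end HeisenbergCategory

theorem theorem3 {R : Type u} [CommRing R] :
    -- the Mackaay–Savage category and the specialized Heisenberg category
    (∀ (p : ℕ) [Algebra (ZMod p) R] (lam : ZMod p →₀ ℕ) (hlam : lam ≠ 0),
      ∃ Φ : HeisenbergCategory.StrictMonoidalIso R
          (HeisenbergCategory.Envelope (HeisenbergCategory.HeisSpecRel R
            (HeisenbergCategory.level_ne_zero hlam) (HeisenbergCategory.charge R lam)))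
          (HeisenbergCategory.Envelope (HeisenbergCategory.MSRel R
            (HeisenbergCategory.level lam) (HeisenbergCategory.charge R lam))),
        HeisenbergCategory.Sends Φ (HeisenbergCategory.Heis.x R (HeisenbergCategory.level lam))
          (HeisenbergCategory.MS.x R) ∧
        HeisenbergCategory.Sends Φ (HeisenbergCategory.Heis.s R (HeisenbergCategory.level lam))
          (HeisenbergCategory.MS.s R) ∧
        HeisenbergCategory.Sends Φ (HeisenbergCategory.Heis.c R (HeisenbergCategory.level lam))
          (HeisenbergCategory.MS.c R) ∧
        HeisenbergCategory.Sends Φ (HeisenbergCategory.Heis.d R (HeisenbergCategory.level lam))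
          (HeisenbergCategory.MS.d R) ∧
        HeisenbergCategory.Sends Φ (HeisenbergCategory.Heis.c' R (HeisenbergCategory.level lam))
          (HeisenbergCategory.MS.c' R) ∧
        HeisenbergCategory.Sends Φ
          (HeisenbergCategory.Heis.d' R (HeisenbergCategory.level_ne_zero hlam))
          (HeisenbergCategory.MS.d' R)) ∧
    -- Khovanov's category and the specialized Heisenberg category of central charge -1
    (∃ Φ : HeisenbergCategory.StrictMonoidalIso R
          (HeisenbergCategory.Envelope (HeisenbergCategory.HeisSpecRel R one_ne_zero 0))
          (HeisenbergCategory.Envelope (HeisenbergCategory.KhovanovRel R)),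
        HeisenbergCategory.Sends Φ (HeisenbergCategory.Heis.x R 1)
          (HeisenbergCategory.Diag.rightCurl (HeisenbergCategory.Khovanov.s R)
            (HeisenbergCategory.Khovanov.d R) (HeisenbergCategory.Khovanov.c' R)) ∧
        HeisenbergCategory.Sends Φ (HeisenbergCategory.Heis.s R 1)
          (HeisenbergCategory.Khovanov.s R) ∧
        HeisenbergCategory.Sends Φ (HeisenbergCategory.Heis.c R 1)
          (HeisenbergCategory.Khovanov.c R) ∧
        HeisenbergCategory.Sends Φ (HeisenbergCategory.Heis.d R 1)
          (HeisenbergCategory.Khovanov.d R) ∧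
        HeisenbergCategory.Sends Φ (HeisenbergCategory.Heis.c' R 1)
          (HeisenbergCategory.Khovanov.c' R) ∧
        HeisenbergCategory.Sends Φ (HeisenbergCategory.Heis.d' R one_ne_zero)
          (HeisenbergCategory.Khovanov.d' R)) ∧
    -- cyclicity of the crossing follows from Khovanov's other relations
    (∀ {a b : HeisenbergCategory.Word}
        (f g : HeisenbergCategory.Diag R HeisenbergCategory.KhovanovGen a b),
      HeisenbergCategory.Cong (HeisenbergCategory.KhovanovRel R) f g →
        HeisenbergCategory.Cong (HeisenbergCategory.KhovanovLocalRel R) f g) := by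
  open HeisenbergCategory in
  refine ⟨fun p _ lam hlam => ?_, ?_, fun f g h => Khovanov.cong_local_of_cong R h⟩
  · let E := MS.presEquiv R (level_ne_zero hlam) (charge R lam)
    -- On `x`, `s`, `c`, `d` the substitution is literal; `c'` and `d'` are the images under
    -- `invFun` of the leftward cup and cap, so `right_inv` applies.
    exact ⟨E.toIso, E.sends _ _ (.refl _), E.sends _ _ (.refl _), E.sends _ _ (.refl _),
      E.sends _ _ (.refl _), E.sends _ _ (E.right_inv .leftCup),
      E.sends _ _ (E.right_inv .leftCap)⟩
  · let E := Khovanov.presEquiv R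
    exact ⟨E.toIso, E.sends _ _ (.refl _), E.sends _ _ (.refl _), E.sends _ _ (.refl _),
      E.sends _ _ (.refl _), E.sends _ _ (E.right_inv .leftCup),
      E.sends _ _ (E.right_inv .leftCap)⟩
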